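/- **Theorem 1 (Quadratic response in the zero-noise limit for a smooth expanding map).** Let $\mathbb S^1=\mathbb R/\mathbb Z$ and let $T:\mathbb S^1\to\mathbb S^1$ be a $C^8$ expanding map, i.e. $|T'(x)|\ge\alpha^{-1}>1$ for all $x$ and some constant $\alpha$. Let $\rho\ge 0$ be a function of bounded variation on $[-1,1]$, extended by $0$, with $\int_{-1}^1\rho(x)\,dx=1$ and $\int_{-1}^1 x\rho(x)\,dx=0$, and put $\sigma^2(\rho)=\int_{-1}^1x^2\rho(x)\,dx$. For $\delta\in(0,1]$ let $\rho_\delta(x)=\frac1\delta\rho(\frac x\delta)$, and let $\rho_0$ be the Dirac mass at $0$. Let $L_T$ be the transfer operator of $T$ on finite signed Borel measures, $(L_T\mu)(A)=\mu(T^{-1}(A))$, and let $L_\delta=\rho_\delta * L_T$ be the transfer operator of the system $X_{n+1}=T(X_n)+\Omega_n \bmod 1$ with i.i.d. noise $\Omega_n$ of law $\rho_\delta$ (convolution on $\mathbb S^1$). Functions in $L^1(\mathbb S^1)$ are identified with signed measures through their densities. Then: (a) For every $\delta\in[0,1]$ there is a probability density $h_\delta\in W^{7,1}(\mathbb S^1)$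 with $L_\delta h_\delta=h_\delta$, and it is the only $f\in L^1(\mathbb S^1)$ with $\int f=1$ and $L_\delta f=f$. (b) On $V=\{f\in W^{1,1}(\mathbb S^1):\int f=0\}$ the operator $Id-L_T$ is invertible with bounded inverse $(Id-L_T)^{-1}f=\sum_{i\ge0}L_T^if$ (convergence in $W^{1,1}$), and $h_0''\in V$. (c) The map $\delta\mapsto h_\delta$ has an order two Taylor expansion at $\delta=0$ in $W^{1,1}$, with vanishing linear term: $$\left\|\frac{h_\delta-h_0}{\delta}\right\|_{W^{1,1}}\longrightarrow0,\qquad \left\|\frac{h_\delta-h_0}{\delta^2}-\frac{\sigma^2(\rho)}2(Id-L_T)^{-1}h_0''\right\|_{W^{1,1}}\longrightarrow 0\qquad(\delta\to0^+).$$ In particular there is a constant $C$ with $\|h_\delta-h_0\|_{W^{1,1}}\le C\delta^2$ for all sufficiently small $\delta>0$. -/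

import Mathlib

open MeasureTheory Filter Topology

noncomputable section

namespace ZeroNoise

/-! ### Sobolev spaces `W^{k,1}` of the circle `ℝ / ℤ` -/

/-- Derivative of a function on the circle, computed in the angular coordinate. -/
def circleDeriv (φ : UnitAddCircle → ℝ) : UnitAddCircle → ℝ :=
  fun x => deriv (fun t : ℝ => φ (x + (t : UnitAddCircle))) 0

/-- `C^∞` functions on the circle, i.e. functions whose `1`-periodic lift to `ℝ` is smooth. -/
def IsTestFunction (φ : UnitAddCircle → ℝ) : Prop :=
  ContDiff ℝ (⊤ : ℕ∞) (fun t : ℝ => φ (t : UnitAddCircle))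

/-- `g ∈ L¹` is an `i`-th weak derivative of `f`. -/
def IsWeakDeriv (i : ℕ) (f g : UnitAddCircle → ℝ) : Prop :=
  Integrable g ∧ ∀ φ : UnitAddCircle → ℝ, IsTestFunction φ →
    ∫ x, f x * (circleDeriv^[i] φ) x = (-1) ^ i * ∫ x, g x * φ x

open Classical in
/-- The `i`-th weak derivative of `f` (unique almost everywhere), and `0` if there is none. -/
def weakDeriv (i : ℕ) (f : UnitAddCircle → ℝ) : UnitAddCircle → ℝ :=
  if h : ∃ g, IsWeakDeriv i f g then h.choose else 0

/-- Membership in the Sobolev space `W^{k,1}` of the circle. -/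
def MemW (k : ℕ) (f : UnitAddCircle → ℝ) : Prop :=
  Integrable f ∧ ∀ i, 1 ≤ i → i ≤ k → ∃ g, IsWeakDeriv i f g

/-- Membership in the subspace of `W^{k,1}` of functions of zero average. -/
def MemV (k : ℕ) (f : UnitAddCircle → ℝ) : Prop :=
  MemW k f ∧ ∫ x, f x = 0

/-- The norm `‖f‖_{L¹} + ‖f'‖_{L¹} + ⋯ + ‖f^{(k)}‖_{L¹}` of `W^{k,1}`. -/
def sobolevNorm (k : ℕ) (f : UnitAddCircle → ℝ) : ℝ :=
  (∫ x, |f x|) + ∑ i ∈ Finset.Icc 1 k, ∫ x, |weakDeriv i f x|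

/-! ### Expanding maps, noise, transfer operators -/

/-- `T` is a `C^n` expanding map of the circle: it has a `C^n` lift `F : ℝ → ℝ` with
`|F'| ≥ c` for some constant `c > 1`. -/
def IsExpanding (n : ℕ) (T : UnitAddCircle → UnitAddCircle) : Prop :=
  ∃ F : ℝ → ℝ, ContDiff ℝ (n : ℕ∞) F ∧ (∀ x : ℝ, T (x : UnitAddCircle) = (F x : UnitAddCircle)) ∧
    ∃ c : ℝ, 1 < c ∧ ∀ x : ℝ, c ≤ |deriv F x|

/-- `ρ` is a probability density of bounded variation on `[-1, 1]` (extended by `0` to `ℝ`)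
with zero average. -/
structure IsNoiseKernel (ρ : ℝ → ℝ) : Prop where
  nonneg : ∀ x, 0 ≤ ρ x
  eq_zero : ∀ x, x ∉ Set.Icc (-1 : ℝ) 1 → ρ x = 0
  boundedVariation : BoundedVariationOn ρ (Set.Icc (-1 : ℝ) 1)
  integral_eq_one : ∫ x in (-1 : ℝ)..1, ρ x = 1
  integral_mul_eq_zero : ∫ x in (-1 : ℝ)..1, x * ρ x = 0

/-- `σ²(ρ)`. -/
def noiseVariance (ρ : ℝ → ℝ) : ℝ := ∫ x in (-1 : ℝ)..1, x ^ 2 * ρ x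

/-- The rescaled kernel `ρ_δ(x) = ρ(x / δ) / δ`. -/
def scaledKernel (ρ : ℝ → ℝ) (δ : ℝ) : ℝ → ℝ := fun x => 1 / δ * ρ (x / δ)

/-- The law on the circle of the noise of amplitude `δ`: the measure `ρ_δ(x) dx` taken modulo `1`
for `δ ≠ 0`, the Dirac mass at `0` for `δ = 0`. -/
def noise (ρ : ℝ → ℝ) (δ : ℝ) : SignedMeasure UnitAddCircle :=
  open Classical in
  if δ = 0 then (Measure.dirac (0 : UnitAddCircle)).toSignedMeasure
  else ((volume : Measure ℝ).withDensityᵥ (scaledKernel ρ δ)).map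
    (fun x : ℝ => (x : UnitAddCircle))

/-- Convolution of finite signed measures on the circle: the image of the product measure
under addition. -/
def signedConv (μ ν : SignedMeasure UnitAddCircle) : SignedMeasure UnitAddCircle :=
  (μ.prod ν (ContinuousLinearMap.mul ℝ ℝ)).map
    (fun p : UnitAddCircle × UnitAddCircle => p.1 + p.2)

/-- The transfer operator `L_T` on signed measures, `(L_T μ)(A) = μ(T⁻¹ A)`. -/
def transfer (T : UnitAddCircle → UnitAddCircle) (μ : SignedMeasure UnitAddCircle) :
    SignedMeasure UnitAddCircle :=
  μ.map T

/-- The annealed transfer operator `L_δ = ρ_δ * L_T`. -/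
def noisyTransfer (T : UnitAddCircle → UnitAddCircle) (ρ : ℝ → ℝ) (δ : ℝ)
    (μ : SignedMeasure UnitAddCircle) : SignedMeasure UnitAddCircle :=
  signedConv (noise ρ δ) (transfer T μ)

/-- The signed measure `f(x) dx`, by which an integrable function is seen as a signed measure. -/
def toMeasure (f : UnitAddCircle → ℝ) : SignedMeasure UnitAddCircle :=
  (volume : Measure UnitAddCircle).withDensityᵥ f

/-- `h` is the density of the stationary measure of the system perturbed with noise of amplitude
`δ`: a probability density in `W^{k,1}`, fixed by `L_δ`, and the only `L¹` function of integral `1`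
that is fixed by `L_δ`. -/
structure IsStationaryDensity (k : ℕ) (T : UnitAddCircle → UnitAddCircle) (ρ : ℝ → ℝ) (δ : ℝ)
    (h : UnitAddCircle → ℝ) : Prop where
  memW : MemW k h
  nonneg : 0 ≤ᵐ[volume] h
  integral_eq_one : ∫ x, h x = 1
  fixed : noisyTransfer T ρ δ (toMeasure h) = toMeasure h
  unique : ∀ f : UnitAddCircle → ℝ, Integrable f → ∫ x, f x = 1 →
    noisyTransfer T ρ δ (toMeasure f) = toMeasure f → f =ᵐ[volume] h

/-- `R` is the operator `(Id - L_T)⁻¹` on the zero average part of `W^{k,1}`: the bounded two-sided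
inverse of `Id - L_T` there, given by the Neumann series `∑ L_T^i`. Functions are identified with
the signed measures that they define. -/
structure IsResolvent (k : ℕ) (T : UnitAddCircle → UnitAddCircle)
    (R : (UnitAddCircle → ℝ) → (UnitAddCircle → ℝ)) : Prop where
  memV : ∀ f, MemV k f → MemV k (R f)
  right_inv : ∀ f, MemV k f → toMeasure (R f) - transfer T (toMeasure (R f)) = toMeasure f
  unique : ∀ f g, MemV k f → MemV k g → toMeasure g - transfer T (toMeasure g) = toMeasure f →
    g =ᵐ[volume] R f
  bounded : ∃ C : ℝ, ∀ f, MemV k f → sobolevNorm k (R f) ≤ C * sobolevNorm k f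
  neumann : ∀ f, MemV k f → ∃ s : ℕ → UnitAddCircle → ℝ,
    (∀ n, MemV k (s n) ∧
      toMeasure (s n) = ∑ i ∈ Finset.range n, (transfer T)^[i] (toMeasure f)) ∧
    Tendsto (fun n => sobolevNorm k (fun x => s n x - R f x)) atTop (𝓝 0)

end ZeroNoise

end

noncomputable section

namespace ZeroNoise

section

/-! ### Transfer operators of expanding lifts -/

/-- A lift `F` of an expanding circle map, with its inverse `G`. -/
structure ExpandingLift where
  F : ℝ → ℝ
  G : ℝ → ℝ
  s : ℝ
  α : ℝ
  D : ℕ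
  s_eq : s = 1 ∨ s = -1
  α_pos : 0 < α
  α_lt_one : α < 1
  leftInv : ∀ x, G (F x) = x
  rightInv : ∀ x, F (G x) = x
  contDiff_F : ContDiff ℝ 2 F
  contDiff_G : ContDiff ℝ 2 G
  one_le : ∀ x, 1 ≤ α * (s * deriv F x)
  F_add_one : ∀ x, F (x + 1) = F x + s * D

namespace ExpandingLift

variable (E : ExpandingLift)

/-- The reciprocal of the derivative of the lift. -/
def c (y : ℝ) : ℝ := (deriv E.F y)⁻¹

/-- The absolute value of the reciprocal of the derivative of the lift. -/
def weight (y : ℝ) : ℝ := E.s * E.c y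

lemma s_mul_deriv_pos (x : ℝ) : 0 < E.s * deriv E.F x := by
  have := E.one_le x
  by_contra h
  nlinarith [E.α_pos, mul_nonneg E.α_pos.le (sub_nonneg.2 (not_lt.1 h))]

lemma deriv_ne_zero (x : ℝ) : deriv E.F x ≠ 0 := by
  intro h
  have := E.s_mul_deriv_pos x
  simp [h] at this

lemma weight_eq (y : ℝ) : E.weight y = (E.s * deriv E.F y)⁻¹ := by
  unfold weight c
  rcases E.s_eq with h | h <;> rw [h] <;> simp [inv_neg]

lemma weight_pos (y : ℝ) : 0 < E.weight y := by
  rw [weight_eq]; exact inv_pos.2 (E.s_mul_deriv_pos y)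

lemma weight_le (y : ℝ) : E.weight y ≤ E.α := by
  rw [weight_eq]
  have h := E.s_mul_deriv_pos y
  rw [inv_le_iff_one_le_mul₀ h]
  exact E.one_le y

lemma abs_s : |E.s| = 1 := by
  rcases E.s_eq with h | h <;> rw [h] <;> norm_num

lemma abs_c (y : ℝ) : |E.c y| = E.weight y := by
  have h := abs_mul E.s (E.c y)
  rw [E.abs_s, one_mul] at h
  rw [← h]; exact abs_of_pos (E.weight_pos y)

lemma abs_c_le (y : ℝ) : |E.c y| ≤ E.α := by
  rw [abs_c]; exact E.weight_le y

lemma differentiable_F : Differentiable ℝ E.F := E.contDiff_F.differentiable (by norm_num)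
lemma differentiable_G : Differentiable ℝ E.G := E.contDiff_G.differentiable (by norm_num)

lemma hasDerivAt_G (x : ℝ) : HasDerivAt E.G (E.c (E.G x)) x := by
  have h := (E.differentiable_F (E.G x)).hasDerivAt.comp x (E.differentiable_G x).hasDerivAt
  have h2 : HasDerivAt (E.F ∘ E.G) 1 x := by
    have : E.F ∘ E.G = id := funext E.rightInv
    rw [this]; exact hasDerivAt_id x
  have h3 := h.unique h2
  have h4 : deriv E.G x = E.c (E.G x) := by
    unfold c
    exact eq_inv_of_mul_eq_one_right h3
  rw [← h4]
  exact (E.differentiable_G x).hasDerivAt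

lemma deriv_G (x : ℝ) : deriv E.G x = E.c (E.G x) := (E.hasDerivAt_G x).deriv

lemma G_injective : Function.Injective E.G := Function.LeftInverse.injective E.rightInv

lemma deriv_F_periodic : Function.Periodic (deriv E.F) 1 := by
  intro x
  have h : (fun y => E.F (y + 1)) = fun y => E.F y + E.s * E.D := funext E.F_add_one
  have h2 := congrArg (fun f => deriv f x) h
  simpa [deriv_comp_add_const] using h2

lemma c_periodic : Function.Periodic E.c 1 := fun x => by
  unfold c; rw [E.deriv_F_periodic x]

lemma weight_periodic : Function.Periodic E.weight 1 := fun x => by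
  unfold weight; rw [E.c_periodic x]

lemma F_add_s (y : ℝ) : E.F (y + E.s) = E.F y + E.D := by
  rcases E.s_eq with h | h
  · rw [h, E.F_add_one, h]; ring
  · have := E.F_add_one (y + E.s)
    rw [h] at this ⊢
    have e : y + -1 + 1 = y := by ring
    rw [e] at this
    rw [this]; ring

lemma G_add_D (x : ℝ) : E.G (x + E.D) = E.G x + E.s := by
  have h := E.F_add_s (E.G x)
  rw [E.rightInv] at h
  rw [← h, E.leftInv]

lemma _root_.Function.Periodic.add_s {E : ExpandingLift} {f : ℝ → ℝ} (hf : Function.Periodic f 1)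
    (x : ℝ) : f (x + E.s) = f x := by
  rcases E.s_eq with h | h <;> rw [h]
  · exact hf x
  · have := hf.sub_eq x
    rw [← this]; congr 1

lemma contDiff_c {k : ℕ} (hF : ContDiff ℝ (k + 1 : ℕ) E.F) : ContDiff ℝ k E.c := by
  unfold c
  refine ContDiff.inv ?_ E.deriv_ne_zero
  have := (contDiff_succ_iff_deriv (n := (k : WithTop ℕ∞)) (f := E.F) (𝕜 := ℝ)).1 (by exact_mod_cast hF)
  exact this.2.2

lemma contDiff_one_c : ContDiff ℝ 1 E.c := by
  have := E.contDiff_c (k := 1) (by exact_mod_cast E.contDiff_F)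
  exact_mod_cast this

lemma continuous_c : Continuous E.c := E.contDiff_one_c.continuous

lemma contDiff_G' {k : ℕ} (hF : ContDiff ℝ (k + 1 : ℕ) E.F) : ContDiff ℝ k E.G := by
  have key : ∀ m : ℕ, m ≤ k → ContDiff ℝ m E.G := by
    intro m
    induction m with
    | zero => intro _; exact_mod_cast contDiff_zero.2 E.differentiable_G.continuous
    | succ m ih =>
      intro hm
      have h := ih (by omega)
      have : ContDiff ℝ ((m : WithTop ℕ∞) + 1) E.G := by
        rw [contDiff_succ_iff_deriv]
        refine ⟨E.differentiable_G, by simp, ?_⟩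
        have e : deriv E.G = E.c ∘ E.G := funext E.deriv_G
        rw [e]
        exact ((E.contDiff_c hF).of_le (by exact_mod_cast (by omega : m ≤ k))).comp h
      exact_mod_cast this
  exact key k le_rfl

/-- The transfer operator of an expanding circle map, acting on periodic functions. -/
def transferOp : (ℝ → ℝ) →ₗ[ℝ] (ℝ → ℝ) where
  toFun f x := ∑ j ∈ Finset.range E.D, E.weight (E.G (x + j)) * f (E.G (x + j))
  map_add' f g := by
    funext x; simp only [Pi.add_apply, mul_add, Finset.sum_add_distrib]
  map_smul' a f := by
    funext x; simp only [Pi.smul_apply, smul_eq_mul, RingHom.id_apply, Finset.mul_sum]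
    exact Finset.sum_congr rfl fun j _ => by ring

lemma transferOp_apply (f : ℝ → ℝ) (x : ℝ) : E.transferOp f x =
    ∑ j ∈ Finset.range E.D, E.weight (E.G (x + j)) * f (E.G (x + j)) := rfl

variable {E}

lemma transferOp_periodic {f : ℝ → ℝ} (hf : Function.Periodic f 1) :
    Function.Periodic (E.transferOp f) 1 := by
  intro x
  simp only [transferOp_apply]
  set a : ℕ → ℝ := fun j => E.weight (E.G (x + j)) * f (E.G (x + j)) with ha
  have h1 : ∀ j : ℕ, E.weight (E.G (x + 1 + j)) * f (E.G (x + 1 + j)) = a (j + 1) := by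
    intro j; simp only [ha]; push_cast; rw [show x + 1 + (j : ℝ) = x + (j + 1) by ring]
  simp only [h1]
  have h2 : a E.D = a 0 := by
    simp only [ha, Nat.cast_zero, add_zero]
    rw [E.G_add_D, hf.add_s, E.weight_periodic.add_s]
  have h3 := Finset.sum_range_succ a E.D
  have h4 := Finset.sum_range_succ' a E.D
  linarith

lemma transferOp_mono {f g : ℝ → ℝ} (h : ∀ x, f x ≤ g x) (x : ℝ) :
    E.transferOp f x ≤ E.transferOp g x := by
  rw [transferOp_apply, transferOp_apply]
  exact Finset.sum_le_sum fun _ _ => mul_le_mul_of_nonneg_left (h _) (E.weight_pos _).le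

lemma abs_transferOp_le (f : ℝ → ℝ) (x : ℝ) :
    |E.transferOp f x| ≤ E.transferOp (fun y => |f y|) x := by
  rw [transferOp_apply, transferOp_apply]
  refine (Finset.abs_sum_le_sum_abs _ _).trans (le_of_eq ?_)
  exact Finset.sum_congr rfl fun j _ => by rw [abs_mul, abs_of_pos (E.weight_pos _)]

lemma transferOp_nonneg {f : ℝ → ℝ} (h : ∀ x, 0 ≤ f x) (x : ℝ) : 0 ≤ E.transferOp f x := by
  rw [transferOp_apply]
  exact Finset.sum_nonneg fun _ _ => mul_nonneg (E.weight_pos _).le (h _)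

lemma abs_transferOp_le_of_le {f : ℝ → ℝ} {M : ℝ} (h : ∀ x, |f x| ≤ M) (x : ℝ) :
    |E.transferOp f x| ≤ E.D * M := by
  have hM : 0 ≤ M := (abs_nonneg _).trans (h 0)
  rw [transferOp_apply]
  refine (Finset.abs_sum_le_sum_abs _ _).trans ?_
  refine (Finset.sum_le_sum (g := fun _ => M) fun j _ => ?_).trans (by simp)
  rw [abs_mul, abs_of_pos (E.weight_pos _)]
  calc _ ≤ 1 * M := mul_le_mul ((E.weight_le _).trans E.α_lt_one.le) (h _) (abs_nonneg _) zero_le_one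
    _ = M := one_mul M

lemma transferOp_mul_comp (f φ : ℝ → ℝ) (hφ : Function.Periodic φ 1) (x : ℝ) :
    E.transferOp (fun y => f y * φ (E.F y)) x = E.transferOp f x * φ x := by
  simp only [transferOp_apply, Finset.sum_mul]
  refine Finset.sum_congr rfl fun j _ => ?_
  rw [E.rightInv, show φ (x + j) = φ x by simpa using hφ.nat_mul j x]
  ring

lemma transferOp_eq (f : ℝ → ℝ) (x : ℝ) : E.transferOp f x =
    ∑ j ∈ Finset.range E.D, E.s * ((E.c * f) (E.G (x + j))) := by
  rw [transferOp_apply]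
  exact Finset.sum_congr rfl fun j _ => by simp only [weight, Pi.mul_apply]; ring

lemma contDiff_transferOp {k : ℕ} (hF : ContDiff ℝ (k + 1 : ℕ) E.F) {f : ℝ → ℝ}
    (hf : ContDiff ℝ k f) : ContDiff ℝ k (E.transferOp f) := by
  have : E.transferOp f = fun x => ∑ j ∈ Finset.range E.D, E.s * ((E.c * f) (E.G (x + j))) :=
    funext fun x => transferOp_eq f x
  rw [this]
  refine ContDiff.sum fun j _ => contDiff_const.mul ?_
  exact ((E.contDiff_c hF).mul hf).comp ((E.contDiff_G' hF).comp (contDiff_id.add contDiff_const))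

lemma continuous_transferOp {f : ℝ → ℝ} (hf : Continuous f) : Continuous (E.transferOp f) := by
  have : E.transferOp f = fun x => ∑ j ∈ Finset.range E.D, E.s * ((E.c * f) (E.G (x + j))) :=
    funext fun x => transferOp_eq f x
  rw [this]
  refine continuous_finsetSum _ fun j _ => continuous_const.mul ?_
  exact (E.continuous_c.mul hf).comp (E.differentiable_G.continuous.comp (by fun_prop))

lemma hasDerivAt_transferOp {f : ℝ → ℝ} (hf : Differentiable ℝ f) (x : ℝ) :
    HasDerivAt (E.transferOp f) (E.transferOp (deriv (E.c * f)) x) x := by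
  have : E.transferOp f = fun x => ∑ j ∈ Finset.range E.D, E.s * ((E.c * f) (E.G (x + j))) :=
    funext fun x => transferOp_eq f x
  rw [this, transferOp_apply]
  refine HasDerivAt.fun_sum fun j _ => ?_
  have hd : Differentiable ℝ (E.c * f) :=
    (E.contDiff_one_c.differentiable (by norm_num)).mul hf
  have h1 : HasDerivAt (fun y : ℝ => E.G (y + j)) (E.c (E.G (x + j))) x :=
    (E.hasDerivAt_G (x + j)).comp_add_const x _
  have h2 := ((hd (E.G (x + j))).hasDerivAt.comp x h1).const_mul E.s
  refine h2.congr_deriv ?_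
  simp only [weight]; ring

lemma deriv_transferOp {f : ℝ → ℝ} (hf : Differentiable ℝ f) :
    deriv (E.transferOp f) = E.transferOp (deriv (E.c * f)) :=
  funext fun x => (hasDerivAt_transferOp hf x).deriv

end ExpandingLift

end

section

/-! ### Change of variables -/

namespace ExpandingLift
variable {E : ExpandingLift}

lemma image_G_Icc : E.G '' Set.Icc 0 (E.D : ℝ) = Set.uIcc (E.G 0) (E.G E.D) := by
  have h0 : (0:ℝ) ≤ E.D := Nat.cast_nonneg _
  have himg : E.G '' Set.Icc 0 (E.D : ℝ) = E.F ⁻¹' Set.Icc 0 (E.D : ℝ) :=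
    congrFun (Set.image_eq_preimage_of_inverse E.rightInv E.leftInv) _
  rw [himg]
  rcases E.s_eq with h | h
  · have hmono : StrictMono E.F := strictMono_of_deriv_pos fun x => by
      simpa [h] using E.s_mul_deriv_pos x
    have hle : E.G 0 ≤ E.G E.D := by
      rw [← hmono.le_iff_le, E.rightInv, E.rightInv]; exact h0
    rw [Set.uIcc_of_le hle]
    ext y
    simp only [Set.mem_preimage, Set.mem_Icc]
    rw [← hmono.le_iff_le (a := E.G 0), ← hmono.le_iff_le (b := E.G E.D), E.rightInv, E.rightInv]
  · have hanti : StrictAnti E.F := strictAnti_of_deriv_neg fun x => by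
      have := E.s_mul_deriv_pos x
      rw [h] at this; linarith
    have hle : E.G E.D ≤ E.G 0 := by
      rw [← hanti.le_iff_ge, E.rightInv, E.rightInv]; exact h0
    rw [Set.uIcc_of_ge hle]
    ext y
    simp only [Set.mem_preimage, Set.mem_Icc]
    rw [← hanti.le_iff_ge (b := E.G E.D), ← hanti.le_iff_ge (a := E.G 0), E.rightInv, E.rightInv]
    tauto

lemma abs_deriv_G (x : ℝ) : |E.c (E.G x)| = E.weight (E.G x) := E.abs_c _

lemma integrableOn_branch {f : ℝ → ℝ} (hf : Function.Periodic f 1)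
    (hi : IntervalIntegrable f volume 0 1) :
    IntegrableOn (fun x => E.weight (E.G x) * f (E.G x)) (Set.Icc 0 (E.D : ℝ)) := by
  have h := (integrableOn_image_iff_integrableOn_abs_deriv_smul (f := E.G)
    (f' := fun x => E.c (E.G x)) (s := Set.Icc 0 (E.D : ℝ)) measurableSet_Icc
    (fun x _ => (E.hasDerivAt_G x).hasDerivWithinAt) E.G_injective.injOn f).1
  simp only [abs_deriv_G, smul_eq_mul] at h
  apply h
  rw [image_G_Icc, ← intervalIntegrable_iff']
  exact hf.intervalIntegrable₀ one_ne_zero hi _ _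

lemma integral_branch {f : ℝ → ℝ} (hf : Function.Periodic f 1) :
    ∫ x in (0:ℝ)..E.D, E.weight (E.G x) * f (E.G x) = ∫ x in (0:ℝ)..1, f x := by
  have h := integral_image_eq_integral_abs_deriv_smul (f := E.G)
    (f' := fun x => E.c (E.G x)) (s := Set.Icc 0 (E.D : ℝ)) measurableSet_Icc
    (fun x _ => (E.hasDerivAt_G x).hasDerivWithinAt) E.G_injective.injOn f
  simp only [abs_deriv_G, smul_eq_mul] at h
  rw [intervalIntegral.integral_of_le (Nat.cast_nonneg _), ← integral_Icc_eq_integral_Ioc, ← h,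
    image_G_Icc]
  have hD : E.G E.D = E.G 0 + E.s := by simpa using E.G_add_D 0
  have hp : ∀ a, ∫ x in Set.Icc a (a + 1), f x = ∫ x in (0:ℝ)..1, f x := fun a => by
    rw [integral_Icc_eq_integral_Ioc, ← intervalIntegral.integral_of_le (by linarith)]
    simpa using hf.intervalIntegral_add_eq a 0
  rcases E.s_eq with hs | hs
  · rw [hD, hs, Set.uIcc_of_le (by linarith), hp]
  · rw [hD, hs, Set.uIcc_of_ge (by linarith), ← hp (E.G 0 + -1)]
    congr 3; ring

lemma transferOp_eq_sum_branch (f : ℝ → ℝ) : E.transferOp f = fun x =>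
    ∑ j ∈ Finset.range E.D, (fun y => E.weight (E.G y) * f (E.G y)) (x + j) := rfl

lemma intervalIntegrable_branch {f : ℝ → ℝ} (hf : Function.Periodic f 1)
    (hi : IntervalIntegrable f volume 0 1) {j : ℕ} (hj : j < E.D) :
    IntervalIntegrable (fun x => E.weight (E.G x) * f (E.G x)) volume j (j + 1 : ℕ) := by
  have h : (j : ℝ) ≤ (j + 1 : ℕ) := by push_cast; linarith
  rw [intervalIntegrable_iff_integrableOn_Icc_of_le h]
  refine (integrableOn_branch hf hi).mono_set (Set.Icc_subset_Icc (Nat.cast_nonneg _) ?_)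
  exact_mod_cast hj

lemma intervalIntegrable_branch_shift {f : ℝ → ℝ} (hf : Function.Periodic f 1)
    (hi : IntervalIntegrable f volume 0 1) {j : ℕ} (hj : j < E.D) :
    IntervalIntegrable (fun x => (fun y => E.weight (E.G y) * f (E.G y)) (x + j)) volume 0 1 := by
  have := (intervalIntegrable_branch hf hi hj).comp_add_right (j : ℝ)
  simpa using this

lemma intervalIntegrable_transferOp {f : ℝ → ℝ} (hf : Function.Periodic f 1)
    (hi : IntervalIntegrable f volume 0 1) :
    IntervalIntegrable (E.transferOp f) volume 0 1 := by
  rw [transferOp_eq_sum_branch]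
  have h := IntervalIntegrable.sum (μ := volume) (Finset.range E.D)
    (f := fun (j : ℕ) x => (fun y => E.weight (E.G y) * f (E.G y)) (x + j)) fun j hj =>
    intervalIntegrable_branch_shift hf hi (Finset.mem_range.1 hj)
  rwa [Finset.sum_fn] at h

lemma integral_transferOp {f : ℝ → ℝ} (hf : Function.Periodic f 1)
    (hi : IntervalIntegrable f volume 0 1) :
    ∫ x in (0:ℝ)..1, E.transferOp f x = ∫ x in (0:ℝ)..1, f x := by
  rw [transferOp_eq_sum_branch, intervalIntegral.integral_finsetSum fun j hj =>
    intervalIntegrable_branch_shift hf hi (Finset.mem_range.1 hj)]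
  rw [← integral_branch (E := E) hf]
  have h := intervalIntegral.sum_integral_adjacent_intervals (μ := volume)
    (f := fun x => E.weight (E.G x) * f (E.G x)) (a := fun n : ℕ => (n : ℝ)) (n := E.D)
    (fun j hj => intervalIntegrable_branch hf hi hj)
  simp only [Nat.cast_zero] at h
  rw [← h]
  refine Finset.sum_congr rfl fun j _ => ?_
  rw [intervalIntegral.integral_comp_add_right (fun y => E.weight (E.G y) * f (E.G y))]
  congr 1
  · simp
  · push_cast; ring

/-- The operator `f ↦ (c f)'`, which conjugates the transfer operator with the derivative. -/
def twist (E : ExpandingLift) (f : ℝ → ℝ) : ℝ → ℝ := deriv (E.c * f)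

lemma _root_.Function.Periodic.deriv' {f : ℝ → ℝ} (hf : Function.Periodic f 1) :
    Function.Periodic (deriv f) 1 := by
  intro x
  have h : (fun y => f (y + 1)) = f := funext hf
  have h2 := congrArg (fun f => deriv f x) h
  simpa [deriv_comp_add_const] using h2

lemma _root_.Function.Periodic.iteratedDeriv' {f : ℝ → ℝ} (hf : Function.Periodic f 1) (i : ℕ) :
    Function.Periodic (iteratedDeriv i f) 1 := by
  induction i with
  | zero => simpa using hf
  | succ i ih => rw [iteratedDeriv_succ]; exact ih.deriv'

lemma _root_.Function.Periodic.exists_abs_le {f : ℝ → ℝ} (hf : Function.Periodic f 1)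
    (hc : Continuous f) : ∃ C, ∀ x, |f x| ≤ C := by
  obtain ⟨C, hC⟩ := isCompact_Icc (a := (0:ℝ)) (b := 1) |>.exists_bound_of_continuousOn hc.continuousOn
  refine ⟨C, fun x => ?_⟩
  obtain ⟨y, hy, hxy⟩ := hf.exists_mem_Ico₀ one_pos x
  rw [hxy]
  exact hC y ⟨hy.1, hy.2.le⟩

/-- Coefficients of the iterates of `twist` as differential operators. -/
lemma exists_coeff_iterate_twist {k : ℕ} (hF : ContDiff ℝ (k + 1 : ℕ) E.F) (i : ℕ) (hi : i ≤ k) :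
    ∃ κ : ℕ → ℝ → ℝ, (∀ j, ContDiff ℝ (k - i : ℕ) (κ j)) ∧ (∀ j, Function.Periodic (κ j) 1) ∧
      ∀ f : ℝ → ℝ, ContDiff ℝ k f → (E.twist^[i] f) = fun x =>
        E.c x ^ i * iteratedDeriv i f x + ∑ j ∈ Finset.range i, κ j x * iteratedDeriv j f x := by
  induction i with
  | zero => exact ⟨fun _ _ => 0, fun _ => contDiff_const, fun _ _ => rfl, fun f _ => by simp⟩
  | succ i ih =>
    obtain ⟨κ, hκ, hκp, hκf⟩ := ih (by omega)
    have hcd : ContDiff ℝ k E.c := E.contDiff_c hF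
    have hk1 : ((k - i : ℕ) : WithTop ℕ∞) = ((k - (i + 1) : ℕ) : WithTop ℕ∞) + 1 := by
      have : k - i = k - (i + 1) + 1 := by omega
      rw [this]; push_cast; rfl
    have hci : ContDiff ℝ (k - i : ℕ) E.c := hcd.of_le (by exact_mod_cast (by omega : k - i ≤ k))
    have hdc : ∀ g : ℝ → ℝ, ContDiff ℝ (k - i : ℕ) g → ContDiff ℝ (k - (i + 1) : ℕ) (deriv g) := by
      intro g hg; rw [hk1, contDiff_succ_iff_deriv] at hg; exact hg.2.2
    have hlow : ∀ g : ℝ → ℝ, ContDiff ℝ (k - i : ℕ) g → ContDiff ℝ (k - (i + 1) : ℕ) g :=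
      fun g hg => hg.of_le (by exact_mod_cast (by omega : k - (i + 1) ≤ k - i))
    have hdiff : ∀ g : ℝ → ℝ, ContDiff ℝ (k - i : ℕ) g → Differentiable ℝ g := fun g hg =>
      hg.differentiable (by
        have : 1 ≤ k - i := by omega
        intro h0
        have : k - i = 0 := by exact_mod_cast h0
        omega)
    have hcp := E.c_periodic
    refine ⟨fun j => (if j = i then deriv (fun x => E.c x ^ (i + 1)) else deriv (E.c * κ j)) +
      (if j = 0 then 0 else if j ≤ i then E.c * κ (j - 1) else 0), fun j => ?_, fun j => ?_, ?_⟩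
    · refine ContDiff.add ?_ ?_
      · split_ifs
        · exact hdc _ (hci.pow _)
        · exact hdc _ (hci.mul (hκ j))
      · split_ifs
        · exact contDiff_const
        · exact hlow _ (hci.mul (hκ _))
        · exact contDiff_const
    · have h1 : Function.Periodic (deriv (fun x => E.c x ^ (i + 1))) 1 := by
        apply Function.Periodic.deriv'
        intro x; simp only [hcp x]
      have h2 : ∀ j, Function.Periodic (E.c * κ j) 1 := fun j => hcp.mul (hκp j)
      refine Function.Periodic.add ?_ ?_
      · split_ifs
        exacts [h1, (h2 j).deriv']
      · split_ifs
        exacts [fun x => rfl, h2 _, fun x => rfl]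
    · intro f hf
      rw [Function.iterate_succ_apply', hκf f hf]
      funext x
      have hfd : ∀ j, j ≤ i → DifferentiableAt ℝ (iteratedDeriv j f) x := fun j hj =>
        (hf.differentiable_iteratedDeriv j (by exact_mod_cast (by omega : j < k))) x
      have hc1 : HasDerivAt (fun y => E.c y ^ (i + 1) * iteratedDeriv i f y)
          (deriv (fun x => E.c x ^ (i + 1)) x * iteratedDeriv i f x +
            E.c x ^ (i + 1) * iteratedDeriv (i + 1) f x) x := by
        refine HasDerivAt.fun_mul ((hdiff _ (hci.pow (i + 1))) x).hasDerivAt ?_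
        rw [iteratedDeriv_succ]
        exact (hfd i le_rfl).hasDerivAt
      have hc2 : HasDerivAt (fun y => ∑ j ∈ Finset.range i, (E.c * κ j) y * iteratedDeriv j f y)
          (∑ j ∈ Finset.range i, (deriv (E.c * κ j) x * iteratedDeriv j f x +
            (E.c * κ j) x * iteratedDeriv (j + 1) f x)) x := by
        refine HasDerivAt.fun_sum fun j hj => ?_
        have hji := Finset.mem_range.1 hj
        refine HasDerivAt.fun_mul ((hdiff _ (hci.mul (hκ j))) x).hasDerivAt ?_
        rw [iteratedDeriv_succ]
        exact (hfd j hji.le).hasDerivAt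
      have heq : E.c * (fun x => E.c x ^ i * iteratedDeriv i f x +
          ∑ j ∈ Finset.range i, κ j x * iteratedDeriv j f x) =
          fun y => E.c y ^ (i + 1) * iteratedDeriv i f y +
            ∑ j ∈ Finset.range i, (E.c * κ j) y * iteratedDeriv j f y := by
        funext y
        simp only [Pi.mul_apply, mul_add, Finset.mul_sum]
        congr 1
        · ring
        · exact Finset.sum_congr rfl fun j _ => by ring
      unfold twist
      rw [heq, (hc1.fun_add hc2).deriv]
      simp only [Pi.add_apply, add_mul, Finset.sum_add_distrib]
      have e1 : ∑ j ∈ Finset.range (i + 1), (if j = i then deriv (fun x => E.c x ^ (i + 1))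
          else deriv (E.c * κ j)) x * iteratedDeriv j f x =
          ∑ j ∈ Finset.range i, deriv (E.c * κ j) x * iteratedDeriv j f x +
            deriv (fun x => E.c x ^ (i + 1)) x * iteratedDeriv i f x := by
        rw [Finset.sum_range_succ, if_pos rfl]
        congr 1
        refine Finset.sum_congr rfl fun j hj => ?_
        rw [if_neg (Finset.mem_range.1 hj).ne]
      have e2 : ∑ j ∈ Finset.range (i + 1), (if j = 0 then (0 : ℝ → ℝ) else
          if j ≤ i then E.c * κ (j - 1) else 0) x * iteratedDeriv j f x =
          ∑ j ∈ Finset.range i, (E.c * κ j) x * iteratedDeriv (j + 1) f x := by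
        rw [Finset.sum_range_succ']
        simp only [if_true, Pi.zero_apply, zero_mul, add_zero]
        refine Finset.sum_congr rfl fun j hj => ?_
        have := Finset.mem_range.1 hj
        rw [if_neg (by omega), if_pos (by omega), Nat.add_sub_cancel]
      rw [e1, e2]; ring

lemma contDiff_iterate_twist {k : ℕ} (hF : ContDiff ℝ (k + 1 : ℕ) E.F) {f : ℝ → ℝ}
    (hf : ContDiff ℝ k f) (i : ℕ) (hi : i ≤ k) : ContDiff ℝ (k - i : ℕ) (E.twist^[i] f) := by
  induction i with
  | zero => simpa using hf
  | succ i ih =>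
    rw [Function.iterate_succ_apply']
    have h := ih (by omega)
    have hci : ContDiff ℝ (k - i : ℕ) E.c :=
      (E.contDiff_c hF).of_le (by exact_mod_cast (by omega : k - i ≤ k))
    have h2 := hci.mul h
    have hk1 : ((k - i : ℕ) : WithTop ℕ∞) = ((k - (i + 1) : ℕ) : WithTop ℕ∞) + 1 := by
      have : k - i = k - (i + 1) + 1 := by omega
      rw [this]; push_cast; rfl
    rw [hk1, contDiff_succ_iff_deriv] at h2
    exact h2.2.2

lemma iteratedDeriv_transferOp {k : ℕ} (hF : ContDiff ℝ (k + 1 : ℕ) E.F) {f : ℝ → ℝ}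
    (hf : ContDiff ℝ k f) (i : ℕ) (hi : i ≤ k) :
    iteratedDeriv i (E.transferOp f) = E.transferOp (E.twist^[i] f) := by
  induction i with
  | zero => simp
  | succ i ih =>
    rw [iteratedDeriv_succ, ih (by omega), Function.iterate_succ_apply']
    refine deriv_transferOp ?_
    have := contDiff_iterate_twist hF hf i (by omega)
    refine this.differentiable ?_
    intro h0
    have : k - i = 0 := by exact_mod_cast h0
    omega

/-- Pointwise Lasota--Yorke inequalities for all derivatives of order at most `k`. -/
lemma exists_abs_iteratedDeriv_transferOp_le {k : ℕ} (hF : ContDiff ℝ (k + 1 : ℕ) E.F) :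
    ∃ K : ℝ, 0 ≤ K ∧ ∀ f : ℝ → ℝ, ContDiff ℝ k f → ∀ i ≤ k, ∀ x,
      |iteratedDeriv i (E.transferOp f) x| ≤ E.transferOp (fun y =>
        E.α ^ i * |iteratedDeriv i f y| + K * ∑ j ∈ Finset.range i, |iteratedDeriv j f y|) x := by
  have h1 : ∀ i : ℕ, ∃ K : ℝ, 0 ≤ K ∧ (i ≤ k → ∀ f : ℝ → ℝ, ContDiff ℝ k f → ∀ x,
      |iteratedDeriv i (E.transferOp f) x| ≤ E.transferOp (fun y =>
        E.α ^ i * |iteratedDeriv i f y| +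
          K * ∑ j ∈ Finset.range i, |iteratedDeriv j f y|) x) := by
    intro i
    by_cases hi : i ≤ k
    swap
    · exact ⟨0, le_rfl, fun h => absurd h hi⟩
    obtain ⟨κ, hκ, hκp, hκf⟩ := exists_coeff_iterate_twist hF i hi
    choose C hC using fun j => (hκp j).exists_abs_le (hκ j).continuous
    have hC0 : ∀ j, 0 ≤ C j := fun j => (abs_nonneg _).trans (hC j 0)
    refine ⟨∑ j ∈ Finset.range i, C j, Finset.sum_nonneg fun j _ => hC0 j, fun _ f hf x => ?_⟩
    rw [iteratedDeriv_transferOp hF hf i hi]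
    refine (abs_transferOp_le _ _).trans (transferOp_mono (fun y => ?_) x)
    rw [hκf f hf]
    refine (abs_add_le _ _).trans (add_le_add ?_ ?_)
    · rw [abs_mul, abs_pow]
      gcongr
      exact E.abs_c_le y
    · refine (Finset.abs_sum_le_sum_abs _ _).trans ?_
      rw [Finset.mul_sum]
      refine Finset.sum_le_sum fun j hj => ?_
      rw [abs_mul]
      refine mul_le_mul_of_nonneg_right ?_ (abs_nonneg _)
      exact (hC j y).trans (Finset.single_le_sum (f := C) (fun j _ => hC0 j) hj)
  choose K hK0 hK using h1
  refine ⟨∑ i ∈ Finset.range (k + 1), K i, Finset.sum_nonneg fun i _ => hK0 i,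
    fun f hf i hi x => (hK i hi f hf x).trans (transferOp_mono (fun y => ?_) x)⟩
  gcongr
  exact Finset.single_le_sum (f := K) (fun j _ => hK0 j) (Finset.mem_range.2 (by omega))

end ExpandingLift

end

section

/-! ### Noise and decay on smooth functions -/

/-- Functions of class `C^k` on the line which are `1`-periodic. -/
structure IsPerC (k : ℕ) (f : ℝ → ℝ) : Prop where
  contDiff : ContDiff ℝ k f
  periodic : Function.Periodic f 1

namespace IsPerC
variable {k : ℕ} {f g : ℝ → ℝ}

lemma continuous (hf : IsPerC k f) : Continuous f := hf.contDiff.continuous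

lemma of_le {m : ℕ} (hf : IsPerC k f) (h : m ≤ k) : IsPerC m f :=
  ⟨hf.contDiff.of_le (by exact_mod_cast h), hf.periodic⟩

lemma const (a : ℝ) : IsPerC k (fun _ => a) := ⟨contDiff_const, fun _ => rfl⟩

lemma add (hf : IsPerC k f) (hg : IsPerC k g) : IsPerC k (fun x => f x + g x) :=
  ⟨hf.contDiff.add hg.contDiff, fun x => by simp only [hf.periodic x, hg.periodic x]⟩

lemma sub (hf : IsPerC k f) (hg : IsPerC k g) : IsPerC k (fun x => f x - g x) :=
  ⟨hf.contDiff.sub hg.contDiff, fun x => by simp only [hf.periodic x, hg.periodic x]⟩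

lemma const_mul (a : ℝ) (hf : IsPerC k f) : IsPerC k (fun x => a * f x) :=
  ⟨contDiff_const.mul hf.contDiff, fun x => by simp only [hf.periodic x]⟩

lemma iteratedDeriv {m i : ℕ} (hf : IsPerC k f) (h : m + i ≤ k) :
    IsPerC m (iteratedDeriv i f) := by
  refine ⟨?_, hf.periodic.iteratedDeriv' i⟩
  have := (hf.of_le h).contDiff
  exact ContDiff.iterate_deriv' m i (by exact_mod_cast this) |> fun h => by
    rwa [← iteratedDeriv_eq_iterate] at h

lemma deriv (hf : IsPerC (k + 1) f) : IsPerC k (deriv f) := by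
  have := hf.iteratedDeriv (m := k) (i := 1) le_rfl
  rwa [iteratedDeriv_one] at this

lemma continuous_iteratedDeriv {i : ℕ} (hf : IsPerC k f) (hi : i ≤ k) :
    Continuous (_root_.iteratedDeriv i f) :=
  (hf.iteratedDeriv (m := 0) (i := i) (by omega)).continuous

lemma exists_abs_le (hf : IsPerC k f) : ∃ C, ∀ x, |f x| ≤ C :=
  hf.periodic.exists_abs_le hf.continuous

lemma exists_abs_iteratedDeriv_le (hf : IsPerC k f) :
    ∃ C, ∀ i ≤ k, ∀ x, |_root_.iteratedDeriv i f x| ≤ C := by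
  have : ∀ i : ℕ, ∃ C, 0 ≤ C ∧ (i ≤ k → ∀ x, |_root_.iteratedDeriv i f x| ≤ C) := fun i => by
    by_cases hi : i ≤ k
    · obtain ⟨C, hC⟩ := (hf.iteratedDeriv (m := 0) (i := i) (by omega)).exists_abs_le
      exact ⟨C, (abs_nonneg _).trans (hC 0), fun _ => hC⟩
    · exact ⟨0, le_rfl, fun h => absurd h hi⟩
  choose C hC0 hC using this
  refine ⟨∑ i ∈ Finset.range (k + 1), C i, fun i hi x => (hC i hi x).trans ?_⟩
  exact Finset.single_le_sum (f := C) (fun j _ => hC0 j) (Finset.mem_range.2 (by omega))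

lemma intervalIntegrable (hf : IsPerC k f) (a b : ℝ) : IntervalIntegrable f volume a b :=
  hf.continuous.intervalIntegrable a b

lemma contDiffAt (hf : IsPerC k f) {i : ℕ} (hi : i ≤ k) {x : ℝ} : ContDiffAt ℝ i f x :=
  (hf.of_le hi).contDiff.contDiffAt

end IsPerC

lemma iteratedDeriv_sub_apply {k i : ℕ} {f g : ℝ → ℝ} (hf : IsPerC k f) (hg : IsPerC k g)
    (hi : i ≤ k) (x : ℝ) :
    iteratedDeriv i (fun y => f y - g y) x = iteratedDeriv i f x - iteratedDeriv i g x :=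
  iteratedDeriv_fun_sub (hf.contDiffAt hi) (hg.contDiffAt hi)

lemma iteratedDeriv_add_apply {k i : ℕ} {f g : ℝ → ℝ} (hf : IsPerC k f) (hg : IsPerC k g)
    (hi : i ≤ k) (x : ℝ) :
    iteratedDeriv i (fun y => f y + g y) x = iteratedDeriv i f x + iteratedDeriv i g x :=
  iteratedDeriv_fun_add (hf.contDiffAt hi) (hg.contDiffAt hi)

/-! ### Averaging over the noise -/

/-- Convolution with the law of `δ t` for `t` of law `ν`. -/
def noiseOp (ν : Measure ℝ) (δ : ℝ) (f : ℝ → ℝ) : ℝ → ℝ := fun x => ∫ t, f (x - δ * t) ∂ν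

section noiseOp
variable {ν : Measure ℝ} [IsProbabilityMeasure ν] {δ : ℝ} {f g : ℝ → ℝ}

lemma integrable_noise (hf : IsPerC 0 f) (x : ℝ) : Integrable (fun t => f (x - δ * t)) ν := by
  obtain ⟨C, hC⟩ := hf.exists_abs_le
  refine Integrable.of_bound (C := C) ?_ (Eventually.of_forall fun t => by simpa using hC _)
  exact (hf.continuous.comp (by fun_prop)).aestronglyMeasurable

lemma noiseOp_sub (hf : IsPerC 0 f) (hg : IsPerC 0 g) :
    noiseOp ν δ (fun x => f x - g x) = fun x => noiseOp ν δ f x - noiseOp ν δ g x :=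
  funext fun x => integral_sub (integrable_noise hf x) (integrable_noise hg x)

omit [IsProbabilityMeasure ν] in
lemma noiseOp_const_mul (a : ℝ) :
    noiseOp ν δ (fun x => a * f x) = fun x => a * noiseOp ν δ f x :=
  funext fun _ => integral_const_mul a _

lemma noiseOp_const (a : ℝ) : noiseOp ν δ (fun _ => a) = fun _ => a :=
  funext fun x => by simp [noiseOp]

lemma abs_noiseOp_le (hg : IsPerC 0 g) (h : ∀ x, |f x| ≤ g x) (x : ℝ) :
    |noiseOp ν δ f x| ≤ noiseOp ν δ g x := by
  have := norm_integral_le_of_norm_le (f := fun t => f (x - δ * t))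
    (integrable_noise (ν := ν) (δ := δ) hg x) (Eventually.of_forall fun _ => h _)
  simpa [noiseOp] using this

lemma abs_noiseOp_le_of_le {M : ℝ} (h : ∀ x, |f x| ≤ M) (x : ℝ) :
    |noiseOp ν δ f x| ≤ M := by
  have := abs_noiseOp_le (ν := ν) (δ := δ) (IsPerC.const M) h x
  rwa [noiseOp_const] at this

lemma noiseOp_isPerC_zero (hf : IsPerC 0 f) : IsPerC 0 (noiseOp ν δ f) := by
  refine ⟨?_, fun x => ?_⟩
  · obtain ⟨C, hC⟩ := hf.exists_abs_le
    rw [Nat.cast_zero, contDiff_zero]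
    refine continuous_of_dominated (bound := fun _ => C) (fun x => ?_)
      (fun x => Eventually.of_forall fun t => by simpa using hC _) (integrable_const _)
      (Eventually.of_forall fun t => hf.continuous.comp (by fun_prop))
    exact (integrable_noise hf x).aestronglyMeasurable
  · unfold noiseOp
    congr 1
    funext t
    rw [← hf.periodic (x - δ * t)]
    congr 1; ring

lemma hasDerivAt_noiseOp (hf : IsPerC 1 f) (x : ℝ) :
    HasDerivAt (noiseOp ν δ f) (noiseOp ν δ (deriv f) x) x := by
  obtain ⟨C, hC⟩ := hf.deriv.exists_abs_le
  have hd : Differentiable ℝ f := hf.contDiff.differentiable (by norm_num)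
  refine (hasDerivAt_integral_of_dominated_loc_of_deriv_le (μ := ν) (s := Set.univ)
    (F := fun x t => f (x - δ * t)) (F' := fun x t => deriv f (x - δ * t)) (bound := fun _ => C)
    Filter.univ_mem ?_ ?_ ?_ ?_ ?_ ?_).2
  · exact Eventually.of_forall fun x => (integrable_noise (hf.of_le zero_le_one) x).aestronglyMeasurable
  · exact integrable_noise (hf.of_le zero_le_one) x
  · exact (integrable_noise hf.deriv x).aestronglyMeasurable
  · exact Eventually.of_forall fun t y _ => by simpa using hC _
  · exact integrable_const _
  · refine Eventually.of_forall fun t y _ => ?_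
    exact (hd (y - δ * t)).hasDerivAt.comp_sub_const y _

lemma deriv_noiseOp (hf : IsPerC 1 f) : deriv (noiseOp ν δ f) = noiseOp ν δ (deriv f) :=
  funext fun x => (hasDerivAt_noiseOp hf x).deriv

lemma iteratedDeriv_noiseOp {k : ℕ} (hf : IsPerC k f) {i : ℕ} (hi : i ≤ k) :
    iteratedDeriv i (noiseOp ν δ f) = noiseOp ν δ (iteratedDeriv i f) := by
  induction i with
  | zero => simp
  | succ i ih =>
    rw [iteratedDeriv_succ, ih (by omega), iteratedDeriv_succ]
    exact deriv_noiseOp (hf.iteratedDeriv (by omega))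

lemma noiseOp_isPerC {k : ℕ} (hf : IsPerC k f) : IsPerC k (noiseOp ν δ f) := by
  refine ⟨?_, (noiseOp_isPerC_zero (hf.of_le (Nat.zero_le _))).periodic⟩
  induction k generalizing f with
  | zero => exact (noiseOp_isPerC_zero hf).contDiff
  | succ k ih =>
    push_cast
    rw [contDiff_succ_iff_deriv]
    refine ⟨fun x => (hasDerivAt_noiseOp (hf.of_le (by omega)) x).differentiableAt, by simp, ?_⟩
    rw [deriv_noiseOp (hf.of_le (by omega))]
    exact ih hf.deriv

lemma integral_noiseOp (hf : IsPerC 0 f) :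
    ∫ x in (0:ℝ)..1, noiseOp ν δ f x = ∫ x in (0:ℝ)..1, f x := by
  obtain ⟨C, hC⟩ := hf.exists_abs_le
  unfold noiseOp
  rw [intervalIntegral.integral_of_le zero_le_one, integral_integral_swap]
  · have : ∀ t, ∫ x in Set.Ioc (0:ℝ) 1, f (x - δ * t) = ∫ x in (0:ℝ)..1, f x := fun t => by
      rw [← intervalIntegral.integral_of_le zero_le_one,
        intervalIntegral.integral_comp_sub_right (fun x => f x)]
      have := hf.periodic.intervalIntegral_add_eq (0 - δ * t) 0
      rw [zero_add] at this
      rw [← this]; congr 1; ring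
    simp [this]
  · refine Integrable.of_bound (C := C) ?_ (Eventually.of_forall fun t => by
      simpa [Function.uncurry] using hC _)
    exact (hf.continuous.comp (by fun_prop)).aestronglyMeasurable

end noiseOp

/-! ### The transfer operator of the noisy system on smooth functions -/

lemma IsPerC.transferOp {E : ExpandingLift} {k : ℕ} (hF : ContDiff ℝ (k + 1 : ℕ) E.F) {f : ℝ → ℝ}
    (hf : IsPerC k f) : IsPerC k (E.transferOp f) :=
  ⟨ExpandingLift.contDiff_transferOp hF hf.contDiff, ExpandingLift.transferOp_periodic hf.periodic⟩

lemma IsPerC.transferOp_zero {E : ExpandingLift} {f : ℝ → ℝ}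
    (hf : IsPerC 0 f) : IsPerC 0 (E.transferOp f) :=
  ⟨by rw [Nat.cast_zero, contDiff_zero]; exact ExpandingLift.continuous_transferOp hf.continuous,
    ExpandingLift.transferOp_periodic hf.periodic⟩

/-- The transfer operator of the system with noise of amplitude `δ`. -/
def noisyOp (E : ExpandingLift) (ν : Measure ℝ) (δ : ℝ) (f : ℝ → ℝ) : ℝ → ℝ :=
  noiseOp ν δ (E.transferOp f)

section noisyOp
variable {E : ExpandingLift} {ν : Measure ℝ} [IsProbabilityMeasure ν] {δ : ℝ} {f g : ℝ → ℝ} {k : ℕ}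

lemma noisyOp_sub (hf : IsPerC 0 f) (hg : IsPerC 0 g) :
    noisyOp E ν δ (fun x => f x - g x) = fun x => noisyOp E ν δ f x - noisyOp E ν δ g x := by
  unfold noisyOp
  rw [← noiseOp_sub hf.transferOp_zero hg.transferOp_zero]
  congr 1
  exact map_sub E.transferOp f g

lemma IsPerC.noisyOp (hF : ContDiff ℝ (k + 1 : ℕ) E.F) (hf : IsPerC k f) :
    IsPerC k (noisyOp E ν δ f) := noiseOp_isPerC (hf.transferOp hF)

lemma IsPerC.noisyOp_zero (hf : IsPerC 0 f) :
    IsPerC 0 (ZeroNoise.noisyOp E ν δ f) := noiseOp_isPerC hf.transferOp_zero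

lemma IsPerC.noisyOp_iterate (hF : ContDiff ℝ (k + 1 : ℕ) E.F) (hf : IsPerC k f) (n : ℕ) :
    IsPerC k ((ZeroNoise.noisyOp E ν δ)^[n] f) := by
  induction n with
  | zero => exact hf
  | succ n ih => rw [Function.iterate_succ_apply']; exact ih.noisyOp hF

lemma integral_noisyOp (hf : IsPerC 0 f) :
    ∫ x in (0:ℝ)..1, noisyOp E ν δ f x = ∫ x in (0:ℝ)..1, f x := by
  unfold noisyOp
  rw [integral_noiseOp hf.transferOp_zero,
    ExpandingLift.integral_transferOp hf.periodic (hf.intervalIntegrable 0 1)]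

lemma integral_noisyOp_iterate (hf : IsPerC 0 f) (n : ℕ) :
    ∫ x in (0:ℝ)..1, (noisyOp E ν δ)^[n] f x = ∫ x in (0:ℝ)..1, f x := by
  induction n generalizing f with
  | zero => rfl
  | succ n ih => rw [Function.iterate_succ_apply, ih hf.noisyOp_zero, integral_noisyOp hf]

omit [IsProbabilityMeasure ν] in
lemma noisyOp_nonneg (hf : ∀ x, 0 ≤ f x) (x : ℝ) : 0 ≤ noisyOp E ν δ f x :=
  integral_nonneg fun _ => ExpandingLift.transferOp_nonneg hf _

lemma abs_noisyOp_le_of_le {M : ℝ} (h : ∀ x, |f x| ≤ M) (x : ℝ) :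
    |noisyOp E ν δ f x| ≤ E.D * M :=
  abs_noiseOp_le_of_le (fun y => ExpandingLift.abs_transferOp_le_of_le h y) x

/-! ### An invariant cone -/

/-- The cone of functions with logarithmically controlled derivatives up to order `k`. -/
structure InCone (k : ℕ) (B : ℝ) (f : ℝ → ℝ) : Prop where
  isPerC : IsPerC k f
  bound : ∀ i ≤ k, ∀ x, |iteratedDeriv i f x| ≤ B ^ i * f x

lemma InCone.nonneg {B : ℝ} (hf : InCone k B f) (x : ℝ) : 0 ≤ f x := by
  have := hf.bound 0 (Nat.zero_le _) x
  simp only [iteratedDeriv_zero, pow_zero, one_mul] at this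
  exact (abs_nonneg _).trans this

lemma InCone.harnack {B : ℝ} (hk : 1 ≤ k) (hB : 0 ≤ B) (hf : InCone k B f) (x y : ℝ) :
    f x ≤ Real.exp B * f y := by
  have hd : Differentiable ℝ f := (hf.isPerC.of_le hk).contDiff.differentiable (by norm_num)
  have hm : Monotone fun z => f z * Real.exp (B * z) := by
    refine monotone_of_deriv_nonneg (by fun_prop) fun z => ?_
    have h1 : HasDerivAt (fun z => f z * Real.exp (B * z))
        (deriv f z * Real.exp (B * z) + f z * (Real.exp (B * z) * B)) z :=
      (hd z).hasDerivAt.fun_mul (((hasDerivAt_id z).const_mul B).exp.congr_deriv (by simp))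
    rw [h1.deriv]
    have h2 := hf.bound 1 hk z
    rw [iteratedDeriv_one, pow_one] at h2
    have h3 := (abs_le.1 h2).1
    have := mul_nonneg (by linarith : 0 ≤ deriv f z + B * f z) (Real.exp_pos (B * z)).le
    linarith
  obtain ⟨z, hz, hyz⟩ := hf.isPerC.periodic.exists_mem_Ico one_pos y x
  rw [hyz]
  have h1 := hm hz.1
  simp only at h1
  have h2 : Real.exp (B * z) ≤ Real.exp (B * x) * Real.exp B := by
    rw [← Real.exp_add]
    exact Real.exp_le_exp.2 (by nlinarith [hz.2])
  have h3 := hf.nonneg z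
  have h4 := Real.exp_pos (B * x)
  have h5 := mul_le_mul_of_nonneg_left h2 h3
  have h6 : f x * Real.exp (B * x) ≤ (Real.exp B * f z) * Real.exp (B * x) := by linarith
  exact le_of_mul_le_mul_right h6 h4

lemma InCone.le_integral {B : ℝ} (hk : 1 ≤ k) (hB : 0 ≤ B) (hf : InCone k B f) (x : ℝ) :
    f x ≤ Real.exp B * ∫ y in (0:ℝ)..1, f y := by
  rw [← intervalIntegral.integral_const_mul]
  have h := intervalIntegral.integral_mono_on (a := 0) (b := 1) (f := fun _ => f x)
    (g := fun y => Real.exp B * f y) zero_le_one (by simp)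
    ((hf.isPerC.const_mul _).intervalIntegrable _ _) fun y _ => hf.harnack hk hB x y
  simpa using h

lemma InCone.integral_le {B : ℝ} (hk : 1 ≤ k) (hB : 0 ≤ B) (hf : InCone k B f) (x : ℝ) :
    ∫ y in (0:ℝ)..1, f y ≤ Real.exp B * f x := by
  have h := intervalIntegral.integral_mono_on (a := 0) (b := 1) (g := fun _ => Real.exp B * f x)
    (f := f) zero_le_one (hf.isPerC.intervalIntegrable _ _) (by simp)
    fun y _ => hf.harnack hk hB y x
  simpa using h

lemma exists_cone_contraction (hF : ContDiff ℝ (k + 1 : ℕ) E.F) :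
    ∃ B θ : ℝ, 1 ≤ B ∧ 0 < θ ∧ θ < 1 ∧ ∀ (ν : Measure ℝ) [IsProbabilityMeasure ν] (δ : ℝ)
      (f : ℝ → ℝ), InCone k B f → ∀ i, 1 ≤ i → i ≤ k → ∀ x,
        |iteratedDeriv i (noisyOp E ν δ f) x| ≤ θ * (B ^ i * noisyOp E ν δ f x) := by
  obtain ⟨K, hK0, hK⟩ := ExpandingLift.exists_abs_iteratedDeriv_transferOp_le hF
  have hα := E.α_pos
  have hα1 := E.α_lt_one
  set θ := (1 + E.α) / 2 with hθ
  have hθα : 0 < θ - E.α := by rw [hθ]; linarith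
  set B := 1 + K / (θ - E.α) with hB
  have hB1 : 1 ≤ B := by rw [hB]; have := div_nonneg hK0 hθα.le; linarith
  refine ⟨B, θ, hB1, by rw [hθ]; linarith, by rw [hθ]; linarith, ?_⟩
  intro ν _ δ f hf i hi1 hik x
  have hsum : K * ∑ j ∈ Finset.range i, B ^ j ≤ (θ - E.α) * B ^ i := by
    have h1 : (∑ j ∈ Finset.range i, B ^ j) * (B - 1) = B ^ i - 1 := geom_sum_mul B i
    have h2 : K = (θ - E.α) * (B - 1) := by rw [hB]; field_simp; ring
    rw [h2, mul_assoc, mul_comm (B - 1), h1]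
    exact mul_le_mul_of_nonneg_left (by linarith) hθα.le
  have hαi : E.α ^ i ≤ E.α := by
    simpa using pow_le_pow_of_le_one hα.le hα1.le hi1
  have hBi : 0 ≤ B ^ i := by positivity
  have hLf : ∀ y, |iteratedDeriv i (E.transferOp f) y| ≤ θ * B ^ i * E.transferOp f y := by
    intro y
    refine (hK f hf.isPerC.contDiff i hik y).trans ?_
    have : E.transferOp (fun z => (θ * B ^ i) * f z) y = θ * B ^ i * E.transferOp f y :=
      congrFun (map_smul E.transferOp (θ * B ^ i) f) y
    rw [← this]
    refine ExpandingLift.transferOp_mono (fun z => ?_) y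
    have hz := hf.nonneg z
    have h1 : ∑ j ∈ Finset.range i, |iteratedDeriv j f z| ≤
        (∑ j ∈ Finset.range i, B ^ j) * f z := by
      rw [Finset.sum_mul]
      exact Finset.sum_le_sum fun j hj => hf.bound j (by have := Finset.mem_range.1 hj; omega) z
    calc E.α ^ i * |iteratedDeriv i f z| + K * ∑ j ∈ Finset.range i, |iteratedDeriv j f z|
        ≤ E.α * (B ^ i * f z) + K * ((∑ j ∈ Finset.range i, B ^ j) * f z) :=
          add_le_add (mul_le_mul hαi (hf.bound i hik z) (abs_nonneg _) hα.le)
            (mul_le_mul_of_nonneg_left h1 hK0)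
      _ = (E.α * B ^ i + K * ∑ j ∈ Finset.range i, B ^ j) * f z := by ring
      _ ≤ (θ * B ^ i) * f z := mul_le_mul_of_nonneg_right (by linarith) hz
  unfold noisyOp
  have hLC := hf.isPerC.transferOp hF
  rw [iteratedDeriv_noiseOp hLC hik, ← mul_assoc,
    ← congrFun (noiseOp_const_mul (ν := ν) (δ := δ) (f := E.transferOp f) (θ * B ^ i)) x]
  exact abs_noiseOp_le ((hLC.of_le (Nat.zero_le _)).const_mul _) hLf x

lemma InCone.noisyOp_sub {B θ : ℝ} (hk : 1 ≤ k) (hF : ContDiff ℝ (k + 1 : ℕ) E.F)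
    (hB : 1 ≤ B) (hθ0 : 0 < θ) (hθ : θ < 1)
    (h : ∀ i, 1 ≤ i → i ≤ k → ∀ x,
        |iteratedDeriv i (ZeroNoise.noisyOp E ν δ f) x| ≤ θ * (B ^ i * ZeroNoise.noisyOp E ν δ f x))
    (hf : InCone k B f) :
    InCone k B (fun x => ZeroNoise.noisyOp E ν δ f x -
      (1 - θ) * Real.exp (-B) * ∫ y in (0:ℝ)..1, f y) := by
  have hP := hf.isPerC.noisyOp (ν := ν) (δ := δ) hF
  have hPn := noisyOp_nonneg (E := E) (ν := ν) (δ := δ) hf.nonneg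
  have hPc : InCone k B (ZeroNoise.noisyOp E ν δ f) := by
    refine ⟨hP, fun i hi x => ?_⟩
    rcases Nat.eq_zero_or_pos i with rfl | hi0
    · simp [abs_of_nonneg (hPn x)]
    · refine (h i hi0 hi x).trans (mul_le_of_le_one_left ?_ hθ.le)
      exact mul_nonneg (by positivity) (hPn x)
  set m := ∫ y in (0:ℝ)..1, f y with hm
  have hlow : ∀ x, (1 - θ) * Real.exp (-B) * m ≤ (1 - θ) * ZeroNoise.noisyOp E ν δ f x := by
    intro x
    have h1 := hPc.integral_le hk (by linarith) x
    rw [integral_noisyOp (hf.isPerC.of_le (Nat.zero_le _))] at h1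
    rw [mul_assoc]
    refine mul_le_mul_of_nonneg_left ?_ (by linarith)
    rw [Real.exp_neg, inv_mul_le_iff₀ (Real.exp_pos B)]
    exact h1
  refine ⟨hP.sub (IsPerC.const _), fun i hi x => ?_⟩
  rcases Nat.eq_zero_or_pos i with rfl | hi0
  · simp only [iteratedDeriv_zero, pow_zero, one_mul]
    rw [abs_of_nonneg]
    have := hlow x
    have h2 : (1 - θ) * ZeroNoise.noisyOp E ν δ f x ≤ ZeroNoise.noisyOp E ν δ f x :=
      mul_le_of_le_one_left (hPn x) (by linarith)
    linarith
  · rw [iteratedDeriv_sub_apply hP (IsPerC.const _) hi, iteratedDeriv_const, if_neg hi0.ne', sub_zero]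
    refine (h i hi0 hi x).trans ?_
    have h1 : θ * (B ^ i * ZeroNoise.noisyOp E ν δ f x) =
      B ^ i * (θ * ZeroNoise.noisyOp E ν δ f x) := by ring
    rw [h1]
    refine mul_le_mul_of_nonneg_left ?_ (by positivity)
    linarith [hlow x]

/-- Exponential decay of the zero average functions of class `C^k`, uniformly in the noise. -/
theorem exists_iterate_noisyOp_decay (E : ExpandingLift) (hk : 1 ≤ k)
    (hF : ContDiff ℝ (k + 1 : ℕ) E.F) :
    ∃ C r : ℝ, 0 ≤ C ∧ 0 < r ∧ r < 1 ∧ ∀ (ν : Measure ℝ) [IsProbabilityMeasure ν] (δ : ℝ)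
      (φ : ℝ → ℝ) (M : ℝ), IsPerC k φ → ∫ x in (0:ℝ)..1, φ x = 0 →
      (∀ i ≤ k, ∀ x, |iteratedDeriv i φ x| ≤ M) → ∀ n, ∀ i ≤ k, ∀ x,
        |iteratedDeriv i ((noisyOp E ν δ)^[n] φ) x| ≤ C * r ^ n * M := by
  obtain ⟨B, θ, hB, hθ0, hθ1, hstep⟩ := exists_cone_contraction (E := E) hF
  have hB0 : 0 ≤ B := by linarith
  set ε := (1 - θ) * Real.exp (-B) with hε
  have hε0 : 0 < ε := mul_pos (by linarith) (Real.exp_pos _)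
  have hε1 : ε < 1 := by
    have : Real.exp (-B) ≤ 1 := Real.exp_le_one_iff.2 (by linarith)
    have : ε ≤ (1 - θ) * 1 := mul_le_mul_of_nonneg_left this (by linarith)
    linarith
  refine ⟨4 * B ^ k * Real.exp B, 1 - ε, by positivity, by linarith, by linarith, ?_⟩
  intro ν _ δ φ M hφ hφ0 hM n i hi x
  have hM0 : 0 ≤ M := (abs_nonneg _).trans (hM 0 (Nat.zero_le _) 0)
  have key : ∃ f g : ℝ → ℝ, InCone k B f ∧ InCone k B g ∧
      ∫ y in (0:ℝ)..1, f y = (1 - ε) ^ n * (2 * M) ∧ ∫ y in (0:ℝ)..1, g y = (1 - ε) ^ n * (2 * M) ∧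
      (noisyOp E ν δ)^[n] φ = fun y => f y - g y := by
    induction n with
    | zero =>
      have hc : ∀ i, 0 < i → ∀ x, iteratedDeriv i (fun _ : ℝ => 2 * M) x = 0 := fun i hi x => by
        rw [iteratedDeriv_const, if_neg hi.ne']
      refine ⟨fun y => φ y + 2 * M, fun _ => 2 * M, ⟨hφ.add (IsPerC.const _), fun i hi x => ?_⟩,
        ⟨IsPerC.const _, fun i hi x => ?_⟩, ?_, by simp, ?_⟩
      · have h0 := hM 0 (Nat.zero_le _) x
        rw [iteratedDeriv_zero] at h0
        have h1 := (abs_le.1 h0).1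
        rcases Nat.eq_zero_or_pos i with rfl | hi0
        · simp only [iteratedDeriv_zero, pow_zero, one_mul]
          rw [abs_of_nonneg (by linarith)]
        · rw [iteratedDeriv_add_apply hφ (IsPerC.const _) hi, hc i hi0, add_zero]
          refine (hM i hi x).trans ?_
          calc M ≤ φ x + 2 * M := by linarith
            _ ≤ B ^ i * (φ x + 2 * M) :=
              le_mul_of_one_le_left (by linarith) (one_le_pow₀ hB)
      · rcases Nat.eq_zero_or_pos i with rfl | hi0
        · simp [abs_of_nonneg hM0]
        · rw [hc i hi0, abs_zero]; positivity
      · rw [intervalIntegral.integral_add (hφ.intervalIntegrable _ _) (by simp), hφ0]; simp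
      · funext y; simp
    | succ n ih =>
      obtain ⟨f, g, hf, hg, hfi, hgi, hfg⟩ := ih
      refine ⟨_, _, hf.noisyOp_sub hk hF hB hθ0 hθ1 (hstep ν δ f hf),
        hg.noisyOp_sub hk hF hB hθ0 hθ1 (hstep ν δ g hg), ?_, ?_, ?_⟩
      · rw [intervalIntegral.integral_sub ((hf.isPerC.noisyOp hF).intervalIntegrable _ _) (by simp),
          integral_noisyOp (hf.isPerC.of_le (Nat.zero_le _)), hfi]
        simp only [intervalIntegral.integral_const, sub_zero, one_smul, ← hε]
        ring
      · rw [intervalIntegral.integral_sub ((hg.isPerC.noisyOp hF).intervalIntegrable _ _) (by simp),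
          integral_noisyOp (hg.isPerC.of_le (Nat.zero_le _)), hgi]
        simp only [intervalIntegral.integral_const, sub_zero, one_smul, ← hε]
        ring
      · rw [Function.iterate_succ_apply', hfg, ZeroNoise.noisyOp_sub (hf.isPerC.of_le (Nat.zero_le _))
          (hg.isPerC.of_le (Nat.zero_le _)), hfi, hgi]
        funext y; ring
  obtain ⟨f, g, hf, hg, hfi, hgi, hfg⟩ := key
  rw [hfg, iteratedDeriv_sub_apply hf.isPerC hg.isPerC hi]
  have hBk : B ^ i ≤ B ^ k := pow_le_pow_right₀ hB hi
  have hfb : ∀ {u : ℝ → ℝ}, InCone k B u → ∫ y in (0:ℝ)..1, u y = (1 - ε) ^ n * (2 * M) →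
      |iteratedDeriv i u x| ≤ B ^ k * (Real.exp B * ((1 - ε) ^ n * (2 * M))) := by
    intro u hu hui
    refine (hu.bound i hi x).trans ?_
    have := hu.le_integral hk hB0 x
    rw [hui] at this
    exact mul_le_mul hBk this (hu.nonneg x) (by positivity)
  have h1 := hfb hf hfi
  have h2 := hfb hg hgi
  calc _ ≤ |iteratedDeriv i f x| + |iteratedDeriv i g x| := abs_sub _ _
    _ ≤ _ := by linarith

end noisyOp

end

section

/-! ### Fixed densities and their expansion -/

lemma nonpos_of_forall_le_mul_pow {a C r : ℝ} (hr0 : 0 < r) (hr : r < 1)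
    (h : ∀ n : ℕ, a ≤ C * r ^ n) : a ≤ 0 := by
  have ht : Tendsto (fun n : ℕ => C * r ^ n) atTop (𝓝 0) := by
    simpa using (tendsto_pow_atTop_nhds_zero_of_lt_one hr0.le hr).const_mul C
  exact ge_of_tendsto' ht h

section fixed
variable {E : ExpandingLift} {k : ℕ}

/-- Smooth fixed densities of the transfer operators. -/
theorem exists_fixed_density (E : ExpandingLift) (hk : 1 ≤ k) (hF : ContDiff ℝ (k + 1 : ℕ) E.F) :
    ∀ (ν : Measure ℝ) [IsProbabilityMeasure ν] (δ : ℝ), ∃ H : ℝ → ℝ,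
      IsPerC k H ∧ noisyOp E ν δ H = H ∧ ∫ x in (0:ℝ)..1, H x = 1 ∧ ∀ x, 0 ≤ H x := by
  obtain ⟨C, r, hC, hr0, hr1, hdec⟩ := exists_iterate_noisyOp_decay E hk hF
  have h1 : IsPerC k (E.transferOp (fun _ => 1)) := (IsPerC.const 1).transferOp hF
  obtain ⟨A, hA⟩ := h1.exists_abs_iteratedDeriv_le
  have hA0 : 0 ≤ A := (abs_nonneg _).trans (hA 0 (Nat.zero_le _) 0)
  set M := A + 1 with hM
  have hgeo : ∀ N, HasSum (fun n : ℕ => C * r ^ (n + N) * M) (C * M / (1 - r) * r ^ N) := by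
    intro N
    have := (hasSum_geometric_of_lt_one hr0.le hr1).mul_left (C * M * r ^ N)
    have e : (fun n : ℕ => C * r ^ (n + N) * M) = fun n => C * M * r ^ N * r ^ n := by
      funext n; rw [pow_add]; ring
    have e2 : C * M / (1 - r) * r ^ N = C * M * r ^ N * (1 - r)⁻¹ := by
      rw [div_eq_mul_inv]; ring
    rw [e, e2]; exact this
  set Q := C * M / (1 - r) with hQ
  intro ν _ δ
  set P := noisyOp E ν δ with hP
  have hone : IsPerC k (fun _ : ℝ => (1:ℝ)) := IsPerC.const 1
  have hP1 : IsPerC k (P fun _ => 1) := hone.noisyOp hF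
  set ψ : ℝ → ℝ := fun x => P (fun _ => 1) x - 1 with hψ
  have hψC : IsPerC k ψ := hP1.sub (IsPerC.const 1)
  have hψ0 : ∫ x in (0:ℝ)..1, ψ x = 0 := by
    rw [hψ, intervalIntegral.integral_sub (hP1.intervalIntegrable _ _) (by simp), hP,
      integral_noisyOp (IsPerC.const 1)]
    simp
  have hψM : ∀ i ≤ k, ∀ x, |iteratedDeriv i ψ x| ≤ M := by
    intro i hi x
    rw [hψ, iteratedDeriv_sub_apply hP1 hone hi]
    have e1 : |iteratedDeriv i (P fun _ => 1) x| ≤ A := by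
      rw [hP]; unfold noisyOp
      rw [iteratedDeriv_noiseOp h1 hi]
      exact abs_noiseOp_le_of_le (hA i hi) x
    have e2 : |iteratedDeriv i (fun _ : ℝ => (1:ℝ)) x| ≤ 1 := by
      rw [iteratedDeriv_const]; split_ifs <;> simp
    exact (abs_sub _ _).trans (add_le_add e1 e2)
  have hd := hdec ν δ ψ M hψC hψ0 hψM
  have hit : ∀ n, IsPerC k (P^[n] ψ) := fun n => hψC.noisyOp_iterate hF n
  have hb0 : ∀ n x, |P^[n] ψ x| ≤ C * r ^ n * M := fun n x => by
    simpa using hd n 0 (Nat.zero_le _) x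
  have hsumm : Summable fun n : ℕ => C * r ^ n * M := by simpa using (hgeo 0).summable
  have hfd : ∀ (i n : ℕ) (x : ℝ), (i : ℕ∞) ≤ (k : ℕ∞) →
      ‖iteratedFDeriv ℝ i (P^[n] ψ) x‖ ≤ C * r ^ n * M := by
    intro i n x hi
    rw [norm_iteratedFDeriv_eq_norm_iteratedDeriv]
    exact hd n i (by exact_mod_cast hi) x
  set S : ℝ → ℝ := fun x => ∑' n, P^[n] ψ x with hSdef
  have hcd : IsPerC k S := by
    refine ⟨?_, fun x => ?_⟩
    · exact contDiff_tsum (N := (k : ℕ∞)) (v := fun _ n => C * r ^ n * M)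
        (fun n => by exact_mod_cast (hit n).contDiff) (fun i _ => hsumm) hfd
    · simp only [hSdef, (hit _).periodic x]
  set H : ℝ → ℝ := fun x => 1 + S x with hH
  have hHC : IsPerC k H := (IsPerC.const 1).add hcd
  have hpart : ∀ N x, P^[N] (fun _ => 1) x = 1 + ∑ n ∈ Finset.range N, P^[n] ψ x := by
    intro N
    induction N with
    | zero => intro x; simp
    | succ N ih =>
      intro x
      rw [Finset.sum_range_succ, ← add_assoc, ← ih x]
      have hsub : ∀ m, P^[m] ψ = fun y => P^[m+1] (fun _ => 1) y - P^[m] (fun _ => 1) y := by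
        intro m
        induction m with
        | zero => rfl
        | succ m ihm =>
          rw [Function.iterate_succ_apply', ihm, hP, noisyOp_sub
            ((hone.noisyOp_iterate hF _).of_le (Nat.zero_le _))
            ((hone.noisyOp_iterate hF _).of_le (Nat.zero_le _))]
          simp only [Function.iterate_succ_apply']
      rw [hsub N]; ring
  have happ : ∀ N x, |H x - P^[N] (fun _ => 1) x| ≤ Q * r ^ N := by
    intro N x
    have hs : Summable fun n => P^[n] ψ x :=
      Summable.of_norm_bounded hsumm fun n => hb0 n x
    rw [hpart, hH, hSdef]
    simp only
    rw [← hs.sum_add_tsum_nat_add N]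
    have : ∀ a b : ℝ, 1 + (a + b) - (1 + a) = b := fun a b => by ring
    rw [this]
    exact tsum_of_norm_bounded (f := fun n => P^[n + N] ψ x) (hgeo N) fun n => hb0 (n + N) x
  have hitone : ∀ N, IsPerC 0 (P^[N] fun _ => 1) := fun N =>
    (hone.noisyOp_iterate hF N).of_le (Nat.zero_le _)
  have hH0 : IsPerC 0 H := hHC.of_le (Nat.zero_le _)
  refine ⟨H, hHC, ?_, ?_, ?_⟩
  · funext x
    have hle : ∀ N : ℕ, |P H x - H x| ≤ (E.D * Q + Q * r) * r ^ N := by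
      intro N
      have e1 : |P H x - P^[N+1] (fun _ => 1) x| ≤ E.D * (Q * r ^ N) := by
        have := congrFun (noisyOp_sub (E := E) (ν := ν) (δ := δ) hH0 (hitone N)) x
        rw [Function.iterate_succ_apply', ← this]
        exact abs_noisyOp_le_of_le (happ N) x
      have e2 := happ (N + 1) x
      rw [abs_sub_comm] at e2
      calc |P H x - H x| ≤ _ := abs_sub_le _ (P^[N+1] (fun _ => 1) x) _
        _ ≤ E.D * (Q * r ^ N) + Q * r ^ (N + 1) := add_le_add e1 e2
        _ = _ := by ring
    have := nonpos_of_forall_le_mul_pow hr0 hr1 hle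
    exact sub_eq_zero.1 (abs_nonpos_iff.1 this)
  · have hle : ∀ N : ℕ, |(∫ x in (0:ℝ)..1, H x) - 1| ≤ Q * r ^ N := by
      intro N
      have e : ∫ x in (0:ℝ)..1, P^[N] (fun _ => 1) x = 1 := by
        rw [hP, integral_noisyOp_iterate (IsPerC.const 1)]; simp
      have e0 : (∫ x in (0:ℝ)..1, H x) - 1 =
          (∫ x in (0:ℝ)..1, H x) - ∫ x in (0:ℝ)..1, P^[N] (fun _ => 1) x := by rw [e]
      rw [e0, ← intervalIntegral.integral_sub (hHC.intervalIntegrable _ _)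
        ((hitone N).intervalIntegrable _ _)]
      have := intervalIntegral.norm_integral_le_of_norm_le_const (a := 0) (b := 1) (C := Q * r ^ N)
        (f := fun x => H x - P^[N] (fun _ => 1) x) fun x _ => happ N x
      simpa using this
    exact sub_eq_zero.1 (abs_nonpos_iff.1 (nonpos_of_forall_le_mul_pow hr0 hr1 hle))
  · intro x
    have hle : ∀ N : ℕ, -H x ≤ Q * r ^ N := by
      intro N
      have h2 : ∀ N x, 0 ≤ P^[N] (fun _ => 1) x := by
        intro N
        induction N with
        | zero => intro x; simp
        | succ N ih => intro x; rw [Function.iterate_succ_apply']; exact noisyOp_nonneg ih x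
      linarith [(abs_le.1 (happ N x)).1, h2 N x]
    linarith [nonpos_of_forall_le_mul_pow hr0 hr1 hle]

lemma noisyOp_iterate_sub {ν : Measure ℝ} [IsProbabilityMeasure ν] {δ : ℝ} {f g : ℝ → ℝ}
    (hf : IsPerC 0 f) (hg : IsPerC 0 g) (n : ℕ) :
    (noisyOp E ν δ)^[n] (fun x => f x - g x) =
      fun x => (noisyOp E ν δ)^[n] f x - (noisyOp E ν δ)^[n] g x := by
  induction n generalizing f g with
  | zero => rfl
  | succ n ih =>
    simp only [Function.iterate_succ_apply]
    rw [noisyOp_sub hf hg, ih hf.noisyOp_zero hg.noisyOp_zero]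

/-- The inverse of `Id - L_δ` on zero average functions is bounded, uniformly in the noise. -/
theorem exists_resolvent_bound (E : ExpandingLift) (hk : 1 ≤ k)
    (hF : ContDiff ℝ (k + 1 : ℕ) E.F) :
    ∃ C : ℝ, 0 ≤ C ∧ ∀ (ν : Measure ℝ) [IsProbabilityMeasure ν] (δ : ℝ) (u w : ℝ → ℝ) (M : ℝ),
      IsPerC k u → IsPerC k w → ∫ x in (0:ℝ)..1, u x = 0 →
      (w = fun x => u x - noisyOp E ν δ u x) →
      (∀ i ≤ k, ∀ x, |iteratedDeriv i w x| ≤ M) → ∀ i ≤ k, ∀ x, |iteratedDeriv i u x| ≤ C * M := by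
  obtain ⟨C, r, hC, hr0, hr1, hdec⟩ := exists_iterate_noisyOp_decay E hk hF
  have hr' : 0 < 1 - r := by linarith
  refine ⟨C / (1 - r), by positivity, ?_⟩
  intro ν _ δ u w M hu hw hu0 hwu hM i hi x
  have hM0 : 0 ≤ M := (abs_nonneg _).trans (hM 0 (Nat.zero_le _) 0)
  have hz := hu.of_le (Nat.zero_le k)
  have hw0 : ∫ x in (0:ℝ)..1, w x = 0 := by
    rw [hwu, intervalIntegral.integral_sub (hu.intervalIntegrable _ _)
      ((hu.noisyOp hF).intervalIntegrable _ _), integral_noisyOp hz, sub_self]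
  obtain ⟨A, hA⟩ := hu.exists_abs_iteratedDeriv_le
  have hdu := fun n => hdec ν δ u A hu hu0 hA n i hi x
  have hdw := fun n => hdec ν δ w M hw hw0 hM n i hi x
  set P := noisyOp E ν δ with hP
  have hstep : ∀ n, iteratedDeriv i (P^[n] w) x =
      iteratedDeriv i (P^[n] u) x - iteratedDeriv i (P^[n+1] u) x := by
    intro n
    rw [hwu, hP, noisyOp_iterate_sub hz hz.noisyOp_zero,
      iteratedDeriv_sub_apply (hu.noisyOp_iterate hF n) ((hu.noisyOp hF).noisyOp_iterate hF n) hi,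
      ← Function.iterate_succ_apply]
  have hind : ∀ n : ℕ, |iteratedDeriv i u x| ≤ |iteratedDeriv i (P^[n] u) x| +
      ∑ m ∈ Finset.range n, C * r ^ m * M := by
    intro n
    induction n with
    | zero => simp
    | succ n ih =>
      rw [Finset.sum_range_succ]
      have e : iteratedDeriv i (P^[n] u) x =
          iteratedDeriv i (P^[n] w) x + iteratedDeriv i (P^[n+1] u) x := by rw [hstep]; ring
      have := abs_add_le (iteratedDeriv i (P^[n] w) x) (iteratedDeriv i (P^[n+1] u) x)
      rw [← e] at this
      linarith [hdw n]
  have hgeo : ∀ n, ∑ m ∈ Finset.range n, C * r ^ m * M ≤ C / (1 - r) * M := by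
    intro n
    rw [← Finset.sum_mul, ← Finset.mul_sum]
    refine mul_le_mul_of_nonneg_right ?_ hM0
    rw [div_eq_mul_inv]
    refine mul_le_mul_of_nonneg_left ?_ hC
    rw [← tsum_geometric_of_lt_one hr0.le hr1]
    exact (summable_geometric_of_lt_one hr0.le hr1).sum_le_tsum _ fun i _ => by positivity
  have hle : ∀ n : ℕ, |iteratedDeriv i u x| - C / (1 - r) * M ≤ (C * A) * r ^ n := fun n => by
    have h1 := hind n
    have h2 := hgeo n
    have h3 := hdu n
    linarith
  linarith [nonpos_of_forall_le_mul_pow hr0 hr1 hle]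

end fixed

/-! ### Taylor expansion of the noise -/

lemma abs_le_of_abs_deriv_le {g g' : ℝ → ℝ} {M : ℝ} {n : ℕ} (hM : 0 ≤ M)
    (hg : ∀ y, HasDerivAt g (g' y) y) (h0 : g 0 = 0) (hb : ∀ y, |g' y| ≤ M * |y| ^ n) (h : ℝ) :
    |g h| ≤ M * |h| ^ (n + 1) := by
  have hmem : ∀ y ∈ Set.uIcc 0 h, |y| ≤ |h| := fun y hy => by
    simpa using Set.abs_sub_left_of_mem_uIcc hy
  have := (convex_uIcc (0:ℝ) h).norm_image_sub_le_of_norm_hasDerivWithin_le (f := g) (f' := g')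
    (C := M * |h| ^ n) (fun y _ => (hg y).hasDerivWithinAt)
    (fun y hy => (hb y).trans (by have := hmem y hy; gcongr)) Set.left_mem_uIcc Set.right_mem_uIcc
  rw [h0, sub_zero, sub_zero] at this
  rw [pow_succ, ← mul_assoc]
  exact this

lemma IsPerC.hasDerivAt {f : ℝ → ℝ} (hf : IsPerC 1 f) (x : ℝ) : HasDerivAt f (_root_.deriv f x) x :=
  ((hf.contDiff.differentiable (by norm_num)) x).hasDerivAt

lemma taylor_one {f : ℝ → ℝ} {M : ℝ} (hf : IsPerC 1 f) (hM : ∀ x, |deriv f x| ≤ M) (x h : ℝ) :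
    |f (x + h) - f x| ≤ M * |h| := by
  have hM0 : 0 ≤ M := (abs_nonneg _).trans (hM 0)
  simpa using abs_le_of_abs_deriv_le (n := 0) hM0 (g := fun y => f (x + y) - f x)
    (g' := fun y => deriv f (x + y))
    (fun y => ((hf.hasDerivAt (x + y)).comp_const_add x y).sub_const _) (by simp)
    (fun y => by simpa using hM _) h

lemma taylor_two {f : ℝ → ℝ} {M : ℝ} (hf : IsPerC 2 f) (hM : ∀ x, |iteratedDeriv 2 f x| ≤ M)
    (x h : ℝ) : |f (x + h) - f x - deriv f x * h| ≤ M * |h| ^ 2 := by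
  have hM0 : 0 ≤ M := (abs_nonneg _).trans (hM 0)
  refine abs_le_of_abs_deriv_le (n := 1) hM0 (g := fun y => f (x + y) - f x - deriv f x * y)
    (g' := fun y => deriv f (x + y) - deriv f x) (fun y => ?_) (by simp) (fun y => ?_) h
  · exact ((((hf.of_le one_le_two).hasDerivAt (x + y)).comp_const_add x y).sub_const _).fun_sub
      (((hasDerivAt_id y).const_mul _).congr_deriv (by simp))
  · rw [pow_one]
    refine taylor_one hf.deriv (fun z => ?_) x y
    have := hM z
    rwa [iteratedDeriv_succ, iteratedDeriv_one] at this

lemma taylor_three {f : ℝ → ℝ} {M : ℝ} (hf : IsPerC 3 f) (hM : ∀ x, |iteratedDeriv 3 f x| ≤ M)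
    (x h : ℝ) : |f (x + h) - f x - deriv f x * h - iteratedDeriv 2 f x * (h ^ 2 / 2)| ≤
      M * |h| ^ 3 := by
  have hM0 : 0 ≤ M := (abs_nonneg _).trans (hM 0)
  refine abs_le_of_abs_deriv_le (n := 2) hM0
    (g := fun y => f (x + y) - f x - deriv f x * y - iteratedDeriv 2 f x * (y ^ 2 / 2))
    (g' := fun y => deriv f (x + y) - deriv f x - iteratedDeriv 2 f x * y)
    (fun y => ?_) (by simp) (fun y => ?_) h
  · have d1 : HasDerivAt (fun y => deriv f x * y) (deriv f x) y :=
      ((hasDerivAt_id y).const_mul _).congr_deriv (by simp)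
    have d2 : HasDerivAt (fun y => iteratedDeriv 2 f x * (y ^ 2 / 2)) (iteratedDeriv 2 f x * y) y :=
      (((hasDerivAt_pow 2 y).div_const 2).const_mul _).congr_deriv (by push_cast; ring)
    exact ((((hf.of_le (by norm_num)).hasDerivAt (x + y)).comp_const_add x y).sub_const _
      |>.fun_sub d1).fun_sub d2
  · have h2 : iteratedDeriv 2 f = deriv (deriv f) := by rw [iteratedDeriv_succ, iteratedDeriv_one]
    rw [h2]
    refine taylor_two hf.deriv (fun z => ?_) x y
    have := hM z
    rwa [iteratedDeriv_succ'] at this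

/-- Probability measures on `[-1, 1]` with zero average. -/
structure IsCentered (ν : Measure ℝ) : Prop where
  abs_le_one : ∀ᵐ t ∂ν, |t| ≤ 1
  integral_eq_zero : ∫ t, t ∂ν = 0

section noise
variable {ν : Measure ℝ} [IsProbabilityMeasure ν] {δ : ℝ} {f : ℝ → ℝ} {M : ℝ}

lemma IsCentered.integrable_id (hν : IsCentered ν) : Integrable (fun t : ℝ => t) ν :=
  Integrable.of_bound (C := 1) measurable_id.aestronglyMeasurable hν.abs_le_one

lemma IsCentered.integrable_sq (hν : IsCentered ν) : Integrable (fun t : ℝ => t ^ 2) ν :=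
  Integrable.of_bound (C := 1) (by fun_prop) (hν.abs_le_one.mono fun t ht => by
    rw [Real.norm_eq_abs, abs_pow]; exact pow_le_one₀ (abs_nonneg _) ht)

lemma abs_mul_pow_le {t : ℝ} (ht : |t| ≤ 1) (n : ℕ) (hM : 0 ≤ M) :
    M * |-(δ * t)| ^ n ≤ M * |δ| ^ n := by
  rw [abs_neg, abs_mul]
  gcongr
  exact mul_le_of_le_one_right (abs_nonneg _) ht

lemma abs_noiseOp_sub_le_one (hν : IsCentered ν) (hf : IsPerC 1 f) (hM : ∀ x, |deriv f x| ≤ M)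
    (x : ℝ) : |noiseOp ν δ f x - f x| ≤ M * |δ| := by
  have hM0 : 0 ≤ M := (abs_nonneg _).trans (hM 0)
  have e : noiseOp ν δ f x - f x = ∫ t, (f (x - δ * t) - f x) ∂ν := by
    rw [integral_sub (integrable_noise (hf.of_le zero_le_one) x) (integrable_const _)]
    simp [noiseOp]
  rw [e]
  have := norm_integral_le_of_norm_le_const (μ := ν) (f := fun t => f (x - δ * t) - f x)
    (C := M * |δ|) (hν.abs_le_one.mono fun t ht => by
      have h1 := taylor_one hf hM x (-(δ * t))
      rw [← sub_eq_add_neg] at h1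
      refine h1.trans ?_
      simpa using abs_mul_pow_le (δ := δ) ht 1 hM0)
  simpa using this

lemma abs_noiseOp_sub_le_two (hν : IsCentered ν) (hf : IsPerC 2 f)
    (hM : ∀ x, |iteratedDeriv 2 f x| ≤ M) (x : ℝ) :
    |noiseOp ν δ f x - f x| ≤ M * |δ| ^ 2 := by
  have hM0 : 0 ≤ M := (abs_nonneg _).trans (hM 0)
  have hi := integrable_noise (ν := ν) (δ := δ) (hf.of_le (Nat.zero_le _)) x
  have hi1 : Integrable (fun t => f (x - δ * t) - f x) ν := hi.sub (integrable_const _)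
  have hi2 : Integrable (fun t => deriv f x * (-(δ * t))) ν :=
    ((hν.integrable_id.const_mul δ).neg).const_mul _
  have e : noiseOp ν δ f x - f x = ∫ t, (f (x - δ * t) - f x - deriv f x * (-(δ * t))) ∂ν := by
    rw [integral_sub hi1 hi2, integral_sub hi (integrable_const _),
      integral_const_mul, integral_neg, integral_const_mul, hν.integral_eq_zero]
    simp [noiseOp]
  rw [e]
  have := norm_integral_le_of_norm_le_const (μ := ν)
    (f := fun t => f (x - δ * t) - f x - deriv f x * (-(δ * t)))
    (C := M * |δ| ^ 2) (hν.abs_le_one.mono fun t ht => by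
      have h1 := taylor_two hf hM x (-(δ * t))
      rw [← sub_eq_add_neg] at h1
      exact h1.trans (abs_mul_pow_le (δ := δ) ht 2 hM0))
  simpa using this

lemma abs_noiseOp_sub_le_three (hν : IsCentered ν) (hf : IsPerC 3 f)
    (hM : ∀ x, |iteratedDeriv 3 f x| ≤ M) (x : ℝ) :
    |noiseOp ν δ f x - f x - δ ^ 2 * ((∫ t, t ^ 2 ∂ν) / 2) * iteratedDeriv 2 f x| ≤
      M * |δ| ^ 3 := by
  have hM0 : 0 ≤ M := (abs_nonneg _).trans (hM 0)
  have hi := integrable_noise (ν := ν) (δ := δ) (hf.of_le (Nat.zero_le _)) x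
  have hi1 : Integrable (fun t => f (x - δ * t) - f x) ν := hi.sub (integrable_const _)
  have hi2 : Integrable (fun t => deriv f x * (-(δ * t))) ν :=
    ((hν.integrable_id.const_mul δ).neg).const_mul _
  have hi3 : Integrable (fun t => iteratedDeriv 2 f x * ((-(δ * t)) ^ 2 / 2)) ν := by
    refine (hν.integrable_sq.const_mul (iteratedDeriv 2 f x * (δ ^ 2 / 2))).congr
      (Eventually.of_forall fun t => ?_)
    simp only; ring
  have hi12 : Integrable (fun t => f (x - δ * t) - f x - deriv f x * (-(δ * t))) ν := hi1.sub hi2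
  have e : noiseOp ν δ f x - f x - δ ^ 2 * ((∫ t, t ^ 2 ∂ν) / 2) * iteratedDeriv 2 f x =
      ∫ t, (f (x - δ * t) - f x - deriv f x * (-(δ * t)) -
        iteratedDeriv 2 f x * ((-(δ * t)) ^ 2 / 2)) ∂ν := by
    have e3 : ∫ t, iteratedDeriv 2 f x * ((-(δ * t)) ^ 2 / 2) ∂ν =
        δ ^ 2 * ((∫ t, t ^ 2 ∂ν) / 2) * iteratedDeriv 2 f x := by
      have : ∀ t : ℝ, iteratedDeriv 2 f x * ((-(δ * t)) ^ 2 / 2) =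
        (iteratedDeriv 2 f x * (δ ^ 2 / 2)) * t ^ 2 := fun t => by ring
      simp only [this]
      rw [integral_const_mul]; ring
    rw [integral_sub hi12 hi3, integral_sub hi1 hi2, integral_sub hi (integrable_const _),
      integral_const_mul, integral_neg, integral_const_mul, hν.integral_eq_zero, e3]
    simp [noiseOp]
  rw [e]
  have := norm_integral_le_of_norm_le_const (μ := ν)
    (f := fun t => f (x - δ * t) - f x - deriv f x * (-(δ * t)) -
        iteratedDeriv 2 f x * ((-(δ * t)) ^ 2 / 2))
    (C := M * |δ| ^ 3) (hν.abs_le_one.mono fun t ht => by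
      have h1 := taylor_three hf hM x (-(δ * t))
      rw [← sub_eq_add_neg] at h1
      exact h1.trans (abs_mul_pow_le (δ := δ) ht 3 hM0))
  simpa using this

end noise

/-! ### The second order expansion of the fixed densities -/

lemma noisyOp_zero (E : ExpandingLift) (ν : Measure ℝ) [IsProbabilityMeasure ν] (f : ℝ → ℝ) :
    noisyOp E ν 0 f = E.transferOp f := by
  funext x; simp [noisyOp, noiseOp]

theorem exists_expansion_bound (E : ExpandingLift) (hF : ContDiff ℝ (7 + 1 : ℕ) E.F)
    (ν : Measure ℝ) [IsProbabilityMeasure ν] (hν : IsCentered ν) {H : ℝ → ℝ → ℝ}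
    (hH : ∀ δ, IsPerC 7 (H δ)) (hfix : ∀ δ, noisyOp E ν δ (H δ) = H δ)
    (hint : ∀ δ, ∫ x in (0:ℝ)..1, H δ x = 1) :
    ∃ C : ℝ, 0 ≤ C ∧ ∀ δ, (∀ i ≤ 1, ∀ x, |iteratedDeriv i (fun y => H δ y - H 0 y) x| ≤ C * |δ| ^ 2) ∧
      ∀ i ≤ 1, ∀ x, |iteratedDeriv i (fun y => H δ y - H 0 y -
        E.transferOp (fun z => H δ z - H 0 z) y -
          δ ^ 2 * ((∫ t, t ^ 2 ∂ν) / 2) * iteratedDeriv 2 (H 0) y) x| ≤ C * |δ| ^ 3 := by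
  have hF3 : ContDiff ℝ (2 + 1 : ℕ) E.F := hF.of_le (by norm_num)
  obtain ⟨C₁, hC₁, hres⟩ := exists_resolvent_bound E one_le_two hF3
  obtain ⟨A, hA⟩ := (hH 0).exists_abs_iteratedDeriv_le
  have hA0 : 0 ≤ A := (abs_nonneg _).trans (hA 0 (Nat.zero_le _) 0)
  obtain ⟨K, hK0, hK⟩ := ExpandingLift.exists_abs_iteratedDeriv_transferOp_le hF3
  have hL0 : E.transferOp (H 0) = H 0 := by rw [← noisyOp_zero E ν, hfix]
  have hadd : ∀ i j x, iteratedDeriv i (iteratedDeriv j (H 0)) x = iteratedDeriv (i + j) (H 0) x := by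
    intro i j x
    simp only [iteratedDeriv_eq_iterate, Function.iterate_add_apply]
  -- the `C^2` estimate on the difference
  have hu : ∀ δ, ∀ i ≤ 2, ∀ x, |iteratedDeriv i (fun y => H δ y - H 0 y) x| ≤ C₁ * (A * |δ| ^ 2) := by
    intro δ
    have hw7 : IsPerC 7 (noiseOp ν δ (H 0)) := noiseOp_isPerC (hH 0)
    have hu7 := (hH δ).sub (hH 0)
    refine hres ν δ _ (fun x => noiseOp ν δ (H 0) x - H 0 x) _ (hu7.of_le (by norm_num))
      ((hw7.sub (hH 0)).of_le (by norm_num)) ?_ ?_ ?_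
    · rw [intervalIntegral.integral_sub ((hH δ).intervalIntegrable _ _)
        ((hH 0).intervalIntegrable _ _), hint, hint, sub_self]
    · rw [noisyOp_sub ((hH δ).of_le (Nat.zero_le _)) ((hH 0).of_le (Nat.zero_le _)), hfix]
      have : noisyOp E ν δ (H 0) = noiseOp ν δ (H 0) := by unfold noisyOp; rw [hL0]
      rw [this]; funext x; ring
    · intro i hi x
      rw [iteratedDeriv_sub_apply hw7 (hH 0) (by omega), iteratedDeriv_noiseOp (hH 0) (by omega)]
      refine abs_noiseOp_sub_le_two hν ((hH 0).iteratedDeriv (by omega)) (fun y => ?_) x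
      rw [hadd]; exact hA _ (by omega) y
  set B := C₁ * A with hB
  have hB0 : 0 ≤ B := mul_nonneg hC₁ hA0
  set Q := E.D * ((1 + K * 2) * B) with hQ
  have hQ0 : 0 ≤ Q := by positivity
  refine ⟨B + Q + A, by positivity, fun δ => ⟨fun i hi x => ?_, fun i hi x => ?_⟩⟩
  · refine (hu δ i (by omega) x).trans ?_
    rw [← mul_assoc]
    exact mul_le_mul_of_nonneg_right (by linarith) (by positivity)
  set u : ℝ → ℝ := fun y => H δ y - H 0 y with hudef
  have hu7 : IsPerC 7 u := (hH δ).sub (hH 0)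
  have hLu : IsPerC 7 (E.transferOp u) := hu7.transferOp hF
  have hLub : ∀ i ≤ 2, ∀ x, |iteratedDeriv i (E.transferOp u) x| ≤ Q * |δ| ^ 2 := by
    intro i hi x
    refine (hK u (hu7.of_le (by norm_num)).contDiff i hi x).trans ((le_abs_self _).trans ?_)
    have : Q * |δ| ^ 2 = E.D * ((1 + K * 2) * (B * |δ| ^ 2)) := by rw [hQ]; ring
    rw [this]
    refine ExpandingLift.abs_transferOp_le_of_le (fun y => ?_) x
    have hb : ∀ j ≤ 2, |iteratedDeriv j u y| ≤ B * |δ| ^ 2 := fun j hj => by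
      have := hu δ j hj y
      rwa [← mul_assoc] at this
    rw [abs_of_nonneg (by have := E.α_pos; positivity), add_mul, one_mul]
    refine add_le_add ?_ ?_
    · refine (mul_le_of_le_one_left (abs_nonneg _) ?_).trans (hb i hi)
      exact pow_le_one₀ E.α_pos.le E.α_lt_one.le
    · rw [mul_assoc]
      refine mul_le_mul_of_nonneg_left ?_ hK0
      refine (Finset.sum_le_sum (g := fun _ => B * |δ| ^ 2) fun j hj => hb j ?_).trans ?_
      · have := Finset.mem_range.1 hj; omega
      · rw [Finset.sum_const, Finset.card_range, nsmul_eq_mul]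
        refine mul_le_mul_of_nonneg_right (by exact_mod_cast hi) (by positivity)
  set s := δ ^ 2 * ((∫ t, t ^ 2 ∂ν) / 2) with hs
  have hdec : (fun y => u y - E.transferOp u y - s * iteratedDeriv 2 (H 0) y) =
      fun y => (noiseOp ν δ (E.transferOp u) y - E.transferOp u y) +
        (noiseOp ν δ (H 0) y - H 0 y - s * iteratedDeriv 2 (H 0) y) := by
    have e1 : noisyOp E ν δ u = fun y => H δ y - noiseOp ν δ (H 0) y := by
      rw [hudef, noisyOp_sub ((hH δ).of_le (Nat.zero_le _)) ((hH 0).of_le (Nat.zero_le _)), hfix]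
      have : noisyOp E ν δ (H 0) = noiseOp ν δ (H 0) := by unfold noisyOp; rw [hL0]
      rw [this]
    funext y
    have e2 := congrFun e1 y
    unfold noisyOp at e2
    rw [e2, hudef]; ring
  have hN1 : IsPerC 7 (noiseOp ν δ (E.transferOp u)) := noiseOp_isPerC hLu
  have hN2 : IsPerC 7 (noiseOp ν δ (H 0)) := noiseOp_isPerC (hH 0)
  have hH2 : IsPerC 5 (iteratedDeriv 2 (H 0)) := (hH 0).iteratedDeriv le_rfl
  have hsm : iteratedDeriv i (fun y => s * iteratedDeriv 2 (H 0) y) x =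
      s * iteratedDeriv 2 (iteratedDeriv i (H 0)) x := by
    rw [hadd, add_comm, ← hadd]
    exact iteratedDeriv_const_mul_field s _
  change |iteratedDeriv i (fun y => u y - E.transferOp u y - s * iteratedDeriv 2 (H 0) y) x| ≤ _
  rw [hdec, iteratedDeriv_add_apply ((hN1.sub hLu).of_le (m := 5) (by norm_num))
      (((hN2.sub (hH 0)).of_le (m := 5) (by norm_num)).sub (hH2.const_mul s)) (by omega),
    iteratedDeriv_sub_apply hN1 hLu (by omega),
    iteratedDeriv_sub_apply ((hN2.sub (hH 0)).of_le (m := 5) (by norm_num)) (hH2.const_mul s) (by omega),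
    iteratedDeriv_sub_apply hN2 (hH 0) (by omega), iteratedDeriv_noiseOp hLu (by omega),
    iteratedDeriv_noiseOp (hH 0) (by omega), hsm]
  have b1 : |noiseOp ν δ (iteratedDeriv i (E.transferOp u)) x - iteratedDeriv i (E.transferOp u) x| ≤
      Q * |δ| ^ 2 * |δ| := by
    refine abs_noiseOp_sub_le_one hν (hLu.iteratedDeriv (by omega)) (fun y => ?_) x
    rw [← iteratedDeriv_succ]
    exact hLub _ (by omega) y
  have b2 := abs_noiseOp_sub_le_three (δ := δ) hν ((hH 0).iteratedDeriv (m := 3) (i := i) (by omega))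
    (M := A) (fun y => by rw [hadd]; exact hA _ (by omega) y) x
  refine (abs_add_le _ _).trans ((add_le_add b1 b2).trans ?_)
  have : 0 ≤ B * |δ| ^ 3 := by positivity
  nlinarith

end

section

/-! ### Functions on the circle and periodic functions on the line -/

/-- The function on the circle induced by a periodic function on the line. -/
def onCircle (f : ℝ → ℝ) : UnitAddCircle → ℝ := fun x => f (AddCircle.equivIco 1 0 x)

lemma onCircle_coe {f : ℝ → ℝ} (hf : Function.Periodic f 1) (x : ℝ) :
    onCircle f (x : UnitAddCircle) = f x := by
  unfold onCircle
  rw [AddCircle.coe_equivIco_mk_apply]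
  simp only [div_one, mul_one]
  have := hf.sub_zsmul_eq (x := x) ⌊x⌋
  rw [← this, Int.fract]; simp

lemma periodic_comp_coe (f : UnitAddCircle → ℝ) :
    Function.Periodic (fun t : ℝ => f (t : UnitAddCircle)) 1 := fun t => by
  simp only [AddCircle.coe_add_period]

lemma onCircle_comp_coe (f : UnitAddCircle → ℝ) :
    onCircle (fun t : ℝ => f (t : UnitAddCircle)) = f := by
  funext x
  obtain ⟨t, rfl⟩ := QuotientAddGroup.mk_surjective x
  exact onCircle_coe (periodic_comp_coe f) t

lemma integral_circle (f : UnitAddCircle → ℝ) :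
    ∫ x, f x = ∫ t in (0:ℝ)..1, f (t : UnitAddCircle) := by
  rw [← UnitAddCircle.intervalIntegral_preimage 0 f, zero_add]

lemma integral_onCircle {f : ℝ → ℝ} (hf : Function.Periodic f 1) :
    ∫ x, onCircle f x = ∫ t in (0:ℝ)..1, f t := by
  rw [integral_circle]; simp only [onCircle_coe hf]

lemma integrable_circle_iff (f : UnitAddCircle → ℝ) :
    Integrable f ↔ IntervalIntegrable (fun t : ℝ => f (t : UnitAddCircle)) volume 0 1 := by
  have h1 := (AddCircle.measurePreserving_equivIoc (T := 1) (a := 0)).integrable_comp_emb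
    (AddCircle.measurableEquivIoc 1 0).measurableEmbedding
    (g := fun t : Set.Ioc (0:ℝ) (0 + 1) => f ((t : ℝ) : UnitAddCircle))
  have h2 : (fun t : Set.Ioc (0:ℝ) (0 + 1) => f ((t : ℝ) : UnitAddCircle)) ∘
      AddCircle.equivIoc 1 0 = f := funext fun x => by simp [AddCircle.coe_equivIoc]
  rw [h2] at h1
  rw [h1, intervalIntegrable_iff_integrableOn_Ioc_of_le zero_le_one]
  have h3 := integrableOn_iff_comap_subtypeVal (μ := volume) (measurableSet_Ioc (a := (0:ℝ)) (b := 0 + 1))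
    (f := fun t : ℝ => f (t : UnitAddCircle))
  rw [zero_add] at h3
  rw [h3, zero_add]
  rfl

lemma continuous_of_comp_coe {f : UnitAddCircle → ℝ}
    (hf : Continuous fun t : ℝ => f (t : UnitAddCircle)) : Continuous f :=
  continuous_coinduced_dom.2 hf

lemma continuous_comp_coe {f : UnitAddCircle → ℝ} (hf : Continuous f) :
    Continuous fun t : ℝ => f (t : UnitAddCircle) := hf.comp (AddCircle.continuous_mk' 1)

lemma continuous_onCircle {f : ℝ → ℝ} (hf : Continuous f) (hp : Function.Periodic f 1) :
    Continuous (onCircle f) :=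
  continuous_of_comp_coe (by simpa only [onCircle_coe hp] using hf)

lemma Continuous.integrable_circle {f : UnitAddCircle → ℝ} (hf : Continuous f) : Integrable f := by
  rw [integrable_circle_iff]
  exact (continuous_comp_coe hf).intervalIntegrable _ _

/-! ### Test functions -/

lemma IsTestFunction.continuous {φ : UnitAddCircle → ℝ} (hφ : IsTestFunction φ) : Continuous φ :=
  continuous_of_comp_coe (ContDiff.continuous hφ)

lemma IsTestFunction.isPerC {φ : UnitAddCircle → ℝ} (hφ : IsTestFunction φ) (k : ℕ) :
    IsPerC k (fun t : ℝ => φ (t : UnitAddCircle)) :=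
  ⟨ContDiff.of_le hφ (by exact_mod_cast le_top), periodic_comp_coe φ⟩

lemma isTestFunction_onCircle {f : ℝ → ℝ} (hf : ContDiff ℝ (⊤ : ℕ∞) f)
    (hp : Function.Periodic f 1) : IsTestFunction (onCircle f) := by
  unfold IsTestFunction; simpa only [onCircle_coe hp] using hf

lemma circleDeriv_coe (φ : UnitAddCircle → ℝ) (x : ℝ) :
    circleDeriv φ (x : UnitAddCircle) = deriv (fun t : ℝ => φ (t : UnitAddCircle)) x := by
  unfold circleDeriv
  have : (fun t : ℝ => φ ((x : UnitAddCircle) + (t : UnitAddCircle))) =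
      fun t => (fun s : ℝ => φ (s : UnitAddCircle)) (x + t) := by
    funext t; simp only [AddCircle.coe_add]
  rw [this, deriv_comp_const_add (fun s : ℝ => φ (s : UnitAddCircle))]; simp

lemma iterate_circleDeriv_coe (i : ℕ) (φ : UnitAddCircle → ℝ) (x : ℝ) :
    (circleDeriv^[i] φ) (x : UnitAddCircle) =
      iteratedDeriv i (fun t : ℝ => φ (t : UnitAddCircle)) x := by
  induction i generalizing x with
  | zero => simp
  | succ i ih =>
    rw [Function.iterate_succ_apply', circleDeriv_coe, iteratedDeriv_succ]
    congr 1
    funext t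
    exact ih t

/-- The algebra of test functions. -/
def testSubalgebra : Subalgebra ℝ C(UnitAddCircle, ℝ) where
  carrier := {φ | IsTestFunction φ}
  mul_mem' := fun {a b} (ha : IsTestFunction a) (hb : IsTestFunction b) =>
    show IsTestFunction _ from ContDiff.mul (show ContDiff ℝ _ _ from ha) hb
  add_mem' := fun {a b} (ha : IsTestFunction a) (hb : IsTestFunction b) =>
    show IsTestFunction _ from ContDiff.add (show ContDiff ℝ _ _ from ha) hb
  algebraMap_mem' := fun r => show IsTestFunction (fun _ => r) from contDiff_const

lemma isTestFunction_re_im :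
    IsTestFunction (fun x => (AddCircle.toCircle x : ℂ).re) ∧
      IsTestFunction (fun x => (AddCircle.toCircle x : ℂ).im) := by
  have h : ∀ t : ℝ, ((AddCircle.toCircle (t : UnitAddCircle) : Circle) : ℂ) =
      Real.cos (2 * Real.pi * t) + Real.sin (2 * Real.pi * t) * Complex.I := fun t => by
    rw [AddCircle.toCircle_apply_mk, Circle.coe_exp, Complex.exp_mul_I]
    push_cast; simp
  constructor
  · unfold IsTestFunction
    have : (fun t : ℝ => (AddCircle.toCircle (t : UnitAddCircle) : ℂ).re) =
        fun t => Real.cos (2 * Real.pi * t) := by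
      funext t; rw [h]; simp [-Complex.ofReal_cos, -Complex.ofReal_sin, -Complex.ofReal_mul]
    rw [this]
    exact Real.contDiff_cos.comp (by fun_prop)
  · unfold IsTestFunction
    have : (fun t : ℝ => (AddCircle.toCircle (t : UnitAddCircle) : ℂ).im) =
        fun t => Real.sin (2 * Real.pi * t) := by
      funext t; rw [h]; simp [-Complex.ofReal_cos, -Complex.ofReal_sin, -Complex.ofReal_mul]
    rw [this]
    exact Real.contDiff_sin.comp (by fun_prop)

lemma separatesPoints_testSubalgebra : testSubalgebra.SeparatesPoints := by
  intro x y hxy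
  have hne : (AddCircle.toCircle x : ℂ) ≠ AddCircle.toCircle y := fun h =>
    hxy (AddCircle.injective_toCircle one_ne_zero (Circle.ext h))
  obtain ⟨hre, him⟩ := isTestFunction_re_im
  by_cases h : (AddCircle.toCircle x : ℂ).re = (AddCircle.toCircle y : ℂ).re
  · exact ⟨_, ⟨⟨_, him.continuous⟩, him, rfl⟩, fun h2 => hne (Complex.ext h h2)⟩
  · exact ⟨_, ⟨⟨_, hre.continuous⟩, hre, rfl⟩, h⟩

/-- Test functions are uniformly dense in the continuous functions. -/
lemma exists_isTestFunction_near {φ : UnitAddCircle → ℝ} (hφ : Continuous φ) {ε : ℝ} (hε : 0 < ε) :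
    ∃ ψ, IsTestFunction ψ ∧ ∀ x, |φ x - ψ x| ≤ ε := by
  obtain ⟨g, hg⟩ := ContinuousMap.exists_mem_subalgebra_near_continuous_of_separatesPoints
    testSubalgebra separatesPoints_testSubalgebra φ hφ ε hε
  exact ⟨_, g.2, fun x => by rw [abs_sub_comm]; exact (hg x).le⟩

lemma integrable_mul_continuous {f φ : UnitAddCircle → ℝ} (hf : Integrable f) (hφ : Continuous φ) :
    Integrable (fun x => f x * φ x) := by
  obtain ⟨C, hC⟩ := isCompact_univ.exists_bound_of_continuousOn (f := φ) hφ.continuousOn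
  exact hf.mul_bdd (c := C) hφ.aestronglyMeasurable (Eventually.of_forall fun x => hC x trivial)

lemma integral_posPart_sub_negPart {f φ : UnitAddCircle → ℝ} (hf : Integrable f)
    (hφ : Continuous φ) :
    (∫ x, φ x ∂((volume : Measure UnitAddCircle).withDensity fun x => ENNReal.ofReal (f x))) -
      ∫ x, φ x ∂((volume : Measure UnitAddCircle).withDensity fun x => ENNReal.ofReal (-f x)) =
    ∫ x, f x * φ x := by
  have hint : ∀ g : UnitAddCircle → ℝ, Integrable g →
      ∫ x, φ x ∂((volume : Measure UnitAddCircle).withDensity fun x => ENNReal.ofReal (g x)) =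
        ∫ x, max (g x) 0 * φ x := by
    intro g hg
    rw [integral_withDensity_eq_integral_toReal_smul₀ hg.aemeasurable.ennreal_ofReal
      (Eventually.of_forall fun _ => ENNReal.ofReal_lt_top)]
    simp only [ENNReal.toReal_ofReal', smul_eq_mul]
  rw [hint f hf, hint (fun x => -f x) hf.neg]
  refine (integral_sub (integrable_mul_continuous hf.pos_part hφ)
    (integrable_mul_continuous hf.neg.pos_part hφ)).symm.trans ?_
  refine integral_congr_ae (Eventually.of_forall fun x => ?_)
  simp only [← sub_mul, Pi.neg_apply]; congr 1
  rcases le_total 0 (f x) with h0 | h0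
  · rw [max_eq_left h0, max_eq_right (by linarith), sub_zero]
  · rw [max_eq_right h0, max_eq_left (by linarith)]; ring

/-- An integrable function which is orthogonal to the continuous functions vanishes. -/
lemma ae_eq_zero_of_forall_continuous {f : UnitAddCircle → ℝ} (hf : Integrable f)
    (h : ∀ φ : UnitAddCircle → ℝ, Continuous φ → ∫ x, f x * φ x = 0) : f =ᵐ[volume] 0 := by
  have i1 := isFiniteMeasure_withDensity_ofReal hf.2
  have i2 := isFiniteMeasure_withDensity_ofReal hf.neg.2
  have hm : (volume : Measure UnitAddCircle).withDensity (fun x => ENNReal.ofReal (f x)) =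
      (volume : Measure UnitAddCircle).withDensity (fun x => ENNReal.ofReal (-f x)) :=
    ext_of_forall_integral_eq_of_IsFiniteMeasure fun φ => by
      rw [← sub_eq_zero, integral_posPart_sub_negPart hf φ.continuous]
      exact h φ φ.continuous
  have h1 := withDensityᵥ_eq_withDensity_pos_part_sub_withDensity_neg_part hf
  rw [Measure.toSignedMeasure_congr hm, sub_self, ← withDensityᵥ_zero (μ := volume)] at h1
  exact hf.ae_eq_of_withDensityᵥ_eq (integrable_zero _ _ _) h1

/-- An integrable function which is orthogonal to the test functions vanishes. -/
lemma ae_eq_zero_of_forall_isTestFunction {f : UnitAddCircle → ℝ} (hf : Integrable f)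
    (h : ∀ φ : UnitAddCircle → ℝ, IsTestFunction φ → ∫ x, f x * φ x = 0) : f =ᵐ[volume] 0 := by
  refine ae_eq_zero_of_forall_continuous hf fun φ hφ => ?_
  have hle : ∀ ε > 0, |∫ x, f x * φ x| ≤ 0 + ε := by
    intro ε hε
    set A := ∫ x, |f x| with hA
    have hA0 : 0 ≤ A := integral_nonneg fun x => abs_nonneg _
    obtain ⟨ψ, hψ, hφψ⟩ := exists_isTestFunction_near hφ (ε := ε / (A + 1)) (by positivity)
    have e : ∫ x, f x * φ x = ∫ x, f x * (φ x - ψ x) := by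
      simp only [mul_sub]
      rw [integral_sub (integrable_mul_continuous hf hφ)
        (integrable_mul_continuous hf hψ.continuous), h ψ hψ, sub_zero]
    rw [e, zero_add]
    have h1 : |∫ x, f x * (φ x - ψ x)| ≤ ∫ x, |f x| * (ε / (A + 1)) := by
      rw [← Real.norm_eq_abs]
      refine norm_integral_le_of_norm_le (hf.abs.mul_const _) (Eventually.of_forall fun x => ?_)
      rw [Real.norm_eq_abs, abs_mul]
      exact mul_le_mul_of_nonneg_left (hφψ x) (abs_nonneg _)
    refine h1.trans ?_
    rw [integral_mul_const, ← hA, ← mul_div_assoc, div_le_iff₀ (by positivity)]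
    nlinarith
  exact abs_nonpos_iff.1 (le_of_forall_pos_le_add hle)

/-! ### Weak derivatives -/

lemma IsWeakDeriv.congr {i : ℕ} {f f' g g' : UnitAddCircle → ℝ} (h : IsWeakDeriv i f g)
    (hf : f =ᵐ[volume] f') (hg : g =ᵐ[volume] g') : IsWeakDeriv i f' g' := by
  refine ⟨h.1.congr hg, fun φ hφ => ?_⟩
  have h1 : ∫ x, f' x * (circleDeriv^[i] φ) x = ∫ x, f x * (circleDeriv^[i] φ) x :=
    integral_congr_ae (hf.mono fun x hx => by simp only [hx])
  have h2 : ∫ x, g' x * φ x = ∫ x, g x * φ x :=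
    integral_congr_ae (hg.mono fun x hx => by simp only [hx])
  rw [h1, h2, h.2 φ hφ]

lemma IsWeakDeriv.unique {i : ℕ} {f g g' : UnitAddCircle → ℝ} (h : IsWeakDeriv i f g)
    (h' : IsWeakDeriv i f g') : g =ᵐ[volume] g' := by
  have : (fun x => g x - g' x) =ᵐ[volume] 0 := by
    refine ae_eq_zero_of_forall_isTestFunction (h.1.sub h'.1) fun φ hφ => ?_
    have h1 := (h.2 φ hφ).symm.trans (h'.2 φ hφ)
    have h2 := mul_left_cancel₀ (pow_ne_zero i (by norm_num)) h1
    simp only [sub_mul]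
    rw [integral_sub (integrable_mul_continuous h.1 hφ.continuous)
      (integrable_mul_continuous h'.1 hφ.continuous), h2, sub_self]
  exact this.mono fun x hx => sub_eq_zero.1 hx

lemma IsWeakDeriv.weakDeriv_ae {i : ℕ} {f g : UnitAddCircle → ℝ} (h : IsWeakDeriv i f g) :
    weakDeriv i f =ᵐ[volume] g := by
  have hex : ∃ g, IsWeakDeriv i f g := ⟨g, h⟩
  unfold weakDeriv
  rw [dif_pos hex]
  exact hex.choose_spec.unique h

lemma continuous_iterate_circleDeriv {φ : UnitAddCircle → ℝ} (hφ : IsTestFunction φ) (i : ℕ) :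
    Continuous (circleDeriv^[i] φ) := by
  refine continuous_of_comp_coe ?_
  simp only [iterate_circleDeriv_coe]
  exact (hφ.isPerC i).continuous_iteratedDeriv le_rfl

lemma IsWeakDeriv.add {i : ℕ} {f f' g g' : UnitAddCircle → ℝ} (hf : Integrable f)
    (hf' : Integrable f') (h : IsWeakDeriv i f g) (h' : IsWeakDeriv i f' g') :
    IsWeakDeriv i (fun x => f x + f' x) (fun x => g x + g' x) := by
  refine ⟨h.1.add h'.1, fun φ hφ => ?_⟩
  have hc := continuous_iterate_circleDeriv hφ i
  simp only [add_mul]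
  rw [integral_add (integrable_mul_continuous hf hc) (integrable_mul_continuous hf' hc),
    integral_add (integrable_mul_continuous h.1 hφ.continuous)
      (integrable_mul_continuous h'.1 hφ.continuous), h.2 φ hφ, h'.2 φ hφ, mul_add]

lemma IsWeakDeriv.const_mul {i : ℕ} {f g : UnitAddCircle → ℝ} (h : IsWeakDeriv i f g) (a : ℝ) :
    IsWeakDeriv i (fun x => a * f x) (fun x => a * g x) := by
  refine ⟨h.1.const_mul a, fun φ hφ => ?_⟩
  simp only [mul_assoc]
  rw [integral_const_mul, integral_const_mul, h.2 φ hφ]; ring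

lemma IsWeakDeriv.sub {i : ℕ} {f f' g g' : UnitAddCircle → ℝ} (hf : Integrable f)
    (hf' : Integrable f') (h : IsWeakDeriv i f g) (h' : IsWeakDeriv i f' g') :
    IsWeakDeriv i (fun x => f x - f' x) (fun x => g x - g' x) := by
  have := IsWeakDeriv.add hf (hf'.const_mul (-1)) h (h'.const_mul (-1))
  simpa [sub_eq_add_neg] using this

lemma IsWeakDeriv.sobolevNorm_one {f g : UnitAddCircle → ℝ} (h : IsWeakDeriv 1 f g) :
    sobolevNorm 1 f = (∫ x, |f x|) + ∫ x, |g x| := by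
  unfold sobolevNorm
  rw [Finset.Icc_self, Finset.sum_singleton]
  congr 1
  exact integral_congr_ae (h.weakDeriv_ae.mono fun x hx => by simp only [hx])

lemma memW_one_iff {f : UnitAddCircle → ℝ} :
    MemW 1 f ↔ Integrable f ∧ ∃ g, IsWeakDeriv 1 f g := by
  refine ⟨fun h => ⟨h.1, h.2 1 le_rfl le_rfl⟩, fun h => ⟨h.1, fun i h1 h2 => ?_⟩⟩
  obtain rfl : i = 1 := le_antisymm h2 h1
  exact h.2

lemma IsPerC.integrable_onCircle {f : ℝ → ℝ} {k : ℕ} (hf : IsPerC k f) : Integrable (onCircle f) :=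
  Continuous.integrable_circle (continuous_onCircle hf.continuous hf.periodic)

/-- Integration by parts for periodic functions. -/
lemma integral_mul_deriv_periodic {f g : ℝ → ℝ} (hf : IsPerC 1 f) (hg : IsPerC 1 g) :
    ∫ t in (0:ℝ)..1, f t * deriv g t = -∫ t in (0:ℝ)..1, deriv f t * g t := by
  rw [intervalIntegral.integral_mul_deriv_eq_deriv_mul (u := f) (v := g)
    (fun x _ => hf.hasDerivAt x) (fun x _ => hg.hasDerivAt x)
    (hf.deriv.intervalIntegrable _ _) (hg.deriv.intervalIntegrable _ _)]
  have h1 := hf.periodic 0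
  have h2 := hg.periodic 0
  rw [zero_add] at h1 h2
  rw [h1, h2]; ring

lemma integral_mul_iteratedDeriv_periodic {i : ℕ} {f g : ℝ → ℝ} (hf : IsPerC i f)
    (hg : IsPerC i g) : ∫ t in (0:ℝ)..1, f t * iteratedDeriv i g t =
      (-1) ^ i * ∫ t in (0:ℝ)..1, iteratedDeriv i f t * g t := by
  induction i generalizing f with
  | zero => simp
  | succ i ih =>
    have h1 := integral_mul_deriv_periodic (hf.of_le (m := 1) (by omega))
      (hg.iteratedDeriv (m := 1) (i := i) (by omega))
    rw [← iteratedDeriv_succ] at h1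
    rw [h1, iteratedDeriv_succ' (f := f), pow_succ, ih hf.deriv (hg.of_le (by omega))]
    ring

/-- The derivatives of a smooth function are weak derivatives. -/
lemma IsPerC.isWeakDeriv {k : ℕ} {f : ℝ → ℝ} (hf : IsPerC k f) {i : ℕ} (hi : i ≤ k) :
    IsWeakDeriv i (onCircle f) (onCircle (_root_.iteratedDeriv i f)) := by
  have hfi := hf.iteratedDeriv (m := 0) (i := i) (by omega)
  refine ⟨hfi.integrable_onCircle, fun φ hφ => ?_⟩
  rw [integral_circle, integral_circle]
  simp only [onCircle_coe hf.periodic, onCircle_coe hfi.periodic, iterate_circleDeriv_coe]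
  exact integral_mul_iteratedDeriv_periodic (hf.of_le hi) (hφ.isPerC i)

lemma IsPerC.memW {k : ℕ} {f : ℝ → ℝ} (hf : IsPerC k f) : MemW k (onCircle f) :=
  ⟨hf.integrable_onCircle, fun _ _ hi => ⟨_, hf.isWeakDeriv hi⟩⟩

end

section

/-! ### Absolutely continuous representatives -/

section primitive
variable {g : ℝ → ℝ}

lemma intervalIntegrable_periodic (hg : Function.Periodic g 1)
    (hi : IntervalIntegrable g volume 0 1) (a b : ℝ) : IntervalIntegrable g volume a b :=
  hg.intervalIntegrable₀ one_ne_zero hi a b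

lemma primitive_sub (hg : Function.Periodic g 1) (hi : IntervalIntegrable g volume 0 1)
    (a b : ℝ) : (∫ t in (0:ℝ)..b, g t) - ∫ t in (0:ℝ)..a, g t = ∫ t in a..b, g t :=
  intervalIntegral.integral_interval_sub_left (intervalIntegrable_periodic hg hi _ _)
    (intervalIntegrable_periodic hg hi _ _)

lemma primitive_add_one (hg : Function.Periodic g 1) (hi : IntervalIntegrable g volume 0 1)
    (x : ℝ) : ∫ t in (0:ℝ)..(x + 1), g t = (∫ t in (0:ℝ)..x, g t) + ∫ t in (0:ℝ)..1, g t := by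
  have h1 := primitive_sub hg hi x (x + 1)
  have h2 := hg.intervalIntegral_add_eq x 0
  rw [zero_add] at h2
  linarith

lemma continuous_primitive (hg : Function.Periodic g 1) (hi : IntervalIntegrable g volume 0 1) :
    Continuous fun x => ∫ t in (0:ℝ)..x, g t :=
  intervalIntegral.continuous_primitive (fun a b => intervalIntegrable_periodic hg hi a b) 0

lemma primitive_isPerC (hg : Function.Periodic g 1) (hi : IntervalIntegrable g volume 0 1)
    (h0 : ∫ t in (0:ℝ)..1, g t = 0) : IsPerC 0 fun x => ∫ t in (0:ℝ)..x, g t :=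
  ⟨by rw [Nat.cast_zero, contDiff_zero]; exact continuous_primitive hg hi,
    fun x => by simp only [primitive_add_one hg hi, h0, add_zero]⟩

lemma primitive_isPerC_succ {k : ℕ} (hg : IsPerC k g) (h0 : ∫ t in (0:ℝ)..1, g t = 0) :
    IsPerC (k + 1) fun x => ∫ t in (0:ℝ)..x, g t := by
  refine ⟨?_, (primitive_isPerC hg.periodic (hg.intervalIntegrable _ _) h0).periodic⟩
  have hd : ∀ x, HasDerivAt (fun x => ∫ t in (0:ℝ)..x, g t) (g x) x := fun x =>
    hg.continuous.integral_hasStrictDerivAt 0 x |>.hasDerivAt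
  push_cast
  rw [contDiff_succ_iff_deriv]
  refine ⟨fun x => (hd x).differentiableAt, by simp, ?_⟩
  rw [funext fun x => (hd x).deriv]
  exact hg.contDiff

/-- Integration by parts for the primitive of an integrable function. -/
lemma integral_primitive_mul_deriv (hi : IntervalIntegrable g volume 0 1) (h0 : ∫ t in (0:ℝ)..1, g t = 0) {φ : ℝ → ℝ}
    (hφ : IsPerC 1 φ) : ∫ x in (0:ℝ)..1, (∫ t in (0:ℝ)..x, g t) * deriv φ x =
      -∫ x in (0:ℝ)..1, g x * φ x := by
  have hG := hi.absolutelyContinuousOnInterval_intervalIntegral (c := 0) (by simp)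
  have hφa : AbsolutelyContinuousOnInterval φ 0 1 :=
    ContDiffOn.absolutelyContinuousOnInterval (hφ.contDiff.contDiffOn)
  rw [hG.integral_mul_deriv_eq_deriv_mul hφa, h0]
  simp only [intervalIntegral.integral_same, zero_mul, sub_zero, zero_sub, neg_inj]
  refine intervalIntegral.integral_congr_ae ?_
  filter_upwards [hi.ae_hasDerivAt_integral] with x hx hx2
  rw [(hx (Set.uIoc_subset_uIcc hx2) 0 (by simp)).deriv]

end primitive

lemma integrable_lift {f : UnitAddCircle → ℝ} (hf : Integrable f) :
    IntervalIntegrable (fun t : ℝ => f (t : UnitAddCircle)) volume 0 1 :=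
  (integrable_circle_iff f).1 hf

lemma IsWeakDeriv.integral_eq_zero {f g : UnitAddCircle → ℝ} (h : IsWeakDeriv 1 f g) :
    ∫ x, g x = 0 := by
  have h1 := h.2 (fun _ => 1) (contDiff_const : ContDiff ℝ _ _)
  have h2 : circleDeriv^[1] (fun _ => 1) = fun _ => 0 := by
    funext x; simp [circleDeriv]
  rw [h2] at h1
  simpa using h1

/-- The primitive of an integrable function of zero average. -/
def circlePrimitive (g : UnitAddCircle → ℝ) (x : ℝ) : ℝ := ∫ t in (0:ℝ)..x, g (t : UnitAddCircle)

lemma isPerC_circlePrimitive {g : UnitAddCircle → ℝ} (hg : Integrable g) (h0 : ∫ x, g x = 0) :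
    IsPerC 0 (circlePrimitive g) :=
  primitive_isPerC (periodic_comp_coe g) (integrable_lift hg) (by rw [← integral_circle]; exact h0)

lemma IsWeakDeriv.exists_ae_eq {f g : UnitAddCircle → ℝ} (hf : Integrable f)
    (h : IsWeakDeriv 1 f g) : ∃ a : ℝ, f =ᵐ[volume] onCircle (fun x => a + circlePrimitive g x) := by
  have hg0 := h.integral_eq_zero
  have hP := isPerC_circlePrimitive h.1 hg0
  set G := circlePrimitive g with hG
  have hGi := hP.integrable_onCircle
  have hGc := continuous_onCircle hP.continuous hP.periodic
  set a := ∫ x, (f x - onCircle G x) with ha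
  refine ⟨a, ?_⟩
  have key : (fun x => f x - onCircle G x - a) =ᵐ[volume] 0 := by
    refine ae_eq_zero_of_forall_isTestFunction ((hf.sub hGi).sub (integrable_const _)) fun ψ hψ => ?_
    set m := ∫ x, ψ x with hm
    have hψC := fun k => hψ.isPerC k
    have hψm : ∀ k, IsPerC k fun t : ℝ => ψ (t : UnitAddCircle) - m := fun k =>
      (hψC k).sub (IsPerC.const m)
    have hψ0 : ∫ t in (0:ℝ)..1, (ψ (t : UnitAddCircle) - m) = 0 := by
      rw [intervalIntegral.integral_sub ((hψC 0).intervalIntegrable _ _) (by simp),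
        ← integral_circle, ← hm]; simp
    set Φ : ℝ → ℝ := fun x => ∫ t in (0:ℝ)..x, (ψ (t : UnitAddCircle) - m) with hΦ
    have hΦC : ∀ k, IsPerC (k + 1) Φ := fun k => primitive_isPerC_succ (hψm k) hψ0
    have hΦd : deriv Φ = fun t : ℝ => ψ (t : UnitAddCircle) - m := funext fun x =>
      ((hψm 0).continuous.integral_hasStrictDerivAt 0 x).hasDerivAt.deriv
    have hΦp := (hΦC 0).periodic
    have hΦt : IsTestFunction (onCircle Φ) := by
      refine isTestFunction_onCircle (contDiff_infty.2 fun n => ?_) hΦp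
      exact ((hΦC n).of_le (Nat.le_succ n)).contDiff
    have h1 := h.2 _ hΦt
    rw [pow_one, integral_circle, integral_circle] at h1
    simp only [iterate_circleDeriv_coe, onCircle_coe hΦp, iteratedDeriv_one] at h1
    have h2 := integral_primitive_mul_deriv (integrable_lift h.1)
      (by rw [← integral_circle]; exact hg0) (hΦC 0)
    have h3 : ∫ x, f x * (ψ x - m) = ∫ x, onCircle G x * (ψ x - m) := by
      rw [integral_circle, integral_circle]
      simp only [onCircle_coe hP.periodic]
      simp only [hΦd] at h1 h2
      rw [h1, neg_one_mul]
      exact h2.symm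
    have i1 : Integrable fun x => f x * (ψ x - m) :=
      integrable_mul_continuous hf (hψ.continuous.sub continuous_const)
    have i2 : Integrable fun x => onCircle G x * (ψ x - m) :=
      integrable_mul_continuous hGi (hψ.continuous.sub continuous_const)
    have e : ∀ x, (f x - onCircle G x - a) * ψ x =
        (f x * (ψ x - m) - onCircle G x * (ψ x - m)) + ((f x - onCircle G x) * m - a * ψ x) :=
      fun x => by ring
    simp only [e]
    have i3 : Integrable fun x => (f x - onCircle G x) * m := (hf.sub hGi).mul_const m
    have i4 : Integrable fun x => a * ψ x := (Continuous.integrable_circle hψ.continuous).const_mul a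
    have i12 : Integrable fun x => f x * (ψ x - m) - onCircle G x * (ψ x - m) := i1.sub i2
    have i34 : Integrable fun x => (f x - onCircle G x) * m - a * ψ x := i3.sub i4
    rw [integral_add i12 i34, integral_sub i1 i2, h3, sub_self, zero_add,
      integral_sub i3 i4, integral_mul_const, integral_const_mul, ← ha, ← hm, sub_self]
  refine key.mono fun x hx => ?_
  have hx' : f x - onCircle G x - a = 0 := hx
  change f x = a + onCircle G x
  linarith

/-- Weak derivatives can be tested against functions of class `C^1`. -/
lemma IsWeakDeriv.integral_mul_deriv {f g : UnitAddCircle → ℝ} (hf : Integrable f)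
    (h : IsWeakDeriv 1 f g) {φ : ℝ → ℝ} (hφ : IsPerC 1 φ) :
    ∫ x, f x * onCircle (deriv φ) x = -∫ x, g x * onCircle φ x := by
  obtain ⟨a, ha⟩ := h.exists_ae_eq hf
  have hg0 := h.integral_eq_zero
  have hP := isPerC_circlePrimitive h.1 hg0
  have h1 : ∫ x, f x * onCircle (deriv φ) x =
      ∫ x, onCircle (fun x => a + circlePrimitive g x) x * onCircle (deriv φ) x :=
    integral_congr_ae (ha.mono fun x hx => by simp only [hx])
  rw [h1, integral_circle, integral_circle]
  simp only [onCircle_coe hφ.periodic, onCircle_coe hφ.deriv.periodic,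
    onCircle_coe ((IsPerC.const (k := 0) a).add hP).periodic, add_mul]
  have hi : IntervalIntegrable (fun t => circlePrimitive g t * deriv φ t) volume 0 1 :=
    (hP.continuous.mul hφ.deriv.continuous).intervalIntegrable _ _
  rw [intervalIntegral.integral_add ((hφ.deriv.const_mul a).intervalIntegrable _ _) hi,
    intervalIntegral.integral_const_mul]
  have h2 := integral_primitive_mul_deriv (integrable_lift h.1)
      (by rw [← integral_circle]; exact hg0) hφ
  have h3 : ∫ x in (0:ℝ)..1, deriv φ x = 0 := by
    rw [intervalIntegral.integral_deriv_eq_sub' φ rfl (fun x _ => (hφ.hasDerivAt x).differentiableAt)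
      hφ.deriv.continuous.continuousOn]
    have := hφ.periodic 0
    rw [zero_add] at this
    rw [this, sub_self]
  rw [h3, mul_zero, zero_add]
  exact h2

/-! ### The transfer operator on integrable functions on the circle -/

/-- The transfer operator acting on functions on the circle. -/
def circleTransfer (E : ExpandingLift) (f : UnitAddCircle → ℝ) : UnitAddCircle → ℝ :=
  onCircle (E.transferOp fun t : ℝ => f (t : UnitAddCircle))

section circleTransfer
variable {E : ExpandingLift} {f g : UnitAddCircle → ℝ}

lemma circleTransfer_coe (f : UnitAddCircle → ℝ) (x : ℝ) :
    circleTransfer E f (x : UnitAddCircle) =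
      E.transferOp (fun t : ℝ => f (t : UnitAddCircle)) x :=
  onCircle_coe (ExpandingLift.transferOp_periodic (periodic_comp_coe f)) x

lemma circleTransfer_onCircle {H : ℝ → ℝ} (hH : Function.Periodic H 1) :
    circleTransfer E (onCircle H) = onCircle (E.transferOp H) := by
  unfold circleTransfer; simp only [onCircle_coe hH]

lemma integrable_circleTransfer (hf : Integrable f) : Integrable (circleTransfer E f) := by
  rw [integrable_circle_iff]
  simp only [circleTransfer_coe]
  exact ExpandingLift.intervalIntegrable_transferOp (periodic_comp_coe f) (integrable_lift hf)

lemma integral_circleTransfer (hf : Integrable f) : ∫ x, circleTransfer E f x = ∫ x, f x := by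
  rw [integral_circle, integral_circle]
  simp only [circleTransfer_coe]
  exact ExpandingLift.integral_transferOp (periodic_comp_coe f) (integrable_lift hf)

lemma circleTransfer_sub (f g : UnitAddCircle → ℝ) :
    circleTransfer E (fun x => f x - g x) =
      fun x => circleTransfer E f x - circleTransfer E g x := by
  unfold circleTransfer
  have := map_sub E.transferOp (fun t : ℝ => f (t : UnitAddCircle)) (fun t : ℝ => g (t : UnitAddCircle))
  funext x
  exact congrFun this _

lemma abs_circleTransfer_le (f : UnitAddCircle → ℝ) (x : UnitAddCircle) :
    |circleTransfer E f x| ≤ circleTransfer E (fun y => |f y|) x :=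
  ExpandingLift.abs_transferOp_le _ _

lemma integral_abs_circleTransfer_le (hf : Integrable f) :
    ∫ x, |circleTransfer E f x| ≤ ∫ x, |f x| := by
  rw [← integral_circleTransfer (E := E) hf.abs]
  exact integral_mono (integrable_circleTransfer hf).abs (integrable_circleTransfer hf.abs)
    (abs_circleTransfer_le f)

lemma circleTransfer_congr (hf : Integrable f) (hg : Integrable g) (h : f =ᵐ[volume] g) :
    circleTransfer E f =ᵐ[volume] circleTransfer E g := by
  have h1 := integral_abs_circleTransfer_le (E := E) (hf.sub hg)
  have h2 : ∫ x, |(f - g) x| = 0 := by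
    rw [integral_eq_zero_iff_of_nonneg (fun _ => abs_nonneg _) (hf.sub hg).abs]
    exact h.mono fun x hx => by simp [hx]
  have h3 : ∫ x, |circleTransfer E (f - g) x| = 0 :=
    le_antisymm (h1.trans h2.le) (integral_nonneg fun _ => abs_nonneg _)
  rw [integral_eq_zero_iff_of_nonneg (fun _ => abs_nonneg _)
    (integrable_circleTransfer (hf.sub hg)).abs] at h3
  refine h3.mono fun x hx => ?_
  have hx' : |circleTransfer E (f - g) x| = 0 := hx
  have e : circleTransfer E (f - g) x = circleTransfer E f x - circleTransfer E g x :=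
    congrFun (circleTransfer_sub f g) x
  rw [e, abs_eq_zero, sub_eq_zero] at hx'
  exact hx'

/-- `E` is a lift of `T`. -/
def ExpandingLift.Lifts (E : ExpandingLift) (T : UnitAddCircle → UnitAddCircle) : Prop :=
  ∀ x : ℝ, T (x : UnitAddCircle) = (E.F x : UnitAddCircle)

variable {T : UnitAddCircle → UnitAddCircle}

lemma circleTransfer_mul_comp (hT : E.Lifts T) (f φ : UnitAddCircle → ℝ) (x : UnitAddCircle) :
    circleTransfer E (fun y => f y * φ (T y)) x = circleTransfer E f x * φ x := by
  obtain ⟨t, rfl⟩ := QuotientAddGroup.mk_surjective x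
  rw [circleTransfer_coe, circleTransfer_coe]
  have := ExpandingLift.transferOp_mul_comp (E := E) (fun t : ℝ => f (t : UnitAddCircle)) _
    (periodic_comp_coe φ) t
  rw [← this]
  refine congrArg (fun u => E.transferOp u t) (funext fun s => ?_)
  rw [hT s]

lemma integral_circleTransfer_mul (hT : E.Lifts T) {φ : UnitAddCircle → ℝ}
    (h : Integrable fun x => f x * φ (T x)) :
    ∫ x, circleTransfer E f x * φ x = ∫ x, f x * φ (T x) := by
  rw [← integral_circleTransfer (E := E) h]
  simp only [circleTransfer_mul_comp hT]

lemma ExpandingLift.Lifts.continuous (hT : E.Lifts T) : Continuous T := by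
  refine continuous_coinduced_dom.2 ?_
  have : T ∘ (QuotientAddGroup.mk : ℝ → UnitAddCircle) = fun x : ℝ => (E.F x : UnitAddCircle) :=
    funext hT
  change Continuous (T ∘ (QuotientAddGroup.mk : ℝ → UnitAddCircle))
  rw [this]
  exact (AddCircle.continuous_mk' 1).comp E.differentiable_F.continuous

end circleTransfer

end

section

/-! ### Decay in `W^{1,1}` -/

variable {E : ExpandingLift} {T : UnitAddCircle → UnitAddCircle}

lemma ExpandingLift.isPerC_c (E : ExpandingLift) : IsPerC 1 E.c :=
  ⟨by exact_mod_cast E.contDiff_one_c, E.c_periodic⟩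

lemma periodic_comp_F (E : ExpandingLift) {φ : ℝ → ℝ} (hφ : Function.Periodic φ 1) :
    Function.Periodic (fun t => φ (E.F t)) 1 := fun t => by
  simp only
  rw [E.F_add_one]
  rcases E.s_eq with h | h <;> rw [h]
  · simpa using hφ.nat_mul E.D (E.F t)
  · have := hφ.sub_nat_mul_eq (x := E.F t) E.D
    rw [← this]; congr 1; ring

/-- The weak derivative of the image of a function by the transfer operator. -/
lemma IsWeakDeriv.circleTransfer (hT : E.Lifts T) {f g : UnitAddCircle → ℝ} (hf : Integrable f)
    (h : IsWeakDeriv 1 f g) : IsWeakDeriv 1 (circleTransfer E f)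
      (circleTransfer E fun x => g x * onCircle E.c x + f x * onCircle (deriv E.c) x) := by
  have hc := E.isPerC_c
  have hcc := continuous_onCircle hc.continuous hc.periodic
  have hcd := continuous_onCircle hc.deriv.continuous hc.deriv.periodic
  have hint : Integrable fun x => g x * onCircle E.c x + f x * onCircle (deriv E.c) x :=
    (integrable_mul_continuous h.1 hcc).add (integrable_mul_continuous hf hcd)
  refine ⟨integrable_circleTransfer hint, fun φ hφ => ?_⟩
  have hφT : Continuous fun x => φ (T x) := hφ.continuous.comp hT.continuous
  have hφT' : Continuous fun x => (circleDeriv^[1] φ) (T x) :=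
    (continuous_iterate_circleDeriv hφ 1).comp hT.continuous
  rw [integral_circleTransfer_mul hT (integrable_mul_continuous hf hφT'),
    integral_circleTransfer_mul hT (integrable_mul_continuous hint hφT)]
  set φl : ℝ → ℝ := fun t => φ (t : UnitAddCircle) with hφl
  have hφl1 : IsPerC 1 φl := hφ.isPerC 1
  set ψ : ℝ → ℝ := fun t => E.c t * φl (E.F t) with hψ
  have hψC : IsPerC 1 ψ := by
    refine ⟨hc.contDiff.mul (hφl1.contDiff.comp (E.contDiff_F.of_le (by norm_num))), ?_⟩
    exact hc.periodic.mul (periodic_comp_F E hφl1.periodic)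
  have hψd : ∀ t, deriv ψ t = deriv E.c t * φl (E.F t) + deriv φl (E.F t) := by
    intro t
    have h1 := (hc.hasDerivAt t).fun_mul
      ((hφl1.hasDerivAt (E.F t)).comp t (E.differentiable_F t).hasDerivAt)
    have h2 : deriv ψ t = _ := h1.deriv
    rw [h2]
    simp only [Function.comp]
    have : E.c t * (deriv φl (E.F t) * deriv E.F t) = deriv φl (E.F t) := by
      unfold ExpandingLift.c
      field_simp [E.deriv_ne_zero t]
    rw [this]
  have hpt : ∀ x, (circleDeriv^[1] φ) (T x) =
      onCircle (deriv ψ) x - onCircle (deriv E.c) x * φ (T x) := by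
    intro x
    obtain ⟨t, rfl⟩ := QuotientAddGroup.mk_surjective x
    have e : T (t : UnitAddCircle) = (E.F t : UnitAddCircle) := hT t
    change (circleDeriv^[1] φ) (T (t : UnitAddCircle)) = onCircle (deriv ψ) (t : UnitAddCircle) -
      onCircle (deriv E.c) (t : UnitAddCircle) * φ (T (t : UnitAddCircle))
    rw [e, iterate_circleDeriv_coe, iteratedDeriv_one, onCircle_coe hψC.deriv.periodic,
      onCircle_coe hc.deriv.periodic, hψd]
    ring
  have hpt2 : ∀ x, onCircle ψ x = onCircle E.c x * φ (T x) := by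
    intro x
    obtain ⟨t, rfl⟩ := QuotientAddGroup.mk_surjective x
    have e : T (t : UnitAddCircle) = (E.F t : UnitAddCircle) := hT t
    change onCircle ψ (t : UnitAddCircle) =
      onCircle E.c (t : UnitAddCircle) * φ (T (t : UnitAddCircle))
    rw [e, onCircle_coe hψC.periodic, onCircle_coe hc.periodic]
  have i1 : Integrable fun x => f x * onCircle (deriv ψ) x :=
    integrable_mul_continuous hf (continuous_onCircle hψC.deriv.continuous hψC.deriv.periodic)
  have i2 : Integrable fun x => f x * (onCircle (deriv E.c) x * φ (T x)) :=
    integrable_mul_continuous hf (hcd.mul hφT)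
  have i3 : Integrable fun x => g x * onCircle ψ x :=
    integrable_mul_continuous h.1 (continuous_onCircle hψC.continuous hψC.periodic)
  have e1 : ∀ x, f x * (circleDeriv^[1] φ) (T x) =
      f x * onCircle (deriv ψ) x - f x * (onCircle (deriv E.c) x * φ (T x)) := fun x => by
    rw [hpt]; ring
  have e2 : ∀ x, (g x * onCircle E.c x + f x * onCircle (deriv E.c) x) * φ (T x) =
      g x * onCircle ψ x + f x * (onCircle (deriv E.c) x * φ (T x)) := fun x => by
    rw [hpt2]; ring
  simp only [e1, e2]
  rw [integral_sub i1 i2, integral_add i3 i2, h.integral_mul_deriv hf hψC]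
  ring

/-- The Lasota--Yorke inequality in `W^{1,1}`. -/
lemma exists_lasotaYorke (hT : E.Lifts T) : ∃ K : ℝ, 0 ≤ K ∧ ∀ f g : UnitAddCircle → ℝ,
    Integrable f → IsWeakDeriv 1 f g → ∃ g', IsWeakDeriv 1 (circleTransfer E f) g' ∧
      ∫ x, |g' x| ≤ E.α * (∫ x, |g x|) + K * ∫ x, |f x| := by
  have hc := E.isPerC_c
  obtain ⟨K, hK⟩ := hc.deriv.exists_abs_le
  refine ⟨K, (abs_nonneg _).trans (hK 0), fun f g hf h => ⟨_, h.circleTransfer hT hf, ?_⟩⟩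
  have hcc := continuous_onCircle hc.continuous hc.periodic
  have hcd := continuous_onCircle hc.deriv.continuous hc.deriv.periodic
  have hint : Integrable fun x => g x * onCircle E.c x + f x * onCircle (deriv E.c) x :=
    (integrable_mul_continuous h.1 hcc).add (integrable_mul_continuous hf hcd)
  refine (integral_abs_circleTransfer_le hint).trans ?_
  rw [← integral_const_mul, ← integral_const_mul,
    ← integral_add (h.1.abs.const_mul _) (hf.abs.const_mul _)]
  refine integral_mono hint.abs ((h.1.abs.const_mul _).add (hf.abs.const_mul _)) fun x => ?_
  refine (abs_add_le _ _).trans (add_le_add ?_ ?_)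
  · rw [abs_mul, mul_comm]
    exact mul_le_mul_of_nonneg_right (E.abs_c_le _) (abs_nonneg _)
  · rw [abs_mul, mul_comm]
    exact mul_le_mul_of_nonneg_right (hK _) (abs_nonneg _)

/-- Approximation of an absolutely continuous function of zero average by moving averages. -/
lemma exists_smooth_approx {g : ℝ → ℝ} (hg : Function.Periodic g 1)
    (hi : IntervalIntegrable g volume 0 1) {a : ℝ} {f : ℝ → ℝ}
    (hfdef : f = fun x => a + ∫ t in (0:ℝ)..x, g t) (hf : IsPerC 0 f)
    (hf0 : ∫ t in (0:ℝ)..1, f t = 0) {η : ℝ} (hη : 0 < η) (hη1 : η ≤ 1) :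
    ∃ p, IsPerC 1 p ∧ ∫ t in (0:ℝ)..1, p t = 0 ∧
      (∀ i ≤ 1, ∀ x, |iteratedDeriv i p x| ≤ (∫ t in (0:ℝ)..1, |g t|) / η) ∧
      ∫ t in (0:ℝ)..1, |f t - p t| ≤ η * ∫ t in (0:ℝ)..1, |g t| := by
  set A := ∫ t in (0:ℝ)..1, |g t| with hA
  have hA0 : 0 ≤ A := intervalIntegral.integral_nonneg zero_le_one fun _ _ => abs_nonneg _
  have hga : Function.Periodic (fun t => |g t|) 1 := fun t => by simp only [hg t]
  have hia : IntervalIntegrable (fun t => |g t|) volume 0 1 := hi.abs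
  set N : ℝ → ℝ := fun x => ∫ t in (0:ℝ)..x, |g t| with hN
  have hNc : Continuous N := continuous_primitive hga hia
  have hN1 : ∀ x, N (x + 1) = N x + A := fun x => primitive_add_one hga hia x
  have hNmono : Monotone N := fun x y hxy => by
    have h1 := primitive_sub hga hia x y
    have h2 : 0 ≤ ∫ t in x..y, |g t| := intervalIntegral.integral_nonneg hxy fun _ _ => abs_nonneg _
    simp only [hN]; linarith
  have hinc : ∀ x y, x ≤ y → |f y - f x| ≤ N y - N x := by
    intro x y hxy
    have h1 := primitive_sub hg hi x y
    have h2 := primitive_sub hga hia x y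
    have e : f y - f x = ∫ t in x..y, g t := by rw [← h1, hfdef]; ring
    rw [e]; simp only [hN]; rw [h2]
    exact intervalIntegral.abs_integral_le_integral_abs hxy
  set Φ : ℝ → ℝ := fun x => ∫ t in (0:ℝ)..x, f t with hΦ
  have hΦC : IsPerC 1 Φ := primitive_isPerC_succ hf hf0
  have hΦd : ∀ x, HasDerivAt Φ (f x) x := fun x =>
    (hf.continuous.integral_hasStrictDerivAt 0 x).hasDerivAt
  have hΦsub : ∀ x y, Φ y - Φ x = ∫ t in x..y, f t := fun x y =>
    primitive_sub hf.periodic (hf.intervalIntegrable _ _) x y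
  set p : ℝ → ℝ := fun x => η⁻¹ * (Φ (x + η) - Φ x) with hp
  have hΦs : IsPerC 1 fun x => Φ (x + η) :=
    ⟨hΦC.contDiff.comp (contDiff_id.add contDiff_const), fun x => by
      rw [add_right_comm, hΦC.periodic]⟩
  have hpC : IsPerC 1 p := (hΦs.sub hΦC).const_mul _
  have hpd : ∀ x, deriv p x = η⁻¹ * (f (x + η) - f x) := fun x =>
    ((((hΦd (x + η)).comp_add_const x η).sub (hΦd x)).const_mul η⁻¹).deriv
  have hfb : ∀ x, |f x| ≤ A := by
    intro x
    have h1 : f x = ∫ y in x..(x + 1), (f x - f y) := by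
      rw [intervalIntegral.integral_sub (by simp) (hf.intervalIntegrable _ _),
        hf.periodic.intervalIntegral_add_eq x 0, zero_add, hf0]; simp
    rw [h1]
    have h2 := intervalIntegral.norm_integral_le_of_norm_le_const (a := x) (b := x + 1) (C := A)
      (f := fun y => f x - f y) fun y hy => by
        rw [Set.uIoc_of_le (by linarith)] at hy
        have h3 := hinc x y hy.1.le
        rw [abs_sub_comm] at h3
        have h4 := hNmono hy.2
        have h5 := hN1 x
        exact h3.trans (by linarith)
    simpa using h2
  have hη' : 0 ≤ η⁻¹ := inv_nonneg.2 hη.le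
  have hpf : ∀ x, |f x - p x| ≤ N (x + η) - N x := by
    intro x
    have h1 : f x - p x = η⁻¹ * ∫ y in x..(x + η), (f x - f y) := by
      rw [intervalIntegral.integral_sub (by simp) (hf.intervalIntegrable _ _), ← hΦsub, hp]
      simp only [intervalIntegral.integral_const, add_sub_cancel_left, smul_eq_mul]
      field_simp
    rw [h1, abs_mul, abs_of_nonneg hη']
    have h2 := intervalIntegral.norm_integral_le_of_norm_le_const (a := x) (b := x + η)
      (C := N (x + η) - N x) (f := fun y => f x - f y) fun y hy => by
        rw [Set.uIoc_of_le (by linarith)] at hy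
        have h3 := hinc x y hy.1.le
        rw [abs_sub_comm] at h3
        have h4 := hNmono hy.2
        exact h3.trans (by linarith)
    rw [add_sub_cancel_left, abs_of_pos hη, Real.norm_eq_abs] at h2
    rw [inv_mul_le_iff₀ hη, mul_comm η]
    exact h2
  refine ⟨p, hpC, ?_, ?_, ?_⟩
  · rw [hp, intervalIntegral.integral_const_mul, intervalIntegral.integral_sub
      (hΦs.intervalIntegrable _ _) (hΦC.intervalIntegrable _ _),
      intervalIntegral.integral_comp_add_right (fun x => Φ x)]
    have := hΦC.periodic.intervalIntegral_add_eq η 0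
    rw [zero_add] at this
    rw [zero_add, add_comm (1:ℝ), this, sub_self, mul_zero]
  · intro i hi x
    rcases Nat.le_one_iff_eq_zero_or_eq_one.1 hi with rfl | rfl
    · rw [iteratedDeriv_zero]
      simp only [hp]
      rw [hΦsub, abs_mul, abs_of_nonneg hη', div_eq_inv_mul]
      refine mul_le_mul_of_nonneg_left ?_ hη'
      have h2 := intervalIntegral.norm_integral_le_of_norm_le_const (a := x) (b := x + η)
        (C := A) (f := f) fun y _ => hfb y
      rw [add_sub_cancel_left, abs_of_pos hη, Real.norm_eq_abs] at h2
      exact h2.trans (mul_le_of_le_one_right hA0 hη1)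
    · rw [iteratedDeriv_one, hpd, abs_mul, abs_of_nonneg hη', div_eq_inv_mul]
      refine mul_le_mul_of_nonneg_left ?_ hη'
      refine (hinc x (x + η) (by linarith)).trans ?_
      have := hNmono (by linarith : x + η ≤ x + 1)
      linarith [hN1 x]
  · have h1 : ∫ t in (0:ℝ)..1, |f t - p t| ≤ ∫ t in (0:ℝ)..1, (N (t + η) - N t) :=
      intervalIntegral.integral_mono_on zero_le_one
        ((hf.continuous.sub hpC.continuous).abs.intervalIntegrable _ _)
        (((hNc.comp (by fun_prop)).sub hNc).intervalIntegrable _ _) fun t _ => hpf t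
    refine h1.trans (le_of_eq ?_)
    have hNi : ∀ a b, IntervalIntegrable N volume a b := fun a b => hNc.intervalIntegrable a b
    have hNsi : IntervalIntegrable (fun t => N (t + η)) volume 0 1 :=
      (hNc.comp (by fun_prop)).intervalIntegrable _ _
    rw [intervalIntegral.integral_sub hNsi (hNi _ _),
      intervalIntegral.integral_comp_add_right (fun x => N x), zero_add]
    have e1 := intervalIntegral.integral_add_adjacent_intervals (hNi 0 η) (hNi η (1 + η))
    have e2 := intervalIntegral.integral_add_adjacent_intervals (hNi 0 1) (hNi 1 (1 + η))
    have e3 : ∫ t in (1:ℝ)..(1 + η), N t = ∫ t in (0:ℝ)..η, (N t + A) := by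
      have := intervalIntegral.integral_comp_add_right (a := 0) (b := η) (fun x => N x) 1
      rw [zero_add, add_comm η] at this
      rw [← this]
      simp only [hN1]
    rw [intervalIntegral.integral_add (hNi _ _) (by simp)] at e3
    simp only [intervalIntegral.integral_const, sub_zero, smul_eq_mul] at e3
    linarith

lemma circleTransfer_iterate_onCircle {H : ℝ → ℝ} (hH : Function.Periodic H 1) (n : ℕ) :
    (circleTransfer E)^[n] (onCircle H) = onCircle (E.transferOp^[n] H) ∧
      Function.Periodic (E.transferOp^[n] H) 1 := by
  induction n with
  | zero => exact ⟨rfl, hH⟩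
  | succ n ih =>
    rw [Function.iterate_succ_apply', Function.iterate_succ_apply', ih.1]
    exact ⟨circleTransfer_onCircle ih.2, ExpandingLift.transferOp_periodic ih.2⟩

lemma integrable_circleTransfer_iterate {f : UnitAddCircle → ℝ} (hf : Integrable f) (n : ℕ) :
    Integrable ((circleTransfer E)^[n] f) := by
  induction n with
  | zero => exact hf
  | succ n ih => rw [Function.iterate_succ_apply']; exact integrable_circleTransfer ih

lemma integral_circleTransfer_iterate {f : UnitAddCircle → ℝ} (hf : Integrable f) (n : ℕ) :
    ∫ x, (circleTransfer E)^[n] f x = ∫ x, f x := by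
  induction n with
  | zero => rfl
  | succ n ih =>
    rw [Function.iterate_succ_apply',
      integral_circleTransfer (integrable_circleTransfer_iterate hf n), ih]

lemma integral_abs_circleTransfer_iterate_le {f : UnitAddCircle → ℝ} (hf : Integrable f) (n : ℕ) :
    ∫ x, |(circleTransfer E)^[n] f x| ≤ ∫ x, |f x| := by
  induction n with
  | zero => exact le_rfl
  | succ n ih =>
    rw [Function.iterate_succ_apply']
    exact (integral_abs_circleTransfer_le (integrable_circleTransfer_iterate hf n)).trans ih

lemma circleTransfer_iterate_sub (f g : UnitAddCircle → ℝ) (n : ℕ) :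
    (circleTransfer E)^[n] (fun x => f x - g x) =
      fun x => (circleTransfer E)^[n] f x - (circleTransfer E)^[n] g x := by
  induction n with
  | zero => rfl
  | succ n ih => simp only [Function.iterate_succ_apply', ih, circleTransfer_sub]

lemma circleTransfer_iterate_congr {f g : UnitAddCircle → ℝ} (hf : Integrable f)
    (hg : Integrable g) (h : f =ᵐ[volume] g) (n : ℕ) :
    (circleTransfer E)^[n] f =ᵐ[volume] (circleTransfer E)^[n] g := by
  induction n with
  | zero => exact h
  | succ n ih =>
    simp only [Function.iterate_succ_apply']
    exact circleTransfer_congr (integrable_circleTransfer_iterate hf n)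
      (integrable_circleTransfer_iterate hg n) ih

/-- Exponential decay in `L^1` of the functions of zero average in `W^{1,1}`. -/
lemma exists_integral_abs_iterate_le (E : ExpandingLift) : ∃ C r : ℝ, 0 ≤ C ∧ 0 < r ∧ r < 1 ∧
    ∀ f g : UnitAddCircle → ℝ, Integrable f → IsWeakDeriv 1 f g → ∫ x, f x = 0 →
      ∀ n, ∫ x, |(circleTransfer E)^[n] f x| ≤ C * r ^ n * ∫ x, |g x| := by
  obtain ⟨C, r, hC, hr0, hr1, hdec⟩ := exists_iterate_noisyOp_decay (k := 1) E le_rfl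
    (by exact_mod_cast E.contDiff_F)
  have hs0 : 0 < Real.sqrt r := Real.sqrt_pos.2 hr0
  have hs1 : Real.sqrt r < 1 := by rw [Real.sqrt_lt' one_pos]; simpa using hr1
  refine ⟨1 + C, Real.sqrt r, by positivity, hs0, hs1, ?_⟩
  intro f g hf h hf0 n
  set q := Real.sqrt r with hq
  have hqq : r = q * q := (Real.mul_self_sqrt hr0.le).symm
  obtain ⟨a, ha⟩ := h.exists_ae_eq hf
  have hP := (IsPerC.const a).add (isPerC_circlePrimitive h.1 h.integral_eq_zero)
  set F : ℝ → ℝ := fun x => a + circlePrimitive g x with hF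
  have hF0 : ∫ t in (0:ℝ)..1, F t = 0 := by
    rw [← integral_onCircle hP.periodic, ← hf0]
    exact integral_congr_ae ha.symm
  obtain ⟨p, hpC, hp0, hpb, hpF⟩ := exists_smooth_approx (periodic_comp_coe g)
    (integrable_lift h.1) hF hP hF0 (η := q ^ n) (by positivity) (pow_le_one₀ hs0.le hs1.le)
  rw [← integral_circle fun x => |g x|] at hpb hpF
  set A := ∫ x, |g x| with hA
  have hA0 : 0 ≤ A := integral_nonneg fun _ => abs_nonneg _
  have hd := hdec (Measure.dirac 0) 0 p _ hpC hp0 hpb n 0 (Nat.zero_le _)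
  have hop : noisyOp E (Measure.dirac 0) 0 = E.transferOp := funext fun u => noisyOp_zero E _ u
  rw [hop] at hd
  have hpi := hpC.integrable_onCircle
  have hFi := hP.integrable_onCircle
  have e1 : ∫ x, |(circleTransfer E)^[n] f x| =
      ∫ x, |(circleTransfer E)^[n] (onCircle F) x| :=
    integral_congr_ae ((circleTransfer_iterate_congr (E := E) hf hFi ha n).mono fun x hx => by
      simp only [hx])
  have hdi : Integrable fun x => onCircle F x - onCircle p x := hFi.sub hpi
  have e2 : ∀ x, |(circleTransfer E)^[n] (onCircle F) x| ≤
      |(circleTransfer E)^[n] (fun x => onCircle F x - onCircle p x) x| +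
        |(circleTransfer E)^[n] (onCircle p) x| := by
    intro x
    rw [circleTransfer_iterate_sub]
    have := abs_add_le ((circleTransfer E)^[n] (onCircle F) x - (circleTransfer E)^[n] (onCircle p) x)
      ((circleTransfer E)^[n] (onCircle p) x)
    rwa [sub_add_cancel] at this
  have hn0 : q ^ n ≠ 0 := by positivity
  have e3 : ∫ x, |(circleTransfer E)^[n] (onCircle p) x| ≤ C * q ^ n * A := by
    have hb : ∀ x, |(circleTransfer E)^[n] (onCircle p) x| ≤ C * q ^ n * A := by
      intro x
      rw [(circleTransfer_iterate_onCircle hpC.periodic n).1]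
      have := hd (AddCircle.equivIco 1 0 x)
      rw [iteratedDeriv_zero] at this
      refine this.trans (le_of_eq ?_)
      rw [hqq, mul_pow]; field_simp
    have := integral_mono (integrable_circleTransfer_iterate hpi n).abs
      (integrable_const (C * q ^ n * A)) hb
    simpa [measureReal_def, UnitAddCircle.measure_univ] using this
  have e4 : ∫ x, |(circleTransfer E)^[n] (fun x => onCircle F x - onCircle p x) x| ≤ q ^ n * A := by
    refine (integral_abs_circleTransfer_iterate_le hdi n).trans ?_
    rw [integral_circle]
    simp only [onCircle_coe hP.periodic, onCircle_coe hpC.periodic]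
    exact hpF
  rw [e1]
  have i1 := (integrable_circleTransfer_iterate (E := E) hdi n).abs
  have i2 := (integrable_circleTransfer_iterate (E := E) hpi n).abs
  have e5 := integral_mono (integrable_circleTransfer_iterate hFi n).abs (i1.add i2) e2
  have e6 := integral_add i1 i2
  have e7 : ∫ x, |(circleTransfer E)^[n] (onCircle F) x| ≤
    (∫ x, |(circleTransfer E)^[n] (fun x => onCircle F x - onCircle p x) x|) +
      ∫ x, |(circleTransfer E)^[n] (onCircle p) x| := by
    rw [← e6]; exact e5
  linarith

/-- Exponential decay in `W^{1,1}` of the functions of zero average. -/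
theorem exists_sobolev_decay (hT : E.Lifts T) : ∃ C r : ℝ, 0 ≤ C ∧ 0 < r ∧ r < 1 ∧
    ∀ f g : UnitAddCircle → ℝ, Integrable f → IsWeakDeriv 1 f g → ∫ x, f x = 0 →
      ∃ G : ℕ → UnitAddCircle → ℝ, ∀ n, IsWeakDeriv 1 ((circleTransfer E)^[n] f) (G n) ∧
        ∫ x, |(circleTransfer E)^[n] f x| ≤ C * r ^ n * (∫ x, |g x|) ∧
        ∫ x, |G n x| ≤ C * r ^ n * ∫ x, |g x| := by
  obtain ⟨C, q, hC, hq0, hq1, hdec⟩ := exists_integral_abs_iterate_le E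
  obtain ⟨K, hK0, hK⟩ := exists_lasotaYorke hT
  have hα0 := E.α_pos
  have hα1 := E.α_lt_one
  obtain ⟨r, hr1, hr2⟩ := exists_between (max_lt hα1 hq1)
  have hαr : E.α < r := (le_max_left _ _).trans_lt hr1
  have hqr : q < r := (le_max_right _ _).trans_lt hr1
  have hr0 : 0 < r := hα0.trans hαr
  set B := 1 + C + K * C / (r - E.α) with hB
  have hrα : 0 < r - E.α := by linarith
  have hB0 : 0 ≤ K * C / (r - E.α) := by positivity
  refine ⟨B, r, by linarith, hr0, hr2, fun f g hf h hf0 => ?_⟩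
  set A := ∫ x, |g x| with hA
  have hA0 : 0 ≤ A := integral_nonneg fun _ => abs_nonneg _
  have key : ∀ n, ∃ G, IsWeakDeriv 1 ((circleTransfer E)^[n] f) G ∧ ∫ x, |G x| ≤ B * r ^ n * A := by
    intro n
    induction n with
    | zero =>
      refine ⟨g, h, ?_⟩
      rw [pow_zero, mul_one]
      exact le_mul_of_one_le_left hA0 (by linarith)
    | succ n ih =>
      obtain ⟨G, hG, hGb⟩ := ih
      obtain ⟨G', hG', hGb'⟩ := hK _ G (integrable_circleTransfer_iterate hf n) hG
      rw [Function.iterate_succ_apply']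
      refine ⟨G', hG', hGb'.trans ?_⟩
      have h1 := hdec f g hf h hf0 n
      have h2 : q ^ n ≤ r ^ n := pow_le_pow_left₀ hq0.le hqr.le n
      have h3 : ∫ x, |(circleTransfer E)^[n] f x| ≤ C * r ^ n * A :=
        h1.trans (by gcongr)
      have h4 : K * C ≤ B * (r - E.α) := by
        rw [hB, add_mul, div_mul_cancel₀ _ hrα.ne']
        have := mul_nonneg (by linarith : 0 ≤ 1 + C) hrα.le
        linarith
      calc E.α * (∫ x, |G x|) + K * ∫ x, |(circleTransfer E)^[n] f x|
          ≤ E.α * (B * r ^ n * A) + K * (C * r ^ n * A) := by gcongr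
        _ = (E.α * B + K * C) * (r ^ n * A) := by ring
        _ ≤ (B * r) * (r ^ n * A) := by
          refine mul_le_mul_of_nonneg_right (by linarith) (by positivity)
        _ = B * r ^ (n + 1) * A := by ring
  choose G hG hGb using key
  refine ⟨G, fun n => ⟨hG n, (hdec f g hf h hf0 n).trans ?_, hGb n⟩⟩
  have h2 : q ^ n ≤ r ^ n := pow_le_pow_left₀ hq0.le hqr.le n
  have : C ≤ B := by linarith
  gcongr

end

section

/-! ### The Neumann series -/

section series
variable {α : Type*} [MeasurableSpace α] {μ : Measure α}

lemma toL1_finset_sum {F : ℕ → α → ℝ} (hF : ∀ n, Integrable (F n) μ) (N : ℕ) :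
    (integrable_finsetSum (Finset.range N) fun i _ => hF i).toL1 =
      ∑ i ∈ Finset.range N, (hF i).toL1 := by
  induction N with
  | zero => exact Integrable.toL1_zero _
  | succ N ih =>
    rw [Finset.sum_range_succ, ← ih, ← Integrable.toL1_add]
    congr 1
    funext x
    exact Finset.sum_range_succ _ _

/-- Absolutely convergent series of integrable functions. -/
lemma exists_integral_abs_sub_sum_le {F : ℕ → α → ℝ} (hF : ∀ n, Integrable (F n) μ) {B r : ℝ}
    (hr0 : 0 ≤ r) (hr1 : r < 1) (hb : ∀ n, ∫ x, |F n x| ∂μ ≤ B * r ^ n) :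
    ∃ S, Integrable S μ ∧
      ∀ N, ∫ x, |S x - ∑ i ∈ Finset.range N, F i x| ∂μ ≤ B * r ^ N / (1 - r) := by
  have hn : ∀ n, ‖(hF n).toL1 (F n)‖ ≤ B * r ^ n := fun n => by
    rw [L1.norm_of_fun_eq_integral_norm]; exact hb n
  have hs : Summable fun n => (hF n).toL1 (F n) :=
    Summable.of_norm_bounded ((summable_geometric_of_lt_one hr0 hr1).mul_left B) hn
  refine ⟨(∑' n, (hF n).toL1 (F n) : α →₁[μ] ℝ), L1.integrable_coeFn _, fun N => ?_⟩
  have h := norm_sub_le_of_geometric_bound_of_hasSum hr1 hn hs.hasSum N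
  rw [norm_sub_rev, ← toL1_finset_sum hF, L1.norm_eq_integral_norm] at h
  refine le_trans (le_of_eq (integral_congr_ae ?_)) h
  filter_upwards [Lp.coeFn_sub (∑' n, (hF n).toL1 (F n))
    ((integrable_finsetSum (Finset.range N) fun i _ => hF i).toL1),
    (integrable_finsetSum (Finset.range N) fun i _ => hF i).coeFn_toL1] with x h1 h2
  rw [h1, Pi.sub_apply, h2]; simp

end series

lemma tendsto_integral_mul_continuous {f : UnitAddCircle → ℝ} {F : ℕ → UnitAddCircle → ℝ}
    (hf : Integrable f) (hF : ∀ n, Integrable (F n))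
    (h : Tendsto (fun n => ∫ x, |f x - F n x|) atTop (𝓝 0)) {φ : UnitAddCircle → ℝ}
    (hφ : Continuous φ) :
    Tendsto (fun n => ∫ x, F n x * φ x) atTop (𝓝 (∫ x, f x * φ x)) := by
  obtain ⟨M, hM⟩ := isCompact_univ.exists_bound_of_continuousOn (f := φ) hφ.continuousOn
  rw [tendsto_iff_norm_sub_tendsto_zero]
  refine squeeze_zero (fun _ => norm_nonneg _) (fun n => ?_) (by simpa using h.const_mul M)
  rw [← integral_sub (integrable_mul_continuous (hF n) hφ) (integrable_mul_continuous hf hφ),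
    ← integral_const_mul]
  refine norm_integral_le_of_norm_le ((hf.sub (hF n)).abs.const_mul M)
    (Eventually.of_forall fun x => ?_)
  have := hM x trivial
  rw [← sub_mul, norm_mul, mul_comm, norm_sub_rev]
  exact mul_le_mul_of_nonneg_right this (norm_nonneg _)

lemma IsWeakDeriv.of_tendsto {i : ℕ} {f g : UnitAddCircle → ℝ} {F G : ℕ → UnitAddCircle → ℝ}
    (hf : Integrable f) (hg : Integrable g) (hF : ∀ n, Integrable (F n))
    (h : ∀ n, IsWeakDeriv i (F n) (G n))
    (hfF : Tendsto (fun n => ∫ x, |f x - F n x|) atTop (𝓝 0))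
    (hgG : Tendsto (fun n => ∫ x, |g x - G n x|) atTop (𝓝 0)) : IsWeakDeriv i f g := by
  refine ⟨hg, fun φ hφ => ?_⟩
  have h1 := tendsto_integral_mul_continuous hf hF hfF (continuous_iterate_circleDeriv hφ i)
  have h2 := (tendsto_integral_mul_continuous hg (fun n => (h n).1) hgG hφ.continuous).const_mul
    ((-1 : ℝ) ^ i)
  simp only [← (h _).2 φ hφ] at h2
  exact tendsto_nhds_unique h1 h2

lemma integral_eq_of_tendsto {f : UnitAddCircle → ℝ} {F : ℕ → UnitAddCircle → ℝ}
    (hf : Integrable f) (hF : ∀ n, Integrable (F n))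
    (h : Tendsto (fun n => ∫ x, |f x - F n x|) atTop (𝓝 0)) {a : ℝ} (ha : ∀ n, ∫ x, F n x = a) :
    ∫ x, f x = a := by
  have := tendsto_integral_mul_continuous hf hF h (continuous_const (y := (1:ℝ)))
  simp only [mul_one, ha] at this
  exact tendsto_nhds_unique this tendsto_const_nhds

lemma isWeakDeriv_zero (i : ℕ) : IsWeakDeriv i (fun _ => 0) (fun _ => 0) :=
  ⟨integrable_zero _ _ _, fun φ _ => by simp⟩

lemma IsWeakDeriv.finset_sum {i : ℕ} {F G : ℕ → UnitAddCircle → ℝ} (hF : ∀ n, Integrable (F n))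
    (h : ∀ n, IsWeakDeriv i (F n) (G n)) (N : ℕ) :
    IsWeakDeriv i (fun x => ∑ n ∈ Finset.range N, F n x)
      (fun x => ∑ n ∈ Finset.range N, G n x) := by
  induction N with
  | zero => simpa using isWeakDeriv_zero i
  | succ N ih =>
    simp only [Finset.sum_range_succ]
    exact ih.add (integrable_finsetSum _ fun n _ => hF n) (hF N) (h N)

lemma ae_eq_of_integral_abs_sub_nonpos {f g : UnitAddCircle → ℝ} (hf : Integrable f)
    (hg : Integrable g) (h : ∫ x, |f x - g x| ≤ 0) : f =ᵐ[volume] g := by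
  have h1 : ∫ x, |f x - g x| = 0 := le_antisymm h (integral_nonneg fun _ => abs_nonneg _)
  have h2 := (integral_eq_zero_iff_of_nonneg (fun x => abs_nonneg (f x - g x))
    (hf.sub hg).abs).1 h1
  refine h2.mono fun x hx => ?_
  have hx' : |f x - g x| = 0 := hx
  rwa [abs_eq_zero, sub_eq_zero] at hx'

variable {E : ExpandingLift} {T : UnitAddCircle → UnitAddCircle}

/-! ### The transfer operator on densities -/

lemma transfer_toMeasure (hT : E.Lifts T) {f : UnitAddCircle → ℝ} (hf : Integrable f) :
    transfer T (toMeasure f) = toMeasure (circleTransfer E f) := by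
  have hm := hT.continuous.measurable
  ext s hs
  unfold transfer toMeasure
  rw [VectorMeasure.map_apply _ hm hs, withDensityᵥ_apply hf (hm hs),
    withDensityᵥ_apply (integrable_circleTransfer hf) hs, ← integral_indicator (hm hs),
    ← integral_indicator hs]
  have e1 : (T ⁻¹' s).indicator f = fun x => f x * s.indicator 1 (T x) := by
    funext x
    by_cases hx : T x ∈ s <;> simp [Set.indicator, hx]
  have e2 : s.indicator (circleTransfer E f) = fun x => circleTransfer E f x * s.indicator 1 x := by
    funext x
    by_cases hx : x ∈ s <;> simp [Set.indicator, hx]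
  rw [e1, e2, integral_circleTransfer_mul hT]
  rw [← e1]
  exact hf.indicator (hm hs)

lemma transfer_iterate_toMeasure (hT : E.Lifts T) {f : UnitAddCircle → ℝ} (hf : Integrable f)
    (n : ℕ) : (transfer T)^[n] (toMeasure f) = toMeasure ((circleTransfer E)^[n] f) := by
  induction n with
  | zero => rfl
  | succ n ih =>
    rw [Function.iterate_succ_apply', Function.iterate_succ_apply', ih,
      transfer_toMeasure hT (integrable_circleTransfer_iterate hf n)]

lemma toMeasure_sub_transfer_eq_iff (hT : E.Lifts T) {f g : UnitAddCircle → ℝ}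
    (hf : Integrable f) (hg : Integrable g) :
    toMeasure g - transfer T (toMeasure g) = toMeasure f ↔
      (fun x => g x - circleTransfer E g x) =ᵐ[volume] f := by
  have hL := integrable_circleTransfer (E := E) hg
  rw [transfer_toMeasure hT hg]
  unfold toMeasure
  rw [← withDensityᵥ_sub' hg hL]
  exact ⟨fun h => (hg.sub hL).ae_eq_of_withDensityᵥ_eq hf h, fun h => WithDensityᵥEq.congr_ae h⟩

lemma toMeasure_finset_sum {F : ℕ → UnitAddCircle → ℝ} (hF : ∀ n, Integrable (F n)) (N : ℕ) :
    toMeasure (fun x => ∑ n ∈ Finset.range N, F n x) = ∑ n ∈ Finset.range N, toMeasure (F n) := by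
  induction N with
  | zero => exact withDensityᵥ_zero (E := ℝ) (μ := (volume : Measure UnitAddCircle))
  | succ N ih =>
    simp only [Finset.sum_range_succ]
    rw [← ih]
    exact withDensityᵥ_add' (integrable_finsetSum _ fun n _ => hF n) (hF N)

lemma circleTransfer_add (f g : UnitAddCircle → ℝ) :
    circleTransfer E (fun x => f x + g x) =
      fun x => circleTransfer E f x + circleTransfer E g x := by
  have := map_add E.transferOp (fun t : ℝ => f (t : UnitAddCircle))
    (fun t : ℝ => g (t : UnitAddCircle))
  funext x
  exact congrFun this _

lemma circleTransfer_zero : circleTransfer E (fun _ => 0) = fun _ => 0 := by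
  funext x
  exact congrFun (map_zero E.transferOp) _

lemma circleTransfer_neumann_sum (f : UnitAddCircle → ℝ) (N : ℕ) (x : UnitAddCircle) :
    circleTransfer E (fun x => ∑ n ∈ Finset.range N, (circleTransfer E)^[n] f x) x + f x =
      ∑ n ∈ Finset.range (N + 1), (circleTransfer E)^[n] f x := by
  rw [Finset.sum_range_succ']
  refine congrArg (· + f x) ?_
  induction N generalizing x with
  | zero => simp [circleTransfer_zero]
  | succ N ih =>
    simp only [Finset.sum_range_succ, circleTransfer_add, ih, Function.iterate_succ_apply']

/-- The Neumann series of the transfer operator. -/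
lemma exists_neumann (hT : E.Lifts T) : ∃ K r : ℝ, 0 ≤ K ∧ 0 < r ∧ r < 1 ∧
    ∀ f g : UnitAddCircle → ℝ, Integrable f → IsWeakDeriv 1 f g → ∫ x, f x = 0 →
      ∃ S S' : UnitAddCircle → ℝ, Integrable S ∧ IsWeakDeriv 1 S S' ∧ ∫ x, S x = 0 ∧
        (∃ G : ℕ → UnitAddCircle → ℝ, (∀ n, IsWeakDeriv 1 ((circleTransfer E)^[n] f) (G n)) ∧
        ∀ N, ∫ x, |S x - ∑ n ∈ Finset.range N, (circleTransfer E)^[n] f x| ≤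
            K * r ^ N * (∫ x, |g x|) ∧
          ∫ x, |S' x - ∑ n ∈ Finset.range N, G n x| ≤ K * r ^ N * ∫ x, |g x|) ∧
        (fun x => S x - circleTransfer E S x) =ᵐ[volume] f := by
  obtain ⟨C, r, hC, hr0, hr1, h⟩ := exists_sobolev_decay hT
  have hr : 0 < 1 - r := by linarith
  refine ⟨C / (1 - r), r, by positivity, hr0, hr1, fun f g hf hg hf0 => ?_⟩
  obtain ⟨G, hG⟩ := h f g hf hg hf0
  set A := ∫ x, |g x| with hA
  have hA0 : 0 ≤ A := integral_nonneg fun _ => abs_nonneg _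
  have hLi := fun n => integrable_circleTransfer_iterate (E := E) hf n
  obtain ⟨S, hS, hSb⟩ := exists_integral_abs_sub_sum_le hLi hr0.le hr1 (B := C * A)
    fun n => ((hG n).2.1.trans_eq (by ring))
  obtain ⟨S', hS', hSb'⟩ := exists_integral_abs_sub_sum_le (fun n => (hG n).1.1) hr0.le hr1
    (B := C * A) fun n => ((hG n).2.2.trans_eq (by ring))
  have hlim : Tendsto (fun N => C * A * r ^ N / (1 - r)) atTop (𝓝 0) := by
    simpa using ((tendsto_pow_atTop_nhds_zero_of_lt_one hr0.le hr1).const_mul (C * A)).div_const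
      (1 - r)
  have hl := squeeze_zero (fun N => integral_nonneg fun _ => abs_nonneg _) hSb hlim
  have hl' := squeeze_zero (fun N => integral_nonneg fun _ => abs_nonneg _) hSb' hlim
  have hsi := fun N : ℕ => integrable_finsetSum (Finset.range N) fun n _ => hLi n
  refine ⟨S, S', hS, ?_, ?_, ⟨G, fun n => (hG n).1, fun N => ⟨(hSb N).trans_eq (by ring),
    (hSb' N).trans_eq (by ring)⟩⟩, ?_⟩
  · exact IsWeakDeriv.of_tendsto hS hS' hsi (IsWeakDeriv.finset_sum hLi fun n => (hG n).1) hl hl'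
  · refine integral_eq_of_tendsto hS hsi hl fun N => ?_
    rw [integral_finsetSum _ fun n _ => hLi n]
    exact Finset.sum_eq_zero fun n _ => by rw [integral_circleTransfer_iterate hf, hf0]
  · have hLS := integrable_circleTransfer (E := E) hS
    refine ae_eq_of_integral_abs_sub_nonpos (hS.sub hLS) hf ?_
    have hb : ∀ N, ∫ x, |S x - circleTransfer E S x - f x| ≤
        C * A * r ^ (N + 1) / (1 - r) + C * A * r ^ N / (1 - r) := by
      intro N
      have h1 := integral_abs_circleTransfer_le (E := E) (hS.sub (hsi N))
      have h2 : ∀ x, |S x - circleTransfer E S x - f x| ≤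
          |S x - ∑ n ∈ Finset.range (N + 1), (circleTransfer E)^[n] f x| +
          |circleTransfer E (S - fun x => ∑ n ∈ Finset.range N, (circleTransfer E)^[n] f x) x| := by
        intro x
        rw [← circleTransfer_neumann_sum,
          show circleTransfer E (S - fun x => ∑ n ∈ Finset.range N, (circleTransfer E)^[n] f x) x =
            _ from congrFun (circleTransfer_sub S _) x]
        refine le_trans (le_of_eq ?_) (abs_sub _ _)
        congr 1; ring
      have i1 := (hS.sub (hsi (N + 1))).abs
      have i2 := (integrable_circleTransfer (E := E) (hS.sub (hsi N))).abs
      have h3 := integral_mono ((hS.sub hLS).sub hf).abs (i1.add i2) h2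
      have h4 := integral_add i1 i2
      exact h3.trans (h4.trans_le (add_le_add (hSb (N + 1)) (h1.trans (hSb N))))
    refine ge_of_tendsto' (x := atTop) ?_ hb
    simpa using ((tendsto_add_atTop_iff_nat 1).2 hlim).add hlim

lemma memV_one_iff {f : UnitAddCircle → ℝ} :
    MemV 1 f ↔ Integrable f ∧ (∃ g, IsWeakDeriv 1 f g) ∧ ∫ x, f x = 0 := by
  unfold MemV; rw [memW_one_iff, and_assoc]

/-- The transfer operator has no nonzero fixed function of zero average in `W^{1,1}`. -/
lemma ae_eq_zero_of_circleTransfer_ae_eq (hT : E.Lifts T) {f : UnitAddCircle → ℝ} (hf : MemV 1 f)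
    (h : circleTransfer E f =ᵐ[volume] f) : f =ᵐ[volume] fun _ => 0 := by
  obtain ⟨hi, ⟨g, hg⟩, hf0⟩ := memV_one_iff.1 hf
  obtain ⟨C, r, hC, hr0, hr1, hd⟩ := exists_sobolev_decay hT
  obtain ⟨G, hG⟩ := hd f g hi hg hf0
  have hn : ∀ n, (circleTransfer E)^[n] f =ᵐ[volume] f := by
    intro n
    induction n with
    | zero => rfl
    | succ n ih =>
      rw [Function.iterate_succ_apply']
      exact (circleTransfer_congr (integrable_circleTransfer_iterate hi n) hi ih).trans h
  refine ae_eq_of_integral_abs_sub_nonpos hi (integrable_zero _ _ _) ?_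
  simp only [sub_zero]
  have hb : ∀ n, ∫ x, |f x| ≤ C * r ^ n * ∫ x, |g x| := fun n =>
    (integral_congr_ae ((hn n).mono fun x hx => by simp only [hx])).symm.trans_le (hG n).2.1
  refine ge_of_tendsto' (x := atTop) ?_ hb
  simpa using ((tendsto_pow_atTop_nhds_zero_of_lt_one hr0.le hr1).const_mul C).mul_const
    (∫ x, |g x|)

theorem exists_isResolvent (hT : E.Lifts T) : ∃ R, IsResolvent 1 T R := by
  classical
  obtain ⟨K, r, hK, hr0, hr1, hN⟩ := exists_neumann hT
  have key : ∀ f : UnitAddCircle → ℝ, ∃ S : UnitAddCircle → ℝ, MemV 1 f →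
      MemV 1 S ∧ (fun x => S x - circleTransfer E S x) =ᵐ[volume] f ∧
      sobolevNorm 1 S ≤ 2 * K * sobolevNorm 1 f ∧
      Tendsto (fun n => sobolevNorm 1 fun x =>
        (∑ i ∈ Finset.range n, (circleTransfer E)^[i] f x) - S x) atTop (𝓝 0) ∧
      ∀ n, MemV 1 fun x => ∑ i ∈ Finset.range n, (circleTransfer E)^[i] f x := by
    intro f
    by_cases hf : MemV 1 f
    swap
    · exact ⟨0, fun h => absurd h hf⟩
    obtain ⟨hi, ⟨g, hg⟩, hf0⟩ := memV_one_iff.1 hf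
    obtain ⟨S, S', hS, hSS', hS0, ⟨G, hG, hb⟩, hSf⟩ := hN f g hi hg hf0
    have hLi := fun n => integrable_circleTransfer_iterate (E := E) hi n
    have hsi := fun N : ℕ => integrable_finsetSum (Finset.range N) fun n _ => hLi n
    have hs := IsWeakDeriv.finset_sum hLi hG
    refine ⟨S, fun _ => ⟨memV_one_iff.2 ⟨hS, ⟨S', hSS'⟩, hS0⟩, hSf, ?_, ?_, fun n => ?_⟩⟩
    · rw [hSS'.sobolevNorm_one, hg.sobolevNorm_one]
      have h0 := hb 0
      simp only [Finset.range_zero, Finset.sum_empty, sub_zero, pow_zero, mul_one] at h0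
      have : 0 ≤ 2 * K * ∫ x, |f x| :=
        mul_nonneg (by positivity) (integral_nonneg fun _ => abs_nonneg _)
      linarith [h0.1, h0.2]
    · refine squeeze_zero (g := fun n => 2 * K * (∫ x, |g x|) * r ^ n) (fun n => ?_) (fun n => ?_) ?_
      · rw [((hs n).sub (hsi n) hS hSS').sobolevNorm_one]
        exact add_nonneg (integral_nonneg fun _ => abs_nonneg _)
          (integral_nonneg fun _ => abs_nonneg _)
      · rw [((hs n).sub (hsi n) hS hSS').sobolevNorm_one]
        have h1 := hb n
        simp only [abs_sub_comm (S _), abs_sub_comm (S' _)] at h1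
        linarith [h1.1, h1.2]
      · simpa using (tendsto_pow_atTop_nhds_zero_of_lt_one hr0.le hr1).const_mul
          (2 * K * ∫ x, |g x|)
    · refine memV_one_iff.2 ⟨hsi n, ⟨_, hs n⟩, ?_⟩
      rw [integral_finsetSum _ fun n _ => hLi n]
      exact Finset.sum_eq_zero fun n _ => by rw [integral_circleTransfer_iterate hi, hf0]
  choose R hR using key
  refine ⟨R, fun f hf => (hR f hf).1, fun f hf => ?_, fun f g hf hg h => ?_,
    ⟨2 * K, fun f hf => (hR f hf).2.2.1⟩, fun f hf => ⟨_, fun n => ⟨(hR f hf).2.2.2.2 n, ?_⟩,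
      (hR f hf).2.2.2.1⟩⟩
  · exact (toMeasure_sub_transfer_eq_iff hT hf.1.1 (hR f hf).1.1.1).2 (hR f hf).2.1
  · have h1 := (toMeasure_sub_transfer_eq_iff hT hf.1.1 hg.1.1).1 h
    obtain ⟨hRV, h2, -⟩ := hR f hf
    obtain ⟨gi, ⟨g', hg'⟩, g0⟩ := memV_one_iff.1 hg
    obtain ⟨Ri, ⟨R', hR'⟩, R0⟩ := memV_one_iff.1 hRV
    have hd : MemV 1 fun x => g x - R f x :=
      memV_one_iff.2 ⟨gi.sub Ri, ⟨_, hg'.sub gi Ri hR'⟩, by rw [integral_sub gi Ri, g0, R0, sub_zero]⟩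
    have h3 := ae_eq_zero_of_circleTransfer_ae_eq hT hd (by
      rw [circleTransfer_sub]
      filter_upwards [h1, h2] with x hx1 hx2
      linarith)
    exact h3.mono fun x hx => by simpa [sub_eq_zero] using hx
  · rw [toMeasure_finset_sum fun n => integrable_circleTransfer_iterate hf.1.1 n]
    exact Finset.sum_congr rfl fun i _ => (transfer_iterate_toMeasure hT hf.1.1 i).symm

end

section

/-! ### The noise kernel as a measure -/

/-- The law of the noise of amplitude `1`, on the line. -/
def kernelMeasure (ρ : ℝ → ℝ) : Measure ℝ := volume.withDensity fun t => ENNReal.ofReal (ρ t)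

/-- The law on the circle of `δ t`, where `t` has law `ν`. -/
def noiseLaw (ν : Measure ℝ) (δ : ℝ) : Measure UnitAddCircle :=
  ν.map fun t : ℝ => ((δ * t : ℝ) : UnitAddCircle)

lemma measurable_coe_mul (δ : ℝ) : Measurable fun t : ℝ => ((δ * t : ℝ) : UnitAddCircle) :=
  ((AddCircle.continuous_mk' 1).comp (continuous_const.mul continuous_id)).measurable

instance {ν : Measure ℝ} [IsProbabilityMeasure ν] {δ : ℝ} :
    IsProbabilityMeasure (noiseLaw ν δ) :=
  Measure.isProbabilityMeasure_map (measurable_coe_mul δ).aemeasurable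

section kernel
variable {ρ : ℝ → ℝ}

lemma IsNoiseKernel.integrable (hρ : IsNoiseKernel ρ) : Integrable ρ := by
  have h : IntervalIntegrable ρ volume (-1) 1 := by
    by_contra h
    have := hρ.integral_eq_one
    rw [intervalIntegral.integral_undef h] at this
    exact zero_ne_one this
  rw [intervalIntegrable_iff_integrableOn_Icc_of_le (by norm_num)] at h
  refine (integrableOn_iff_integrable_of_support_subset fun x hx => ?_).1 h
  by_contra hx'
  exact hx (hρ.eq_zero x hx')

lemma IsNoiseKernel.integral_mul (hρ : IsNoiseKernel ρ) (g : ℝ → ℝ) :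
    ∫ t, g t * ρ t = ∫ t in (-1:ℝ)..1, g t * ρ t := by
  rw [intervalIntegral.integral_of_le (by norm_num), ← integral_Icc_eq_integral_Ioc,
    setIntegral_eq_integral_of_forall_compl_eq_zero fun x hx => by rw [hρ.eq_zero x hx, mul_zero]]

lemma IsNoiseKernel.integral_kernelMeasure (hρ : IsNoiseKernel ρ) (g : ℝ → ℝ) :
    ∫ t, g t ∂(kernelMeasure ρ) = ∫ t, g t * ρ t := by
  unfold kernelMeasure
  rw [integral_withDensity_eq_integral_toReal_smul₀ hρ.integrable.aemeasurable.ennreal_ofReal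
    (Eventually.of_forall fun _ => ENNReal.ofReal_lt_top)]
  simp only [ENNReal.toReal_ofReal (hρ.nonneg _), smul_eq_mul, mul_comm]

lemma IsNoiseKernel.isProbabilityMeasure (hρ : IsNoiseKernel ρ) :
    IsProbabilityMeasure (kernelMeasure ρ) := by
  refine ⟨?_⟩
  have h := hρ.integral_mul fun _ => 1
  simp only [one_mul, hρ.integral_eq_one] at h
  rw [kernelMeasure, withDensity_apply _ MeasurableSet.univ, Measure.restrict_univ,
    ← ofReal_integral_eq_lintegral_ofReal hρ.integrable (Eventually.of_forall hρ.nonneg), h,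
    ENNReal.ofReal_one]

lemma IsNoiseKernel.isCentered (hρ : IsNoiseKernel ρ) : IsCentered (kernelMeasure ρ) := by
  refine ⟨?_, ?_⟩
  · rw [kernelMeasure, ae_withDensity_iff' hρ.integrable.aemeasurable.ennreal_ofReal]
    refine Eventually.of_forall fun t ht => ?_
    by_contra h
    refine ht ?_
    rw [hρ.eq_zero t fun h' => h (abs_le.2 h'), ENNReal.ofReal_zero]
  · rw [hρ.integral_kernelMeasure, hρ.integral_mul, hρ.integral_mul_eq_zero]

lemma IsNoiseKernel.variance_eq (hρ : IsNoiseKernel ρ) :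
    ∫ t, t ^ 2 ∂(kernelMeasure ρ) = noiseVariance ρ := by
  rw [hρ.integral_kernelMeasure, hρ.integral_mul]; rfl

lemma IsNoiseKernel.noise_eq (hρ : IsNoiseKernel ρ) {δ : ℝ} (hδ : 0 ≤ δ) :
    have := hρ.isProbabilityMeasure
    noise ρ δ = (noiseLaw (kernelMeasure ρ) δ).toSignedMeasure := by
  have := hρ.isProbabilityMeasure
  unfold noise
  split_ifs with h0
  · refine Measure.toSignedMeasure_congr ?_
    rw [noiseLaw, h0]
    simp only [zero_mul, AddCircle.coe_zero, Measure.map_const, measure_univ, one_smul]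
  · have hδ' : 0 < δ := lt_of_le_of_ne hδ (Ne.symm h0)
    have hi : Integrable (scaledKernel ρ δ) := (hρ.integrable.comp_div h0).const_mul _
    have hc : Measurable fun x : ℝ => (x : UnitAddCircle) := (AddCircle.continuous_mk' 1).measurable
    ext s hs
    rw [VectorMeasure.map_apply _ hc hs, withDensityᵥ_apply hi (hc hs),
      Measure.toSignedMeasure_apply_measurable hs, noiseLaw, measureReal_def,
      Measure.map_apply (measurable_coe_mul δ) hs, ← measureReal_def,
      ← integral_indicator_one (measurable_coe_mul δ hs), hρ.integral_kernelMeasure,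
      ← integral_indicator (hc hs)]
    have h1 := Measure.integral_comp_div (fun t : ℝ =>
      ((fun t : ℝ => ((δ * t : ℝ) : UnitAddCircle)) ⁻¹' s).indicator 1 t * ρ t) δ
    rw [abs_of_pos hδ', smul_eq_mul] at h1
    rw [← mul_right_inj' h0, ← h1, ← integral_const_mul]
    refine integral_congr_ae (Eventually.of_forall fun x => ?_)
    have hx : δ * (x / δ) = x := by field_simp
    beta_reduce
    by_cases hxs : (x : UnitAddCircle) ∈ s
    · rw [Set.indicator_of_mem (by exact hxs), Set.indicator_of_mem (by simpa [hx] using hxs),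
        scaledKernel, Pi.one_apply]
      field_simp
    · rw [Set.indicator_of_notMem (by exact hxs), Set.indicator_of_notMem (by simpa [hx] using hxs)]
      simp

end kernel

/-! ### The noisy transfer operator in weak form -/

/-- The average of `φ` over the noise added to `x`. -/
def noiseAvg (ν : Measure ℝ) (δ : ℝ) (φ : UnitAddCircle → ℝ) (x : UnitAddCircle) : ℝ :=
  ∫ t, φ (x + ((δ * t : ℝ) : UnitAddCircle)) ∂ν

/-- The Koopman operator of the system with noise. -/
def koopman (T : UnitAddCircle → UnitAddCircle) (ν : Measure ℝ) (δ : ℝ)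
    (φ : UnitAddCircle → ℝ) : UnitAddCircle → ℝ := fun x => noiseAvg ν δ φ (T x)

lemma exists_abs_le_of_continuous {φ : UnitAddCircle → ℝ} (hφ : Continuous φ) :
    ∃ M, ∀ x, |φ x| ≤ M := by
  obtain ⟨M, hM⟩ := isCompact_univ.exists_bound_of_continuousOn (f := φ) hφ.continuousOn
  exact ⟨M, fun x => hM x trivial⟩

lemma continuous_coe_mul (δ : ℝ) : Continuous fun t : ℝ => ((δ * t : ℝ) : UnitAddCircle) :=
  (AddCircle.continuous_mk' 1).comp (continuous_const.mul continuous_id)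

section weak
variable {ν : Measure ℝ} [IsProbabilityMeasure ν] {δ : ℝ} {φ : UnitAddCircle → ℝ}
  {T : UnitAddCircle → UnitAddCircle}

lemma continuous_noiseAvg (hφ : Continuous φ) : Continuous (noiseAvg ν δ φ) := by
  obtain ⟨M, hM⟩ := exists_abs_le_of_continuous hφ
  have hc := continuous_coe_mul δ
  refine continuous_of_dominated (bound := fun _ => M) (fun x => ?_)
    (fun x => Eventually.of_forall fun t => hM _) (integrable_const _)
    (Eventually.of_forall fun t => by fun_prop)
  exact (hφ.comp (continuous_const.add hc)).aestronglyMeasurable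

lemma abs_noiseAvg_le {M : ℝ} (hM : ∀ x, |φ x| ≤ M) (x : UnitAddCircle) :
    |noiseAvg ν δ φ x| ≤ M := by
  have := norm_integral_le_of_norm_le_const (μ := ν) (C := M)
    (f := fun t => φ (x + ((δ * t : ℝ) : UnitAddCircle))) (Eventually.of_forall fun t => hM _)
  simpa [noiseAvg] using this

lemma continuous_koopman (hT : Continuous T) (hφ : Continuous φ) :
    Continuous (koopman T ν δ φ) := (continuous_noiseAvg hφ).comp hT

lemma koopman_iterate (hT : Continuous T) (hφ : Continuous φ) {M : ℝ} (hM : ∀ x, |φ x| ≤ M)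
    (n : ℕ) : Continuous ((koopman T ν δ)^[n] φ) ∧ ∀ x, |(koopman T ν δ)^[n] φ x| ≤ M := by
  induction n with
  | zero => exact ⟨hφ, hM⟩
  | succ n ih =>
    rw [Function.iterate_succ_apply']
    exact ⟨continuous_koopman hT ih.1, fun x => abs_noiseAvg_le ih.2 _⟩

lemma signedConv_toSignedMeasure (l a b : Measure UnitAddCircle) [IsFiniteMeasure l]
    [IsFiniteMeasure a] [IsFiniteMeasure b] :
    signedConv l.toSignedMeasure (a.toSignedMeasure - b.toSignedMeasure) =
      ((l.prod a).map fun p => p.1 + p.2).toSignedMeasure -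
        ((l.prod b).map fun p => p.1 + p.2).toSignedMeasure := by
  have hadd : Measurable fun p : UnitAddCircle × UnitAddCircle => p.1 + p.2 :=
    measurable_fst.add measurable_snd
  unfold signedConv
  rw [VectorMeasure.prod_eq_of_forall_apply_prod
    (ρ := (l.prod a).toSignedMeasure - (l.prod b).toSignedMeasure)]
  · ext s hs
    rw [VectorMeasure.map_apply _ hadd hs]
    simp only [sub_apply, Measure.toSignedMeasure_apply_measurable hs,
      Measure.toSignedMeasure_apply_measurable (hadd hs), measureReal_def,
      Measure.map_apply hadd hs]
  · intro s t hs ht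
    simp only [sub_apply, Measure.toSignedMeasure_apply_measurable hs,
      Measure.toSignedMeasure_apply_measurable ht,
      Measure.toSignedMeasure_apply_measurable (hs.prod ht), measureReal_prod_prod,
      ContinuousLinearMap.mul_apply']
    ring

lemma integral_conv_map (hT : Continuous T) (a : Measure UnitAddCircle) [IsFiniteMeasure a]
    (hφ : Continuous φ) :
    ∫ x, φ x ∂(((noiseLaw ν δ).prod (a.map T)).map fun p => p.1 + p.2) =
      ∫ x, koopman T ν δ φ x ∂a := by
  have hadd : Continuous fun p : UnitAddCircle × UnitAddCircle => p.1 + p.2 := by fun_prop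
  obtain ⟨M, hM⟩ := exists_abs_le_of_continuous hφ
  have hfin : IsFiniteMeasure (a.map T) := inferInstance
  rw [integral_map hadd.measurable.aemeasurable hφ.aestronglyMeasurable, integral_prod_symm]
  · have h1 : ∀ y, ∫ x, φ (x + y) ∂(noiseLaw ν δ) = noiseAvg ν δ φ y := by
      intro y
      have hy : Continuous fun x => φ (x + y) := by fun_prop
      rw [noiseLaw, integral_map (measurable_coe_mul δ).aemeasurable hy.aestronglyMeasurable]
      simp only [noiseAvg, add_comm y]
    simp only [h1]
    rw [integral_map hT.measurable.aemeasurable (continuous_noiseAvg hφ).aestronglyMeasurable]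
    rfl
  · exact Integrable.of_bound (hφ.comp hadd).aestronglyMeasurable M
      (Eventually.of_forall fun p => hM _)

lemma toSignedMeasure_sub_eq_iff (a b c d : Measure UnitAddCircle) [IsFiniteMeasure a]
    [IsFiniteMeasure b] [IsFiniteMeasure c] [IsFiniteMeasure d] :
    a.toSignedMeasure - b.toSignedMeasure = c.toSignedMeasure - d.toSignedMeasure ↔
      ∀ φ : UnitAddCircle → ℝ, Continuous φ →
        (∫ x, φ x ∂a) - ∫ x, φ x ∂b = (∫ x, φ x ∂c) - ∫ x, φ x ∂d := by
  have hi : ∀ (m : Measure UnitAddCircle) [IsFiniteMeasure m] {φ : UnitAddCircle → ℝ},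
      Continuous φ → Integrable φ m := by
    intro m _ φ hφ
    obtain ⟨M, hM⟩ := exists_abs_le_of_continuous hφ
    exact Integrable.of_bound hφ.aestronglyMeasurable M (Eventually.of_forall hM)
  rw [sub_eq_sub_iff_add_eq_add, ← Measure.toSignedMeasure_add, ← Measure.toSignedMeasure_add,
    Measure.toSignedMeasure_eq_toSignedMeasure_iff]
  constructor
  · intro h φ hφ
    rw [sub_eq_sub_iff_add_eq_add, ← integral_add_measure (hi a hφ) (hi d hφ),
      ← integral_add_measure (hi c hφ) (hi b hφ), h]
  · intro h
    refine ext_of_forall_integral_eq_of_IsFiniteMeasure fun φ => ?_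
    rw [integral_add_measure (hi a φ.continuous) (hi d φ.continuous),
      integral_add_measure (hi c φ.continuous) (hi b φ.continuous), ← sub_eq_sub_iff_add_eq_add]
    exact h φ φ.continuous

/-- The image of an integrable density under the noisy transfer operator, tested against
continuous functions. -/
lemma noisyTransfer_toMeasure_eq_iff (hT : Continuous T) {ρ : ℝ → ℝ}
    (hnoise : noise ρ δ = (noiseLaw ν δ).toSignedMeasure) {f g : UnitAddCircle → ℝ}
    (hf : Integrable f) (hg : Integrable g) :
    noisyTransfer T ρ δ (toMeasure f) = toMeasure g ↔ ∀ φ : UnitAddCircle → ℝ, Continuous φ →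
      ∫ x, f x * koopman T ν δ φ x = ∫ x, g x * φ x := by
  have i1 := isFiniteMeasure_withDensity_ofReal hf.2
  have i2 := isFiniteMeasure_withDensity_ofReal hf.neg.2
  have i3 := isFiniteMeasure_withDensity_ofReal hg.2
  have i4 := isFiniteMeasure_withDensity_ofReal hg.neg.2
  unfold noisyTransfer toMeasure
  rw [hnoise, withDensityᵥ_eq_withDensity_pos_part_sub_withDensity_neg_part hf,
    withDensityᵥ_eq_withDensity_pos_part_sub_withDensity_neg_part hg]
  set a := (volume : Measure UnitAddCircle).withDensity fun x => ENNReal.ofReal (f x) with ha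
  set b := (volume : Measure UnitAddCircle).withDensity fun x => ENNReal.ofReal (-f x) with hb
  have htr : transfer T (a.toSignedMeasure - b.toSignedMeasure) =
      (a.map T).toSignedMeasure - (b.map T).toSignedMeasure := by
    have hm := hT.measurable
    ext s hs
    unfold transfer
    rw [VectorMeasure.map_apply _ hm hs]
    simp only [sub_apply, Measure.toSignedMeasure_apply_measurable hs,
      Measure.toSignedMeasure_apply_measurable (hm hs), measureReal_def,
      Measure.map_apply hm hs]
  rw [htr, signedConv_toSignedMeasure, toSignedMeasure_sub_eq_iff]
  refine forall₂_congr fun φ hφ => ?_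
  rw [integral_conv_map hT a hφ, integral_conv_map hT b hφ,
    integral_posPart_sub_negPart hf (continuous_koopman hT hφ),
    integral_posPart_sub_negPart hg hφ]

end weak

end

section

/-! ### Duality and uniqueness -/

section duality
variable {E : ExpandingLift} {T : UnitAddCircle → UnitAddCircle} {ν : Measure ℝ}
  [IsProbabilityMeasure ν] {δ : ℝ} {φ : UnitAddCircle → ℝ} {H : ℝ → ℝ}

lemma integral_swap_of_continuous {Ψ : UnitAddCircle → ℝ → ℝ} (hΨ : Continuous (Function.uncurry Ψ))
    {M : ℝ} (hM : ∀ x t, |Ψ x t| ≤ M) : ∫ x, (∫ t, Ψ x t ∂ν) = ∫ t, (∫ x, Ψ x t) ∂ν :=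
  integral_integral_swap (Integrable.of_bound hΨ.aestronglyMeasurable M
    (Eventually.of_forall fun _ => hM _ _))

lemma onCircle_noiseOp {f : ℝ → ℝ} (hf : IsPerC 0 f) (x : UnitAddCircle) :
    onCircle (noiseOp ν δ f) x = ∫ t, onCircle f (x - ((δ * t : ℝ) : UnitAddCircle)) ∂ν := by
  obtain ⟨y, rfl⟩ := QuotientAddGroup.mk_surjective x
  rw [onCircle_coe (noiseOp_isPerC_zero hf).periodic, noiseOp]
  refine integral_congr_ae (Eventually.of_forall fun t => ?_)
  exact (onCircle_coe hf.periodic (y - δ * t)).symm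

lemma integral_onCircle_noiseOp_mul {f : ℝ → ℝ} (hf : IsPerC 0 f) (hφ : Continuous φ) :
    ∫ x, onCircle (noiseOp ν δ f) x * φ x = ∫ x, onCircle f x * noiseAvg ν δ φ x := by
  have hfc := continuous_onCircle hf.continuous hf.periodic
  have hc := continuous_coe_mul δ
  obtain ⟨M, hM⟩ := exists_abs_le_of_continuous hφ
  obtain ⟨K, hK⟩ := exists_abs_le_of_continuous hfc
  have hb : ∀ x y, |onCircle f x * φ y| ≤ K * M := fun x y => by
    rw [abs_mul]
    exact mul_le_mul (hK x) (hM y) (abs_nonneg _) ((abs_nonneg _).trans (hK x))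
  simp only [onCircle_noiseOp hf, noiseAvg, ← integral_mul_const, ← integral_const_mul]
  rw [integral_swap_of_continuous (M := K * M) (by unfold Function.uncurry; fun_prop)
      (fun x t => hb _ _),
    integral_swap_of_continuous (M := K * M) (by unfold Function.uncurry; fun_prop)
      (fun x t => hb _ _)]
  refine integral_congr_ae (Eventually.of_forall fun t => ?_)
  have := integral_sub_right_eq_self (μ := (volume : Measure UnitAddCircle))
    (fun x => onCircle f x * φ (x + ((δ * t : ℝ) : UnitAddCircle))) ((δ * t : ℝ) : UnitAddCircle)
  simpa only [sub_add_cancel] using this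

lemma integral_onCircle_noisyOp_mul (hT : E.Lifts T) (hH : IsPerC 0 H) (hφ : Continuous φ) :
    ∫ x, onCircle (noisyOp E ν δ H) x * φ x = ∫ x, onCircle H x * koopman T ν δ φ x := by
  unfold noisyOp
  rw [integral_onCircle_noiseOp_mul hH.transferOp_zero hφ, ← circleTransfer_onCircle hH.periodic,
    integral_circleTransfer_mul hT]
  · rfl
  · exact integrable_mul_continuous hH.integrable_onCircle (continuous_koopman hT.continuous hφ)

lemma integral_onCircle_noisyOp_iterate_mul (hT : E.Lifts T) (hH : IsPerC 0 H)
    (hφ : Continuous φ) (n : ℕ) :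
    ∫ x, onCircle ((noisyOp E ν δ)^[n] H) x * φ x =
      ∫ x, onCircle H x * (koopman T ν δ)^[n] φ x := by
  obtain ⟨M, hM⟩ := exists_abs_le_of_continuous hφ
  induction n generalizing H with
  | zero => rfl
  | succ n ih =>
    rw [Function.iterate_succ_apply, Function.iterate_succ_apply', ih hH.noisyOp_zero,
      integral_onCircle_noisyOp_mul hT hH (koopman_iterate hT.continuous hφ hM n).1]

/-- Density in `L¹` of the test functions of zero average. -/
lemma exists_isTestFunction_integral_abs_sub_le {r : UnitAddCircle → ℝ} (hr : Integrable r)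
    (hr0 : ∫ x, r x = 0) {ε : ℝ} (hε : 0 < ε) :
    ∃ p, IsTestFunction p ∧ ∫ x, p x = 0 ∧ ∫ x, |r x - p x| ≤ ε := by
  obtain ⟨g, hg, -⟩ := hr.exists_boundedContinuous_integral_sub_le (show 0 < ε / 4 by positivity)
  obtain ⟨q, hq, hgq⟩ := exists_isTestFunction_near g.continuous (show 0 < ε / 4 by positivity)
  have hgi := Continuous.integrable_circle g.continuous
  have hqi := Continuous.integrable_circle hq.continuous
  have hrg : Integrable fun x => r x - g x := hr.sub hgi
  have hrq : Integrable fun x => r x - q x := hr.sub hqi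
  have h1 : ∫ x, |r x - q x| ≤ ε / 2 := by
    have h2 : ∫ x, |r x - q x| ≤ ∫ x, (|r x - g x| + ε / 4) :=
      integral_mono hrq.abs (hrg.abs.add (integrable_const _)) fun x => by
        have := abs_add_le (r x - g x) (g x - q x)
        rw [sub_add_sub_cancel] at this
        exact this.trans (add_le_add_right (hgq x) _)
    have h3 : ∫ x, (|r x - g x| + ε / 4) = (∫ x, |r x - g x|) + ε / 4 := by
      rw [integral_add hrg.abs (integrable_const _)]
      simp [measureReal_def]
    have h4 : ∫ x, |r x - g x| ≤ ε / 4 := hg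
    linarith
  set m := ∫ x, q x with hm
  have hmb : |m| ≤ ε / 2 := by
    have h2 : m = -∫ x, (r x - q x) := by rw [integral_sub hr hqi, hr0, ← hm]; ring
    rw [h2, abs_neg]
    exact (abs_integral_le_integral_abs).trans h1
  refine ⟨fun x => q x - m, ContDiff.sub hq contDiff_const, ?_, ?_⟩
  · rw [integral_sub hqi (integrable_const _)]
    simp [measureReal_def, hm]
  · have h2 : ∫ x, |r x - (q x - m)| ≤ ∫ x, (|r x - q x| + |m|) :=
      integral_mono (hr.sub (hqi.sub (integrable_const _))).abs
        (hrq.abs.add (integrable_const _)) fun x => by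
        have := abs_add_le (r x - q x) m
        rwa [sub_add] at this
    have h3 : ∫ x, (|r x - q x| + |m|) = (∫ x, |r x - q x|) + |m| := by
      rw [integral_add hrq.abs (integrable_const _)]
      simp [measureReal_def]
    linarith

/-- The noisy transfer operator has no nonzero fixed function of zero average in `L¹`. -/
lemma ae_eq_zero_of_koopman_invariant (hT : E.Lifts T) (hF : ContDiff ℝ (1 + 1 : ℕ) E.F)
    {r : UnitAddCircle → ℝ} (hr : Integrable r) (hr0 : ∫ x, r x = 0)
    (h : ∀ φ : UnitAddCircle → ℝ, Continuous φ →
      ∫ x, r x * koopman T ν δ φ x = ∫ x, r x * φ x) : r =ᵐ[volume] 0 := by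
  obtain ⟨C, q, hC, hq0, hq1, hdec⟩ := exists_iterate_noisyOp_decay E le_rfl hF
  refine ae_eq_zero_of_forall_continuous hr fun φ hφ => ?_
  obtain ⟨M, hM⟩ := exists_abs_le_of_continuous hφ
  have hM0 : 0 ≤ M := (abs_nonneg _).trans (hM 0)
  have hU := koopman_iterate (ν := ν) (δ := δ) hT.continuous hφ hM
  have hiter : ∀ n, ∫ x, r x * (koopman T ν δ)^[n] φ x = ∫ x, r x * φ x := by
    intro n
    induction n with
    | zero => rfl
    | succ n ih => rw [Function.iterate_succ_apply', h _ (hU n).1, ih]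
  have key : ∀ ε > 0, |∫ x, r x * φ x| ≤ ε * M := by
    intro ε hε
    obtain ⟨p, hp, hp0, hrp⟩ := exists_isTestFunction_integral_abs_sub_le hr hr0 hε
    have hpi := Continuous.integrable_circle hp.continuous
    have hrp' : Integrable fun x => r x - p x := hr.sub hpi
    have hP := hp.isPerC 1
    obtain ⟨B, hB⟩ := hP.exists_abs_iteratedDeriv_le
    have hd := hdec ν δ _ B hP (by rw [← integral_circle]; exact hp0) hB
    have hb : ∀ n, |∫ x, r x * φ x| ≤ ε * M + C * q ^ n * B * M := by
      intro n
      have e1 : ∫ x, r x * φ x = (∫ x, (r x - p x) * (koopman T ν δ)^[n] φ x) +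
          ∫ x, onCircle ((noisyOp E ν δ)^[n] fun t : ℝ => p t) x * φ x := by
        rw [integral_onCircle_noisyOp_iterate_mul hT (hP.of_le zero_le_one) hφ,
          onCircle_comp_coe, ← integral_add (integrable_mul_continuous hrp' (hU n).1)
            (integrable_mul_continuous hpi (hU n).1), ← hiter n]
        refine integral_congr_ae (Eventually.of_forall fun x => ?_)
        ring
      have e2 : |∫ x, (r x - p x) * (koopman T ν δ)^[n] φ x| ≤ ε * M := by
        refine (abs_integral_le_integral_abs).trans ((integral_mono
          (integrable_mul_continuous hrp' (hU n).1).abs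
          (hrp'.abs.mul_const M) fun x => ?_).trans ?_)
        · rw [abs_mul]
          exact mul_le_mul_of_nonneg_left ((hU n).2 x) (abs_nonneg _)
        · rw [integral_mul_const]
          exact mul_le_mul_of_nonneg_right hrp hM0
      have e3 : |∫ x, onCircle ((noisyOp E ν δ)^[n] fun t : ℝ => p t) x * φ x| ≤
          C * q ^ n * B * M := by
        have := norm_integral_le_of_norm_le_const (μ := (volume : Measure UnitAddCircle))
          (C := C * q ^ n * B * M)
          (f := fun x => onCircle ((noisyOp E ν δ)^[n] fun t : ℝ => p t) x * φ x)
          (Eventually.of_forall fun x => by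
            rw [norm_mul]
            have h1 := hd n 0 zero_le_one (AddCircle.equivIco 1 0 x)
            rw [iteratedDeriv_zero] at h1
            exact mul_le_mul h1 (hM x) (abs_nonneg _) ((abs_nonneg _).trans h1))
        simpa [measureReal_def, UnitAddCircle.measure_univ] using this
      rw [e1]
      exact (abs_add_le _ _).trans (add_le_add e2 e3)
    refine ge_of_tendsto' (x := atTop) ?_ hb
    simpa using (((((tendsto_pow_atTop_nhds_zero_of_lt_one hq0.le hq1).const_mul C).mul_const
      B).mul_const M).const_add (ε * M))
  have h0 : |∫ x, r x * φ x| ≤ 0 := by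
    refine ge_of_tendsto (f := fun ε : ℝ => ε * M) (x := 𝓝[>] 0) ?_
      (eventually_mem_nhdsWithin.mono fun ε hε => key ε hε)
    have h1 : Continuous fun ε : ℝ => ε * M := by fun_prop
    simpa using (h1.tendsto 0).mono_left (nhdsWithin_le_nhds (s := Set.Ioi 0))
  exact abs_nonpos_iff.1 h0

/-- A smooth fixed density of the noisy transfer operator is the stationary density. -/
theorem isStationaryDensity_onCircle (hT : E.Lifts T) (hF : ContDiff ℝ (1 + 1 : ℕ) E.F)
    {ρ : ℝ → ℝ} (hnoise : noise ρ δ = (noiseLaw ν δ).toSignedMeasure) {k : ℕ} (hH : IsPerC k H)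
    (hfix : noisyOp E ν δ H = H) (hint : ∫ x in (0:ℝ)..1, H x = 1) (hpos : ∀ x, 0 ≤ H x) :
    IsStationaryDensity k T ρ δ (onCircle H) := by
  have hH0 := hH.of_le (Nat.zero_le _)
  have hi := hH.integrable_onCircle
  have hdual : ∀ φ : UnitAddCircle → ℝ, Continuous φ →
      ∫ x, onCircle H x * koopman T ν δ φ x = ∫ x, onCircle H x * φ x := fun φ hφ => by
    rw [← integral_onCircle_noisyOp_mul hT hH0 hφ, hfix]
  have h1 : ∫ x, onCircle H x = 1 := by rw [integral_onCircle hH.periodic, hint]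
  refine ⟨hH.memW, Eventually.of_forall fun x => hpos _, h1,
    (noisyTransfer_toMeasure_eq_iff hT.continuous hnoise hi hi).2 hdual, fun f hf hf1 hff => ?_⟩
  have hfd := (noisyTransfer_toMeasure_eq_iff hT.continuous hnoise hf hf).1 hff
  have h0 := ae_eq_zero_of_koopman_invariant (ν := ν) (δ := δ) hT hF (hf.sub hi)
    (by simp only [Pi.sub_apply]; rw [integral_sub hf hi, hf1, h1, sub_self]) fun φ hφ => by
      have hk := continuous_koopman (ν := ν) (δ := δ) hT.continuous hφ
      simp only [Pi.sub_apply, sub_mul]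
      rw [integral_sub (integrable_mul_continuous hf hk) (integrable_mul_continuous hi hk),
        integral_sub (integrable_mul_continuous hf hφ) (integrable_mul_continuous hi hφ),
        hfd φ hφ, hdual φ hφ]
  exact h0.mono fun x hx => sub_eq_zero.1 hx

end duality

end

section

/-! ### Construction of the lift -/

lemma exists_sign_of_le_abs {f : ℝ → ℝ} (hf : Continuous f) {c : ℝ} (hc : 0 < c)
    (h : ∀ x, c ≤ |f x|) : ∃ s : ℝ, (s = 1 ∨ s = -1) ∧ ∀ x, c ≤ s * f x := by
  have h0 : ∀ x, f x ≠ 0 := fun x hx => by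
    have := h x
    rw [hx, abs_zero] at this
    linarith
  by_cases hpos : ∀ x, 0 ≤ f x
  · exact ⟨1, Or.inl rfl, fun x => by rw [one_mul, ← abs_of_nonneg (hpos x)]; exact h x⟩
  · push Not at hpos
    obtain ⟨y, hy⟩ := hpos
    have hneg : ∀ x, f x ≤ 0 := by
      by_contra hcon
      push Not at hcon
      obtain ⟨z, hz⟩ := hcon
      obtain ⟨w, hw⟩ := mem_range_of_exists_le_of_exists_ge hf ⟨y, hy.le⟩ ⟨z, hz.le⟩
      exact h0 w hw
    exact ⟨-1, Or.inr rfl, fun x => by rw [neg_one_mul, ← abs_of_nonpos (hneg x)]; exact h x⟩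

lemma surjective_of_one_le_deriv {P : ℝ → ℝ} (hP : Differentiable ℝ P) (h : ∀ x, 1 ≤ deriv P x) :
    Function.Surjective P := by
  have hm : Monotone fun x => P x - x := by
    refine monotone_of_deriv_nonneg (hP.sub differentiable_id) fun x => ?_
    have : HasDerivAt (fun x => P x - x) (deriv P x - 1) x :=
      (hP x).hasDerivAt.sub (hasDerivAt_id x)
    rw [this.deriv]
    linarith [h x]
  refine hP.continuous.surjective ?_ ?_
  · refine tendsto_atTop_mono' atTop (f₁ := fun x => P 0 + x) ?_
      (tendsto_atTop_add_const_left _ _ tendsto_id)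
    filter_upwards [eventually_ge_atTop 0] with x hx
    have := hm hx
    simp only [sub_zero] at this
    linarith
  · refine tendsto_atBot_mono' atBot (f₁ := fun x => P 0 + x) ?_
      (tendsto_atBot_add_const_left _ _ tendsto_id)
    filter_upwards [eventually_le_atBot 0] with x hx
    have := hm hx
    simp only [sub_zero] at this
    linarith

lemma exists_forall_eq_intCast {f : ℝ → ℝ} (hf : Continuous f) (h : ∀ x, ∃ m : ℤ, f x = m) :
    ∃ m : ℤ, ∀ x, f x = m := by
  choose m hm using h
  have hc : Continuous m := by
    rw [Int.isClosedEmbedding_coe_real.isEmbedding.continuous_iff]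
    exact hf.congr hm
  exact ⟨m 0, fun x => by rw [hm x, PreconnectedSpace.constant inferInstance hc (y := 0)]⟩

/-- An expanding map of the circle has an expanding lift. -/
theorem IsExpanding.exists_expandingLift {n : ℕ} (hn : 2 ≤ n) {T : UnitAddCircle → UnitAddCircle}
    (hT : IsExpanding n T) : ∃ E : ExpandingLift, E.Lifts T ∧ ContDiff ℝ n E.F := by
  obtain ⟨F, hF, hFT, c, hc, hcF⟩ := hT
  have hF' : ContDiff ℝ n F := hF
  have hF2 : ContDiff ℝ 2 F := hF'.of_le (by exact_mod_cast hn)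
  have hd : Differentiable ℝ F := hF2.differentiable (by norm_num)
  obtain ⟨s, hs, hsF⟩ := exists_sign_of_le_abs (hF2.continuous_deriv (by norm_num))
    (by linarith) hcF
  have hss : s * s = 1 := by rcases hs with h | h <;> rw [h] <;> norm_num
  have hPd : ∀ x, HasDerivAt (fun x => s * F x) (s * deriv F x) x := fun x =>
    (hd x).hasDerivAt.const_mul s
  have hPdiff : Differentiable ℝ fun x => s * F x := fun x => (hPd x).differentiableAt
  have hpos : ∀ x, 0 < deriv (fun x => s * F x) x := fun x => by
    rw [(hPd x).deriv]; linarith [hsF x]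
  have hmono : StrictMono fun x => s * F x := strictMono_of_deriv_pos hpos
  have hsurj : Function.Surjective fun x => s * F x :=
    surjective_of_one_le_deriv hPdiff fun x => by rw [(hPd x).deriv]; linarith [hsF x]
  set e : ℝ ≃ₜ ℝ := (hmono.orderIsoOfSurjective _ hsurj).toHomeomorph with he
  have heF : ∀ x, e x = s * F x := fun x => rfl
  have hesymm : ContDiff ℝ 2 e.symm :=
    e.contDiff_symm_deriv (f' := fun x => s * deriv F x)
      (fun x => by linarith [hsF x]) hPd (contDiff_const.mul hF2)
  obtain ⟨m, hm⟩ := exists_forall_eq_intCast (f := fun x => s * (F (x + 1) - F x))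
    (by have := hd.continuous; fun_prop) fun x => by
      have h1 : ((F (x + 1) : ℝ) : UnitAddCircle) = (F x : UnitAddCircle) := by
        rw [← hFT, ← hFT, AddCircle.coe_add_period]
      rw [← sub_eq_zero, ← AddCircle.coe_sub] at h1
      obtain ⟨k, hk⟩ := AddCircle.coe_eq_zero_iff _ |>.1 h1
      rw [zsmul_one] at hk
      rcases hs with h | h
      · exact ⟨k, by rw [h, hk, one_mul]⟩
      · exact ⟨-k, by rw [h, ← hk]; push_cast; ring⟩
  have hm0 : 0 ≤ m := by
    have h1 := hmono (lt_add_one 0)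
    have h2 := hm 0
    simp only at h1
    have : (0 : ℝ) ≤ m := by rw [← h2]; linarith
    exact_mod_cast this
  lift m to ℕ using hm0
  refine ⟨⟨F, fun x => e.symm (s * x), s, c⁻¹, m, hs, by positivity, inv_lt_one_of_one_lt₀ hc,
    fun x => ?_, fun x => ?_, hF2, hesymm.comp (contDiff_const.mul contDiff_id), fun x => ?_,
    fun x => ?_⟩, hFT, hF'⟩
  · rw [← heF, e.symm_apply_apply]
  · have h1 := heF (e.symm (s * x))
    rw [e.apply_symm_apply] at h1
    have h2 := congrArg (s * ·) h1
    simp only [← mul_assoc, hss, one_mul] at h2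
    exact h2.symm
  · rw [inv_mul_eq_div, le_div_iff₀ (by linarith), one_mul]
    exact hsF x
  · have h1 := congrArg (s * ·) (hm x)
    simp only [← mul_assoc, hss, one_mul, Int.cast_natCast] at h1
    linarith

end

section

/-! ### Sobolev norms of differences -/

section sobolevNorm
variable {f g : UnitAddCircle → ℝ}

lemma sobolevNorm_one_nonneg (f : UnitAddCircle → ℝ) : 0 ≤ sobolevNorm 1 f :=
  add_nonneg (integral_nonneg fun _ => abs_nonneg _)
    (Finset.sum_nonneg fun _ _ => integral_nonneg fun _ => abs_nonneg _)

lemma sobolevNorm_one_congr (hf : MemW 1 f) (h : f =ᵐ[volume] g) :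
    sobolevNorm 1 f = sobolevNorm 1 g := by
  obtain ⟨-, f', hf'⟩ := memW_one_iff.1 hf
  rw [hf'.sobolevNorm_one, (hf'.congr h (ae_eq_refl _)).sobolevNorm_one]
  congr 1
  exact integral_congr_ae (h.mono fun x hx => by simp only [hx])

lemma sobolevNorm_one_const_mul (hf : MemW 1 f) (a : ℝ) :
    sobolevNorm 1 (fun x => a * f x) = |a| * sobolevNorm 1 f := by
  obtain ⟨-, f', hf'⟩ := memW_one_iff.1 hf
  rw [hf'.sobolevNorm_one, (hf'.const_mul a).sobolevNorm_one]
  simp only [abs_mul, integral_const_mul, mul_add]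

lemma sobolevNorm_one_onCircle_le {f : ℝ → ℝ} (hf : IsPerC 1 f) {M : ℝ}
    (hM : ∀ i ≤ 1, ∀ x, |iteratedDeriv i f x| ≤ M) : sobolevNorm 1 (onCircle f) ≤ 2 * M := by
  have h : ∀ i ≤ 1, ∫ x, |onCircle (iteratedDeriv i f) x| ≤ M := fun i hi => by
    have hfi := (hf.isWeakDeriv hi).1
    have := integral_mono hfi.abs (integrable_const M) fun x => hM i hi _
    simpa [measureReal_def] using this
  have h0 := h 0 zero_le_one
  rw [iteratedDeriv_zero] at h0
  rw [(hf.isWeakDeriv le_rfl).sobolevNorm_one]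
  linarith [h 1 le_rfl]

lemma MemV.const_mul_sub (hf : MemV 1 f) (hg : MemV 1 g) (a b : ℝ) :
    MemV 1 fun x => a * f x - b * g x := by
  obtain ⟨hfi, ⟨f', hf'⟩, hf0⟩ := memV_one_iff.1 hf
  obtain ⟨hgi, ⟨g', hg'⟩, hg0⟩ := memV_one_iff.1 hg
  refine memV_one_iff.2 ⟨(hfi.const_mul a).sub (hgi.const_mul b), ⟨_, IsWeakDeriv.sub
    (hfi.const_mul a) (hgi.const_mul b) (hf'.const_mul a) (hg'.const_mul b)⟩, ?_⟩
  rw [integral_sub (hfi.const_mul a) (hgi.const_mul b), integral_const_mul, integral_const_mul,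
    hf0, hg0]
  simp

lemma IsPerC.memV_onCircle {f : ℝ → ℝ} (hf : IsPerC 1 f) (h0 : ∫ x in (0:ℝ)..1, f x = 0) :
    MemV 1 (onCircle f) := ⟨hf.memW, by rw [integral_onCircle hf.periodic, h0]⟩

lemma MemV.congr (hf : MemV 1 f) (h : f =ᵐ[volume] g) : MemV 1 g := by
  obtain ⟨hfi, ⟨f', hf'⟩, hf0⟩ := memV_one_iff.1 hf
  exact memV_one_iff.2 ⟨hfi.congr h, ⟨f', hf'.congr h (ae_eq_refl _)⟩,
    (integral_congr_ae h).symm.trans hf0⟩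

end sobolevNorm

lemma circleTransfer_const_mul {E : ExpandingLift} (a : ℝ) (f : UnitAddCircle → ℝ) :
    circleTransfer E (fun x => a * f x) = fun x => a * circleTransfer E f x := by
  have := map_smul E.transferOp a (fun t : ℝ => f (t : UnitAddCircle))
  funext x
  exact congrFun this _

lemma integral_iteratedDeriv_two_eq_zero {f : ℝ → ℝ} (hf : IsPerC 2 f) :
    ∫ x in (0:ℝ)..1, iteratedDeriv 2 f x = 0 := by
  have h1 : IsPerC 1 (iteratedDeriv 1 f) := hf.iteratedDeriv (by norm_num)
  have h2 := (h1.isWeakDeriv le_rfl).integral_eq_zero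
  have e : iteratedDeriv 1 (iteratedDeriv 1 f) = iteratedDeriv 2 f := by
    simp [iteratedDeriv_succ, iteratedDeriv_zero]
  rwa [e, integral_onCircle (hf.iteratedDeriv (m := 0) (i := 2) (by norm_num)).periodic] at h2

/-- A solution of the cohomological equation up to a small error is close to the one given by the
resolvent. -/
lemma sobolevNorm_sub_resolvent_le {E : ExpandingLift} {T : UnitAddCircle → UnitAddCircle}
    (hT : E.Lifts T) {R : (UnitAddCircle → ℝ) → (UnitAddCircle → ℝ)} (hR : IsResolvent 1 T R) :
    ∃ K : ℝ, 0 ≤ K ∧ ∀ (u w z : UnitAddCircle → ℝ) (a b : ℝ), MemV 1 u → MemV 1 w →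
      MemV 1 z → (∀ᵐ x, a * (u x - circleTransfer E u x) - b * w x = z x) →
      sobolevNorm 1 (fun x => a * u x - b * R w x) ≤ K * sobolevNorm 1 z := by
  obtain ⟨B, hB⟩ := hR.bounded
  refine ⟨|B|, abs_nonneg B, fun u w z a b hu hw hz h => ?_⟩
  have hRw := hR.memV w hw
  have hd := hu.const_mul_sub hRw a b
  have h1 := (toMeasure_sub_transfer_eq_iff hT hw.1.1 hRw.1.1).1 (hR.right_inv w hw)
  have h2 : toMeasure (fun x => a * u x - b * R w x) -
      transfer T (toMeasure fun x => a * u x - b * R w x) = toMeasure z := by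
    rw [toMeasure_sub_transfer_eq_iff hT hz.1.1 hd.1.1, circleTransfer_sub,
      circleTransfer_const_mul, circleTransfer_const_mul]
    filter_upwards [h, h1] with x hx hx1
    rw [← hx, ← hx1]; ring
  rw [sobolevNorm_one_congr hd.1 (hR.unique z _ hz hd h2)]
  exact (hB z hz).trans (mul_le_mul_of_nonneg_right (le_abs_self B) (sobolevNorm_one_nonneg z))

end

end ZeroNoise

end

open ZeroNoise in
theorem theorem1 (T : UnitAddCircle → UnitAddCircle) (hT : IsExpanding 8 T)
    (ρ : ℝ → ℝ) (hρ : IsNoiseKernel ρ) :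
    ∃ (h : ℝ → UnitAddCircle → ℝ) (R : (UnitAddCircle → ℝ) → (UnitAddCircle → ℝ)),
      (∀ δ ∈ Set.Icc (0 : ℝ) 1, IsStationaryDensity 7 T ρ δ (h δ)) ∧
      IsResolvent 1 T R ∧
      MemV 1 (weakDeriv 2 (h 0)) ∧
      Tendsto
        (fun δ : ℝ => sobolevNorm 1 (fun x =>
          (h δ x - h 0 x) / δ ^ 2 - noiseVariance ρ / 2 * R (weakDeriv 2 (h 0)) x))
        (𝓝[>] 0) (𝓝 0) ∧
      Tendsto (fun δ : ℝ => sobolevNorm 1 (fun x => (h δ x - h 0 x) / δ)) (𝓝[>] 0) (𝓝 0) ∧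
      ∃ C : ℝ, ∀ᶠ δ in 𝓝[>] (0 : ℝ), sobolevNorm 1 (fun x => h δ x - h 0 x) ≤ C * δ ^ 2 := by
  obtain ⟨E, hE, hF⟩ := hT.exists_expandingLift (by norm_num)
  have hF7 : ContDiff ℝ (7 + 1 : ℕ) E.F := hF
  have hν := hρ.isProbabilityMeasure
  choose H hH hfix hint hpos using exists_fixed_density E (by norm_num : 1 ≤ 7) hF7
    (kernelMeasure ρ)
  obtain ⟨R, hR⟩ := exists_isResolvent hE
  obtain ⟨K, hK0, hK⟩ := sobolevNorm_sub_resolvent_le hE hR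
  obtain ⟨C, hC0, hC⟩ := exists_expansion_bound E hF7 (kernelMeasure ρ) hρ.isCentered hH hfix hint
  simp only [hρ.variance_eq] at hC
  have hw : IsPerC 5 (iteratedDeriv 2 (H 0)) := (hH 0).iteratedDeriv (by norm_num)
  have hw0 := integral_iteratedDeriv_two_eq_zero ((hH 0).of_le (m := 2) (by norm_num))
  have hW : weakDeriv 2 (onCircle (H 0)) =ᵐ[volume] onCircle (iteratedDeriv 2 (H 0)) :=
    ((hH 0).isWeakDeriv (i := 2) (by norm_num)).weakDeriv_ae
  have hWV : MemV 1 (weakDeriv 2 (onCircle (H 0))) :=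
    ((hw.of_le (m := 1) (by norm_num)).memV_onCircle hw0).congr hW.symm
  have hu : ∀ δ, IsPerC 7 fun x => H δ x - H 0 x := fun δ => (hH δ).sub (hH 0)
  have hui : ∀ δ, ∫ x in (0:ℝ)..1, (H δ x - H 0 x) = 0 := fun δ => by
    rw [intervalIntegral.integral_sub ((hH δ).intervalIntegrable _ _)
      ((hH 0).intervalIntegrable _ _), hint, hint, sub_self]
  have huV : ∀ δ, MemV 1 (onCircle fun x => H δ x - H 0 x) := fun δ =>
    ((hu δ).of_le (by norm_num)).memV_onCircle (hui δ)
  have hun : ∀ δ, sobolevNorm 1 (onCircle fun x => H δ x - H 0 x) ≤ 2 * C * δ ^ 2 := fun δ => by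
    refine (sobolevNorm_one_onCircle_le ((hu δ).of_le (by norm_num)) (hC δ).1).trans (le_of_eq ?_)
    rw [sq_abs]; ring
  refine ⟨fun δ => onCircle (H δ), R, fun δ hδ => isStationaryDensity_onCircle hE
    (hF7.of_le (by norm_num)) (hρ.noise_eq hδ.1) (hH δ) (hfix δ) (hint δ) (hpos δ), hR, hWV,
    ?_, ?_, 2 * C, Eventually.of_forall hun⟩
  · have hbound : ∀ δ > 0, sobolevNorm 1 (fun x => (onCircle (H δ) x - onCircle (H 0) x) / δ ^ 2 -
        noiseVariance ρ / 2 * R (weakDeriv 2 (onCircle (H 0))) x) ≤ K * (2 * C) * δ := by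
      intro δ hδ
      set z : ℝ → ℝ := fun y => H δ y - H 0 y - E.transferOp (fun z => H δ z - H 0 z) y -
        δ ^ 2 * (noiseVariance ρ / 2) * iteratedDeriv 2 (H 0) y with hz
      have hLu := (hu δ).transferOp hF7
      have hzC : IsPerC 1 z := (((hu δ).sub hLu).of_le (m := 1) (by norm_num)).sub
        ((hw.of_le (m := 1) (by norm_num)).const_mul _)
      have hz0 : ∫ x in (0:ℝ)..1, z x = 0 := by
        rw [hz, intervalIntegral.integral_sub (((hu δ).sub hLu).intervalIntegrable _ _)
          ((hw.const_mul _).intervalIntegrable _ _), intervalIntegral.integral_sub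
          ((hu δ).intervalIntegrable _ _) (hLu.intervalIntegrable _ _),
          ExpandingLift.integral_transferOp (hu δ).periodic ((hu δ).intervalIntegrable _ _),
          intervalIntegral.integral_const_mul, hui, hw0]
        simp
      have hzV := hzC.memV_onCircle hz0
      have hzn := sobolevNorm_one_onCircle_le hzC (hC δ).2
      have hδ2 : |(δ ^ 2)⁻¹| = (δ ^ 2)⁻¹ := abs_of_pos (by positivity)
      have h1 := hK _ _ (fun x => (δ ^ 2)⁻¹ * onCircle z x) (δ ^ 2)⁻¹ (noiseVariance ρ / 2)
        (huV δ) hWV (by simpa using hzV.const_mul_sub hzV (δ ^ 2)⁻¹ 0) (by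
          filter_upwards [hW] with x hx
          rw [hx, circleTransfer_onCircle (hu δ).periodic]
          simp only [onCircle, hz]
          field_simp)
      rw [sobolevNorm_one_const_mul hzV.1, hδ2] at h1
      have e : (fun x => (onCircle (H δ) x - onCircle (H 0) x) / δ ^ 2 -
          noiseVariance ρ / 2 * R (weakDeriv 2 (onCircle (H 0))) x) =
          fun x => (δ ^ 2)⁻¹ * onCircle (fun x => H δ x - H 0 x) x -
            noiseVariance ρ / 2 * R (weakDeriv 2 (onCircle (H 0))) x := by
        funext x
        rw [div_eq_inv_mul]; rfl
      rw [e]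
      refine h1.trans ?_
      rw [mul_assoc]
      refine mul_le_mul_of_nonneg_left ?_ hK0
      rw [inv_mul_le_iff₀ (by positivity)]
      refine hzn.trans (le_of_eq ?_)
      rw [abs_of_pos hδ]; ring
    have hlim : Tendsto (fun δ : ℝ => K * (2 * C) * δ) (𝓝[>] 0) (𝓝 0) := by
      have h1 : Continuous fun δ : ℝ => K * (2 * C) * δ := by fun_prop
      simpa using (h1.tendsto 0).mono_left (nhdsWithin_le_nhds (s := Set.Ioi 0))
    exact squeeze_zero' (Eventually.of_forall fun δ => sobolevNorm_one_nonneg _)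
      (eventually_mem_nhdsWithin.mono hbound) hlim
  · have hlim : Tendsto (fun δ : ℝ => 2 * C * δ) (𝓝[>] 0) (𝓝 0) := by
      have h1 : Continuous fun δ : ℝ => 2 * C * δ := by fun_prop
      simpa using (h1.tendsto 0).mono_left (nhdsWithin_le_nhds (s := Set.Ioi 0))
    refine squeeze_zero' (Eventually.of_forall fun δ => sobolevNorm_one_nonneg _)
      (eventually_mem_nhdsWithin.mono fun δ (hδ : 0 < δ) => ?_) hlim
    have e : (fun x => (onCircle (H δ) x - onCircle (H 0) x) / δ) =
        fun x => δ⁻¹ * onCircle (fun x => H δ x - H 0 x) x := by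
      funext x
      rw [div_eq_inv_mul]; rfl
    rw [e, sobolevNorm_one_const_mul (huV δ).1, abs_of_pos (inv_pos.2 hδ), inv_mul_le_iff₀ hδ]
    exact (hun δ).trans (le_of_eq (by ring))
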